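/- **Notation.** Let $K$ be a complete normed field of characteristic $0$ and $q\in K$ with $0<|q|<1$ (for instance $K=\mathbb C$, or $K=\mathbb Q((q))$ with its $q$-adic norm, in which case $q$ is a formal variable). Put $(a;q)_n=\prod_{0\le t<n}(1-aq^t)$, $(a;q)_\infty=\prod_{t\ge0}(1-aq^t)$, $(a)_n=(a;q)_n$, and $$Q(s,t)=\prod_{n\ge1}(1-s^n)(1-s^nt)(1-s^{n-1}t^{-1})(1-s^{2n-1}t^2)(1-s^{2n-1}t^{-2}).$$ The standard $A_2^{(2)}$-modules of level $\ell$ are labelled $L(s_0,s_1)$ with $s_0,s_1\ge 0$, $s_0+2s_1=\ell$. With $M=\ell+3$, the principal character of $L(s_0,s_1)$ (the principally specialized character of its vacuum space) is, throughout this statement, taken in its product form $$\chi_{s_0,s_1}=\frac{(q^{s_1+1};q^M)_\infty(q^{s_0+s_1+2};q^M)_\infty(q^{M};q^M)_\infty\,(q^{s_0+1};q^{2M})_\infty(q^{s_0+4s_1+5};q^{2M})_\infty}{(q)_\infty};$$ it has modulus $2\ell+6$. A pair of sequences $(\alpha_n,\beta_n)_{n\ge0}$ is a Bailey pair with base $a$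 if $\beta_n=\sum_{t=0}^n\frac{\alpha_t}{(q)_{n-t}(aq)_{n+t}}$ for all $n\ge0$. Write $\widetilde\alpha_n=\frac{1-a}{1-aq^{2n}}\alpha_n$. **Initial pairs.** | # | $a$ | $\beta_n$ | $\widetilde\alpha_m$, $m\equiv0$ (mod 3) | $m\equiv1$ | $m\equiv2$ | |---|---|---|---|---|---| | 1 | $q$ | $1/(q)_{2n}$ | $q^{(2m^2-m)/3}$ | $0$ | $-q^{(2m^2-m)/3}$ | | 2 | $q^2$ | $1/(q^2)_{2n}$ | $q^{(2m^2+m)/3}$ | $-q^{(2m^2+m)/3}$ | $0$ | | 3 | $q$ | $q^{n^2-n}/(q)_{2n}$ | $q^{(m^2-2m)/3}$ | $0$ | $-q^{(m^2-2m)/3}$ | | 4 | $q^2$ | $q^{n^2}/(q^2)_{2n}$ | $q^{(m^2-m)/3}$ | $-q^{(m^2-m)/3}$ | $0$ | | 5 | $q$ | $\frac{(-1;q^3)_n}{(q)_{2n}(-1)_n}$ | $q^{(m^2-m)/2}$ | $0$ | $-q^{(m^2-m)/2}$ | **Moves.** From a pair $(\alpha,\beta)$ with base $a$ they produce a pair $(\alpha',\beta')$;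 F1, B1, F2 keep the base $a$, and BC1, BC2 change it to $a/q$. For BC1 and BC2, $\alpha_0'=\alpha_0$ and the formula for $\alpha'_n$ is for $n\ge1$. - F1: $\beta_n'=\sum_{j=0}^n\frac{a^jq^{j^2}}{(q)_{n-j}}\beta_j$, $\ \alpha_n'=a^nq^{n^2}\alpha_n$. - B1: $\beta_n'=(-1)^na^{-n}q^{-n^2}\sum_{j=0}^n(-1)^j\frac{q^{\binom{n-j}2}}{(q)_{n-j}}\beta_j$, $\ \alpha_n'=a^{-n}q^{-n^2}\alpha_n$. - F2: $\beta_n'=\sum_{j=0}^n\frac{(-q)_jq^{\binom j2}a^j}{(q)_{n-j}(-a)_n}\beta_j$, $\ \alpha_n'=\frac{(-q)_nq^{\binom n2}a^n}{(-a)_n}\alpha_n$. - BC1: $\beta_n'=\sum_{j=0}^n\frac{a^jq^{j^2-j}}{(q)_{n-j}}\beta_j$, $\ \alpha_n'=a^nq^{n^2-n}(\widetilde\alpha_n-aq^{2n-2}\widetilde\alpha_{n-1})$. - BC2: $\beta_n'=\sum_{j=0}^n\frac{(-q)_j}{(-a/q)_n}\frac{a^jq^{\binom j2-j}}{(q)_{n-j}}\beta_j$,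 $\ \alpha_n'=\frac{(-q)_na^nq^{\binom n2-n}}{(-a/q)_n}(\widetilde\alpha_n-aq^{2n-2}\widetilde\alpha_{n-1})$. For an integer $d$ let F1$^d$ mean $d$ moves F1 if $d\ge0$ and $|d|$ moves B1 if $d<0$. **Move sequences** (applied from left to right, $k\ge1$, $i\ge0$). - (I) no F2: F1$^{k}$ if $i=0$; F1$^{k-i}$, BC1, F1$^{i-1}$ if $i\ge1$. - (II) F2 at the end: F1$^{k-1}$, F2 if $i=0$; F1$^{k-1}$, BC2 if $i=1$; F1$^{k-i}$, BC1, F1$^{i-2}$, F2 if $i\ge2$. - (III) F2 at the beginning: F2, F1$^{k-1}$ if $i=0$; F2, F1$^{k-i-1}$, BC1, F1$^{i-1}$ if $i\ge1$. **Multi-sums.** Let $a$ and $\beta$ be the base and the $\beta$-sequence of the initial pair, let $r$ be the number of moves ($r=k$ if $i\le k$ in (I), (II) and if $i\le k-1$ in (III); otherwise $r=2i-k$ in (I), (II) and $r=2i-k+2$ in (III)). For $\mathbf j=(j_1\ge\dots\ge j_r\ge0)$ put $D=(q)_{j_1-j_2}\cdots(q)_{j_{r-1}-j_r}$ and $B_{u,v}=\sum_{m=u}^v\binom{j_m-j_{m+1}}2$,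 and let $w(\mathbf j)$ be: - (I), $i\le k$: $\ a^{j_1+\dots+j_k}q^{j_1^2+\dots+j_k^2-(j_1+\dots+j_i)}D^{-1}\beta_{j_k}$. - (I), $i>k$: $\ (-1)^{j_i+j_r}a^{(j_1+\dots+j_{i-1})-(j_{i+1}+\dots+j_{r-1})}q^{(j_1^2+\dots+j_{i-1}^2)-(j_{i+1}^2+\dots+j_{r-1}^2)-(j_1+\dots+j_i)+B_{i,r-1}}D^{-1}\beta_{j_r}$. - (II): the expressions of (I) with the exponent $j_1^2$ of $q$ replaced by $\binom{j_1}2$, times $(-q)_{j_1}$. - (III), $i\le k-1$: $\ a^{j_1+\dots+j_k}q^{j_1^2+\dots+j_{k-1}^2-(j_1+\dots+j_i)+\binom{j_k}2}(-q)_{j_k}D^{-1}(-a)_{j_{k-1}}^{-1}\beta_{j_k}$, where the factor $(-a)_{j_{k-1}}^{-1}$ is omitted if $k=1$. - (III), $i\ge k$: $\ (-1)^{j_i+j_{r-1}}(-q)_{j_r}a^{(j_1+\dots+j_{i-1})-(j_{i+1}+\dots+j_{r-2})+j_r}q^{(j_1^2+\dots+j_{i-1}^2)-(j_{i+1}^2+\dots+j_{r-2}^2)-(j_1+\dots+j_i)+B_{i,r-2}+\binom{j_r}2}D^{-1}(-a)_{j_{r-1}}^{-1}\beta_{j_r}$.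 For $0\le n\le\infty$ let $E_n=1$ in (I); in (II), $E_n=(-a)_n$ if $i=0$ and $E_n=(-a/q)_n$ if $i\ge1$; in (III), $E_n=(-a)_n$ if $k=1$ and $i=0$, and $E_n=1$ otherwise. **List of identities** ($k\ge1$). | Pair | Moves | level $\ell$ | number of modules | modulus | $i$ | $s_1$ | |---|---|---|---|---|---|---| | 1 | (I) | $6k+1$ | $3k+1$ | $12k+8$ | $0\le i\le3k$ | $i$ | | 1 | (III) | $6k-2$ | $3k$ | $12k+2$ | $0\le i\le3k-1$ | $i$ | | 2 | (I) | $6k+1$ | $3k+1$ | $12k+8$ | $0\le i\le3k$ | $3k-i$ | | 2 | (II) | $6k-2$ | $3k$ | $12k+2$ | $0\le i\le3k-1$ | $3k-1-i$ | | 3 | (I) | $6k-1$ | $3k$ | $12k+4$ | $0\le i\le3k-1$ | $i$ | | 3 | (III) | $6k-4$ | $3k-1$ | $12k-2$ | $0\le i\le3k-2$ | $i$ | | 4 | (I) | $6k-1$ | $3k$ | $12k+4$ | $0\le i\le3k-1$ | $3k-1-i$ | | 4 | (II) | $6k-4$ | $3k-1$ | $12k-2$ | $0\le i\le3k-2$ |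 $3k-2-i$ | | 5 | (I) | $6k$ | $3k+1$ | $12k+6$ | $0\le i\le3k$ | $i$ | | 5 | (III) | $6k-3$ | $3k-1$ | $12k$ | $0\le i\le3k-2$ | $i$ | **Theorem.** 1. The five initial pairs are Bailey pairs. 2. For all $s_0,s_1\ge0$, with $\ell=s_0+2s_1$, $\ \chi_{s_0,s_1}=Q(q^{\ell+3},q^{-s_1-1})/(q)_\infty$. 3. In each row and for each $k\ge1$, the modulus is $2\ell+6$, the given number of modules is the number of $(s_0,s_1)$ with $s_0+2s_1=\ell$, and $i\mapsto(\ell-2s_1,s_1)$ is a bijection from the given range of $i$ onto these $(s_0,s_1)$. 4. For each row, each $k\ge1$, each $i$ in the given range (values $i>k$ included), and $s_0=\ell-2s_1$: the moves applied to the initial pair give a Bailey pair $(\alpha^{\rm final},\beta^{\rm final})$ (with base $a$ if $i=0$ and $a/q$ if $i\ge1$); for all $n\ge 0$ $$\beta_n^{\rm final}=\sum_{n\ge j_1\ge\dots\ge j_r\ge0}\frac{w(\mathbf j)}{(q)_{n-j_1}E_n};$$ and $$\lim_{n\to\infty}(q)_\infty\beta_n^{\rm final}=\sum_{j_1\ge0}\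 \Bigl(\sum_{j_1\ge j_2\ge\dots\ge j_r\ge0}\frac{w(\mathbf j)}{E_\infty}\Bigr)=c\cdot\chi_{s_0,s_1},$$ where the limit exists, the outer series over $j_1$ converges unconditionally, and $c=1$ for pairs 1, 3, 5, $c=1-q$ for pairs 2, 4, except that $c=1-q^2$ for pairs 2, 4 with moves (II) and $i=0$. 5. For every $\ell\ge2$ there are exactly one row with pair 1, 3 or 5 and exactly one $k\ge1$ with level $\ell$; so by 3 and 4 these three pairs give a sum side for every module of every level $\ell\ge2$. The six rows with pairs 1, 3, 5 are six families according to $\ell$ modulo $6$: two levels occurring in these rows are congruent modulo $6$ if and only if they belong to the same row. 6. For every $\ell\ge2$ that is not divisible by $3$ there are also exactly one row with pair 2 or 4 and exactly one $k\ge1$ with level $\ell$. -/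

import Mathlib

open Finset Filter Topology

namespace A22

/-! ### q-products -/

/-- The finite `q`-Pochhammer symbol `(a; q)_n = ∏_{0 ≤ t < n} (1 - a q^t)`. -/
def qPoch {K : Type*} [Field K] (a q : K) (n : ℕ) : K :=
  ∏ t ∈ range n, (1 - a * q ^ t)

/-- The infinite `q`-Pochhammer symbol `(a; q)_∞ = ∏_{t ≥ 0} (1 - a q^t)`. -/
noncomputable def qPochInf {K : Type*} [Field K] [TopologicalSpace K] (a q : K) : K :=
  ∏' t : ℕ, (1 - a * q ^ t)

/-- The product `Q(s, t)` of the quintuple product identity,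
`∏_{n ≥ 1} (1 - s^n)(1 - s^n t)(1 - s^{n-1} t⁻¹)(1 - s^{2n-1} t²)(1 - s^{2n-1} t⁻²)`;
the index below is `n - 1`. -/
noncomputable def quintupleQ {K : Type*} [Field K] [TopologicalSpace K] (s t : K) : K :=
  ∏' n : ℕ, ((1 - s ^ (n + 1)) * (1 - s ^ (n + 1) * t) * (1 - s ^ n * t⁻¹) *
    (1 - s ^ (2 * n + 1) * t ^ 2) * (1 - s ^ (2 * n + 1) * (t ^ 2)⁻¹))

/-- The principal character of the standard `A_2^{(2)}`-module `L(s₀, s₁)` (the principally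
specialized character of its vacuum space), in its product form
`(q^{s₁+1}, q^{s₀+s₁+2}, q^{M}; q^{M})_∞ (q^{s₀+1}, q^{s₀+4s₁+5}; q^{2M})_∞ / (q; q)_∞`,
where `M = s₀ + 2 s₁ + 3`. -/
noncomputable def principalChar {K : Type*} [Field K] [TopologicalSpace K]
    (q : K) (s₀ s₁ : ℕ) : K :=
  qPochInf (q ^ (s₁ + 1)) (q ^ (s₀ + 2 * s₁ + 3)) *
    qPochInf (q ^ (s₀ + s₁ + 2)) (q ^ (s₀ + 2 * s₁ + 3)) *
    qPochInf (q ^ (s₀ + 2 * s₁ + 3)) (q ^ (s₀ + 2 * s₁ + 3)) *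
    qPochInf (q ^ (s₀ + 1)) (q ^ (2 * (s₀ + 2 * s₁ + 3))) *
    qPochInf (q ^ (s₀ + 4 * s₁ + 5)) (q ^ (2 * (s₀ + 2 * s₁ + 3))) / qPochInf q q

/-! ### Bailey pairs -/

/-- A pair of sequences `α`, `β` together with a base. -/
structure SeqPair (K : Type*) where
  base : K
  α : ℕ → K
  β : ℕ → K

/-- `β_n = ∑_{t=0}^n α_t / ((q)_{n-t} (aq)_{n+t})` for all `n`, where `a` is the base. -/
def IsBaileyPair {K : Type*} [Field K] (q : K) (P : SeqPair K) : Prop :=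
  ∀ n : ℕ, P.β n =
    ∑ t ∈ range (n + 1), P.α t / (qPoch q q (n - t) * qPoch (P.base * q) q (n + t))

/-- `α̃_n = (1 - a) / (1 - a q^{2n}) α_n`. -/
def SeqPair.tilde {K : Type*} [Field K] (q : K) (P : SeqPair K) (n : ℕ) : K :=
  (1 - P.base) / (1 - P.base * q ^ (2 * n)) * P.α n

/-- The names of the five initial Bailey pairs. -/
inductive PairNo
  | one | two | three | four | five

/-- The base of each initial pair: `q` for pairs 1, 3, 5 and `q²` for pairs 2, 4. -/
def PairNo.base {K : Type*} [Field K] (q : K) : PairNo → K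
  | one => q
  | two => q ^ 2
  | three => q
  | four => q ^ 2
  | five => q

/-- The sequence `β_n` of each initial pair. -/
def PairNo.beta {K : Type*} [Field K] (q : K) : PairNo → ℕ → K
  | one, n => 1 / qPoch q q (2 * n)
  | two, n => 1 / qPoch (q ^ 2) q (2 * n)
  | three, n => q ^ (n ^ 2 - n) / qPoch q q (2 * n)
  | four, n => q ^ (n ^ 2) / qPoch (q ^ 2) q (2 * n)
  | five, n => qPoch (-1) (q ^ 3) n / (qPoch q q (2 * n) * qPoch (-1) q n)

/-- A sequence given according to the residue of the index modulo 3. -/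
def byResidue {K : Type*} (f₀ f₁ f₂ : ℕ → K) (m : ℕ) : K :=
  if m % 3 = 0 then f₀ m else if m % 3 = 1 then f₁ m else f₂ m

/-- The sequence `α̃_m` of each initial pair. All divisions in the exponents are exact, and no
subtraction truncates, for the residues of `m` at which they are used. -/
def PairNo.alphaTilde {K : Type*} [Field K] (q : K) : PairNo → ℕ → K
  | one => byResidue (fun m => q ^ ((2 * m ^ 2 - m) / 3)) (fun _ => 0)
      (fun m => -q ^ ((2 * m ^ 2 - m) / 3))
  | two => byResidue (fun m => q ^ ((2 * m ^ 2 + m) / 3))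
      (fun m => -q ^ ((2 * m ^ 2 + m) / 3)) (fun _ => 0)
  | three => byResidue (fun m => q ^ ((m ^ 2 - 2 * m) / 3)) (fun _ => 0)
      (fun m => -q ^ ((m ^ 2 - 2 * m) / 3))
  | four => byResidue (fun m => q ^ ((m ^ 2 - m) / 3))
      (fun m => -q ^ ((m ^ 2 - m) / 3)) (fun _ => 0)
  | five => byResidue (fun m => q ^ ((m ^ 2 - m) / 2)) (fun _ => 0)
      (fun m => -q ^ ((m ^ 2 - m) / 2))

/-- The initial pair: `α_n` is recovered from `α̃_n = (1 - a) / (1 - a q^{2n}) α_n`. -/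
def PairNo.pair {K : Type*} [Field K] (q : K) (p : PairNo) : SeqPair K where
  base := p.base q
  α := fun n => (1 - p.base q * q ^ (2 * n)) / (1 - p.base q) * p.alphaTilde q n
  β := p.beta q

/-! ### Moves -/

/-- The first forward move. -/
def moveF1 {K : Type*} [Field K] (q : K) (P : SeqPair K) : SeqPair K where
  base := P.base
  α := fun n => P.base ^ n * q ^ (n ^ 2) * P.α n
  β := fun n => ∑ j ∈ range (n + 1),
    P.base ^ j * q ^ (j ^ 2) / qPoch q q (n - j) * P.β j

/-- The first backward move. -/
def moveB1 {K : Type*} [Field K] (q : K) (P : SeqPair K) : SeqPair K where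
  base := P.base
  α := fun n => (P.base ^ n)⁻¹ * (q ^ (n ^ 2))⁻¹ * P.α n
  β := fun n => (-1) ^ n * (P.base ^ n)⁻¹ * (q ^ (n ^ 2))⁻¹ * ∑ j ∈ range (n + 1),
    (-1) ^ j * q ^ ((n - j).choose 2) / qPoch q q (n - j) * P.β j

/-- The second forward move. -/
def moveF2 {K : Type*} [Field K] (q : K) (P : SeqPair K) : SeqPair K where
  base := P.base
  α := fun n => qPoch (-q) q n * q ^ (n.choose 2) * P.base ^ n / qPoch (-P.base) q n * P.α n
  β := fun n => ∑ j ∈ range (n + 1),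
    qPoch (-q) q j * q ^ (j.choose 2) * P.base ^ j /
      (qPoch q q (n - j) * qPoch (-P.base) q n) * P.β j

/-- The bracket `α̃_n - a q^{2n-2} α̃_{n-1}` of the base change moves, used for `n ≥ 1`. -/
def bracket {K : Type*} [Field K] (q : K) (P : SeqPair K) (n : ℕ) : K :=
  P.tilde q n - P.base * q ^ (2 * n - 2) * P.tilde q (n - 1)

/-- The first base change move. -/
def moveBC1 {K : Type*} [Field K] (q : K) (P : SeqPair K) : SeqPair K where
  base := P.base / q
  α := fun n => if n = 0 then P.α 0 else P.base ^ n * q ^ (n ^ 2 - n) * bracket q P n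
  β := fun n => ∑ j ∈ range (n + 1),
    P.base ^ j * q ^ (j ^ 2 - j) / qPoch q q (n - j) * P.β j

/-- The second base change move. -/
def moveBC2 {K : Type*} [Field K] (q : K) (P : SeqPair K) : SeqPair K where
  base := P.base / q
  α := fun n => if n = 0 then P.α 0 else
    qPoch (-q) q n * P.base ^ n * q ^ ((n.choose 2 : ℤ) - n) / qPoch (-(P.base / q)) q n *
      bracket q P n
  β := fun n => ∑ j ∈ range (n + 1),
    qPoch (-q) q j / qPoch (-(P.base / q)) q n *
      (P.base ^ j * q ^ ((j.choose 2 : ℤ) - j) / qPoch q q (n - j)) * P.β j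

/-- The three kinds of move sequences: no second forward move, second forward move (or second
base change) at the end, second forward move at the beginning. -/
inductive MoveSeq
  | noF2 | F2End | F2Begin

/-- `d` forward moves of the first kind if `d ≥ 0`, and `|d|` backward moves if `d < 0`. -/
def shiftMoves {K : Type*} [Field K] (q : K) (d : ℤ) (P : SeqPair K) : SeqPair K :=
  if 0 ≤ d then (moveF1 q)^[d.natAbs] P else (moveB1 q)^[d.natAbs] P

/-- The pair obtained from `P` by the move sequence with parameters `k` and `i`. -/
def MoveSeq.run {K : Type*} [Field K] (q : K) (k i : ℕ) (P : SeqPair K) : MoveSeq → SeqPair K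
  | noF2 =>
      if i = 0 then shiftMoves q k P
      else (moveF1 q)^[i - 1] (moveBC1 q (shiftMoves q ((k : ℤ) - i) P))
  | F2End =>
      if i = 0 then moveF2 q ((moveF1 q)^[k - 1] P)
      else if i = 1 then moveBC2 q ((moveF1 q)^[k - 1] P)
      else moveF2 q ((moveF1 q)^[i - 2] (moveBC1 q (shiftMoves q ((k : ℤ) - i) P)))
  | F2Begin =>
      if i = 0 then shiftMoves q ((k : ℤ) - 1) (moveF2 q P)
      else (moveF1 q)^[i - 1] (moveBC1 q (shiftMoves q ((k : ℤ) - i - 1) (moveF2 q P)))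

/-! ### Explicit multi-sums -/

/-- The entry `j_m` (`1 ≤ m ≤ r`) of a tuple `(j_1, …, j_r)`; zero for other `m`. -/
def entry {r : ℕ} (J : Fin r → ℕ) (m : ℕ) : ℕ :=
  if h : 1 ≤ m ∧ m ≤ r then J ⟨m - 1, by omega⟩ else 0

open Classical in
/-- All tuples with `n ≥ j_1 ≥ j_2 ≥ ⋯ ≥ j_r ≥ 0`. -/
noncomputable def chains (r n : ℕ) : Finset (Fin r → ℕ) :=
  (Fintype.piFinset fun _ : Fin r => range (n + 1)).filter fun J => Antitone J

/-- All tuples with `N = j_1 ≥ j_2 ≥ ⋯ ≥ j_r ≥ 0`. -/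
noncomputable def chainsFrom (r N : ℕ) : Finset (Fin r → ℕ) :=
  (chains r N).filter fun J => entry J 1 = N

/-- The number of summation variables, which is the number of moves. -/
def MoveSeq.len (k i : ℕ) : MoveSeq → ℕ
  | noF2 => if i ≤ k then k else 2 * i - k
  | F2End => if i ≤ k then k else 2 * i - k
  | F2Begin => if i + 1 ≤ k then k else 2 * i + 2 - k

/-- `j_u + ⋯ + j_v`. -/
def lin (j : ℕ → ℕ) (u v : ℕ) : ℤ := ∑ m ∈ Icc u v, (j m : ℤ)

/-- `j_u² + ⋯ + j_v²`. -/
def sqr (j : ℕ → ℕ) (u v : ℕ) : ℤ := ∑ m ∈ Icc u v, (j m : ℤ) ^ 2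

/-- `C(j_u - j_{u+1}, 2) + ⋯ + C(j_v - j_{v+1}, 2)`. -/
def bin (j : ℕ → ℕ) (u v : ℕ) : ℤ := ∑ m ∈ Icc u v, ((j m - j (m + 1)).choose 2 : ℤ)

/-- `(q)_{j_1 - j_2} ⋯ (q)_{j_{r-1} - j_r}`. -/
def den {K : Type*} [Field K] (q : K) (j : ℕ → ℕ) (r : ℕ) : K :=
  ∏ m ∈ Icc 1 (r - 1), qPoch q q (j m - j (m + 1))

/-- The summand of the multi-sum for `β_n`, without the factors that depend on the outer
index `n`. Here `a` and `β` are the base and the `β`-sequence of the initial pair. -/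
def MoveSeq.summand {K : Type*} [Field K] (q a : K) (β : ℕ → K) (k i : ℕ) (j : ℕ → ℕ) :
    MoveSeq → K
  | noF2 =>
      if i ≤ k then
        a ^ lin j 1 k * q ^ (sqr j 1 k - lin j 1 i) / den q j k * β (j k)
      else
        (-1) ^ (j i + j (2 * i - k)) *
          a ^ (lin j 1 (i - 1) - lin j (i + 1) (2 * i - k - 1)) *
          q ^ (sqr j 1 (i - 1) - sqr j (i + 1) (2 * i - k - 1) - lin j 1 i +
            bin j i (2 * i - k - 1)) /
          den q j (2 * i - k) * β (j (2 * i - k))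
  | F2End =>
      if i ≤ k then
        qPoch (-q) q (j 1) * a ^ lin j 1 k *
          q ^ (((j 1).choose 2 : ℤ) + sqr j 2 k - lin j 1 i) / den q j k * β (j k)
      else
        (-1) ^ (j i + j (2 * i - k)) * qPoch (-q) q (j 1) *
          a ^ (lin j 1 (i - 1) - lin j (i + 1) (2 * i - k - 1)) *
          q ^ (((j 1).choose 2 : ℤ) + sqr j 2 (i - 1) - sqr j (i + 1) (2 * i - k - 1) -
            lin j 1 i + bin j i (2 * i - k - 1)) /
          den q j (2 * i - k) * β (j (2 * i - k))
  | F2Begin =>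
      if i + 1 ≤ k then
        a ^ lin j 1 k *
          q ^ (sqr j 1 (k - 1) - lin j 1 i + ((j k).choose 2 : ℤ)) * qPoch (-q) q (j k) /
          (den q j k * if k = 1 then 1 else qPoch (-a) q (j (k - 1))) * β (j k)
      else
        (-1) ^ (j i + j (2 * i - k + 1)) * qPoch (-q) q (j (2 * i - k + 2)) *
          a ^ (lin j 1 (i - 1) - lin j (i + 1) (2 * i - k) + (j (2 * i - k + 2) : ℤ)) *
          q ^ (sqr j 1 (i - 1) - sqr j (i + 1) (2 * i - k) - lin j 1 i +
            bin j i (2 * i - k) + ((j (2 * i - k + 2)).choose 2 : ℤ)) /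
          (den q j (2 * i - k + 2) * qPoch (-a) q (j (2 * i - k + 1))) * β (j (2 * i - k + 2))

/-- The factor `(-a)_n`, `(-a/q)_n` or `1` in the denominator of the multi-sum which depends on
the outer index `n` (besides `(q)_{n - j_1}`). The argument `poch x` stands for `(x; q)_n`, so
that `n = ∞` is possible too. -/
def MoveSeq.outer {K : Type*} [Field K] (poch : K → K) (q a : K) (k i : ℕ) : MoveSeq → K
  | noF2 => 1
  | F2End => if i = 0 then poch (-a) else poch (-(a / q))
  | F2Begin => if k = 1 ∧ i = 0 then poch (-a) else 1

/-- The multi-sum for the sequence `β` of the pair obtained by the moves. -/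
noncomputable def multiSum {K : Type*} [Field K] (q : K) (p : PairNo) (μ : MoveSeq)
    (k i n : ℕ) : K :=
  ∑ J ∈ chains (μ.len k i) n,
    μ.summand q (p.base q) (p.beta q) k i (entry J) /
      (qPoch q q (n - entry J 1) * μ.outer (fun x => qPoch x q n) q (p.base q) k i)

/-- The part with `j_1 = N` of the infinite multi-sum (the sum side). -/
noncomputable def sumSideTerm {K : Type*} [Field K] [TopologicalSpace K] (q : K) (p : PairNo)
    (μ : MoveSeq) (k i N : ℕ) : K :=
  ∑ J ∈ chainsFrom (μ.len k i) N,
    μ.summand q (p.base q) (p.beta q) k i (entry J) /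
      μ.outer (fun x => qPochInf x q) q (p.base q) k i

/-- The simple factor on the product side: `1` for the pairs with base `q`; for those with base
`q²` it is `1 - q`, or `1 - q²` if the second forward move is used at the end and `i = 0`. -/
def simpleFactor {K : Type*} [Field K] (q : K) : PairNo → MoveSeq → ℕ → K
  | .two, .F2End, i => if i = 0 then 1 - q ^ 2 else 1 - q
  | .four, .F2End, i => if i = 0 then 1 - q ^ 2 else 1 - q
  | .two, _, _ => 1 - q
  | .four, _, _ => 1 - q
  | _, _, _ => 1

/-! ### Modules and identities -/

/-- A row of the list of identities: the initial pair, the move sequence and, as functions of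
`k ≥ 1`, the level, the number of modules of that level, the modulus, the largest `i`, and `s₁`
as a function of `k` and `i`. -/
structure Row where
  pair : PairNo
  moves : MoveSeq
  level : ℕ → ℕ
  numModules : ℕ → ℕ
  modulus : ℕ → ℕ
  iMax : ℕ → ℕ
  s₁ : ℕ → ℕ → ℕ

/-- The list of identities. Subtractions never truncate for `k ≥ 1` and `i ≤ iMax k`. -/
def table : Fin 10 → Row := ![
  ⟨.one, .noF2, fun k => 6 * k + 1, fun k => 3 * k + 1, fun k => 12 * k + 8,
    fun k => 3 * k, fun _ i => i⟩,
  ⟨.one, .F2Begin, fun k => 6 * k - 2, fun k => 3 * k, fun k => 12 * k + 2,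
    fun k => 3 * k - 1, fun _ i => i⟩,
  ⟨.two, .noF2, fun k => 6 * k + 1, fun k => 3 * k + 1, fun k => 12 * k + 8,
    fun k => 3 * k, fun k i => 3 * k - i⟩,
  ⟨.two, .F2End, fun k => 6 * k - 2, fun k => 3 * k, fun k => 12 * k + 2,
    fun k => 3 * k - 1, fun k i => 3 * k - 1 - i⟩,
  ⟨.three, .noF2, fun k => 6 * k - 1, fun k => 3 * k, fun k => 12 * k + 4,
    fun k => 3 * k - 1, fun _ i => i⟩,
  ⟨.three, .F2Begin, fun k => 6 * k - 4, fun k => 3 * k - 1, fun k => 12 * k - 2,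
    fun k => 3 * k - 2, fun _ i => i⟩,
  ⟨.four, .noF2, fun k => 6 * k - 1, fun k => 3 * k, fun k => 12 * k + 4,
    fun k => 3 * k - 1, fun k i => 3 * k - 1 - i⟩,
  ⟨.four, .F2End, fun k => 6 * k - 4, fun k => 3 * k - 1, fun k => 12 * k - 2,
    fun k => 3 * k - 2, fun k i => 3 * k - 2 - i⟩,
  ⟨.five, .noF2, fun k => 6 * k, fun k => 3 * k + 1, fun k => 12 * k + 6,
    fun k => 3 * k, fun _ i => i⟩,
  ⟨.five, .F2Begin, fun k => 6 * k - 3, fun k => 3 * k - 1, fun k => 12 * k,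
    fun k => 3 * k - 2, fun _ i => i⟩]

/-- The pairs `(s₀, s₁)` that label the standard modules `L(s₀, s₁)` of level `ℓ`. -/
def modulesOfLevel (l : ℕ) : Set (ℕ × ℕ) := {s | s.1 + 2 * s.2 = l}

end A22

namespace A22

section Finite

variable {K : Type*} [Field K]

/-! ### Finite `q`-products -/

/-! For a Bailey pair with base `a` and summable `α`, letting `n → ∞` in the defining relation gives
`lim (q)_∞ β_n = (∑ α_t) / (aq)_∞`. An identity therefore follows once the final `β` is known to be
the multi-sum and the final `∑ α` to be, up to a constant, the numerator of the character.

Moves. F1, B1 and F2 multiply `α_t` by a factor and apply a kernel to `β`. Since `(aq)_{2t+i} =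
(aq)_{2t} (aq^{2t+1})_i`, preservation of Bailey pairs reduces to a `q`-Chu–Vandermonde sum with
base `a q^{2t}` (`IsBaileyPair.of_kernel`, `chu_vandermonde` and its two degenerate forms). BC1 and
BC2 are F1 and F2 preceded by a change of base from `a` to `a/q` that leaves `β` alone
(`IsBaileyPair.changeBase`). So every move sequence is a final F1 or F2 applied to some Bailey pair
(`MoveSeq.run_eq`), and composing the kernels gives the multi-sum (`sum_chainsFrom_pathWeight`,
`MoveSeq.summand_eq`).

Initial pairs. For `a = q^e` the reflection `t ↦ -t - e` exchanges `(q)_{n-t}` and `(q)_{n+t+e}`. It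
folds the nonzero residue classes of `t` modulo 3 into one bilateral sum over `t = 3r` with terms of
the form `q` to a quadratic polynomial in `r`. A rational certificate shows that this sum obeys the
same first-order recurrence in `n` as `β_n` (`telescoping_recurrence`).

Evaluation. The final `α_m` is a constant times `A_m - B_m` if `i = 0`, and `A_m - B_{m-1}` if `i ≥
1`, where `A = partA` and `B = partB` are `α̃_m` times explicit powers of `q`; in both cases `∑ (A_m
- B_m)` is what matters. Separating residues modulo 3 turns it into a difference of two theta series
over `ℤ` (`hasSum_parts_of_base_one`, `hasSum_parts_of_base_two`). That difference is the quintuple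
product series with base `q^M` and `z = -q^{s₁+1}` (`theta_sub_theta`). The quintuple product
identity is itself the limit of a terminating sum proved by telescoping (`finite_quintuple`,
`hasSum_quintTerm`).

Convergence. Tannery's theorem is applied twice, to the expansion of the final `β` in `α` and to its
expression through the last kernel (`IsBaileyPair.tendsto_and_hasSum`). The factors `1 - q` and `1 -
q²` are what remains of `(q)_∞ / (aq)_∞`. The statements about levels and rows are arithmetic modulo
6. -/

@[simp] theorem qPoch_zero (a q : K) : qPoch a q 0 = 1 := by simp [qPoch]

theorem qPoch_succ (a q : K) (n : ℕ) : qPoch a q (n + 1) = qPoch a q n * (1 - a * q ^ n) := by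
  simp [qPoch, prod_range_succ]

theorem qPoch_add (a q : K) (m n : ℕ) :
    qPoch a q (m + n) = qPoch a q m * qPoch (a * q ^ m) q n := by
  simp only [qPoch, prod_range_add]
  congr 1
  exact prod_congr rfl fun t _ => by rw [pow_add]; ring

theorem qPoch_succ' (a q : K) (n : ℕ) :
    qPoch a q (n + 1) = (1 - a) * qPoch (a * q) q n := by
  rw [add_comm, qPoch_add]
  simp [qPoch_succ]

theorem qPoch_ne_zero {a q : K} {n : ℕ} (h : ∀ t < n, a * q ^ t ≠ 1) : qPoch a q n ≠ 0 := by
  refine prod_ne_zero_iff.2 fun t ht => ?_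
  rw [sub_ne_zero]
  exact (h t (mem_range.1 ht)).symm

theorem qPoch_self_ne_zero {q : K} (hq : ∀ n, 1 ≤ n → q ^ n ≠ 1) (n : ℕ) : qPoch q q n ≠ 0 :=
  qPoch_ne_zero fun t _ => by
    rw [← pow_succ']
    exact hq _ (by omega)

theorem qPoch_base_ne_zero {a q : K} (ha : ∀ n, 1 ≤ n → a * q ^ n ≠ 1) (n : ℕ) :
    qPoch (a * q) q n ≠ 0 :=
  qPoch_ne_zero fun t _ => by
    rw [mul_assoc, ← pow_succ']
    exact ha _ (by omega)

/-! ### Summation formulas of `q`-Chu–Vandermonde type -/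

/-- The first `q`-Pascal rule, for a weighted sum. -/
theorem pascal_sum {q : K} (hq : ∀ n, 1 ≤ n → q ^ n ≠ 1) (N : ℕ) (x : ℕ → K) :
    (1 - q ^ (N + 1)) * ∑ i ∈ range (N + 2), x i / (qPoch q q (N + 1 - i) * qPoch q q i) =
      ∑ i ∈ range (N + 1), (x i + q ^ (N - i) * x (i + 1)) /
        (qPoch q q (N - i) * qPoch q q i) := by
  -- The `q`-Pascal rule is `1 - q^{N+1} = (1 - q^{N+1-i}) + q^{N+1-i} (1 - q^i)`. Each summand
  -- cancels a factor of one `q`-factorial, and vanishes at `i = N+1` or `i = 0` respectively, so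
  -- one end term of each sum drops out.
  have key : ∀ i ∈ range (N + 2),
      (1 - q ^ (N + 1)) * (x i / (qPoch q q (N + 1 - i) * qPoch q q i)) =
      (1 - q ^ (N + 1 - i)) * x i / (qPoch q q (N + 1 - i) * qPoch q q i) +
      (1 - q ^ i) * q ^ (N + 1 - i) * x i / (qPoch q q (N + 1 - i) * qPoch q q i) := by
    intro i hi
    have : q ^ (N + 1) = q ^ (N + 1 - i) * q ^ i := by
      rw [← pow_add]; congr 1; have := mem_range.1 hi; omega
    rw [this]; ring
  rw [mul_sum, sum_congr rfl key, sum_add_distrib, sum_range_succ, sum_range_succ' _ (N + 1)]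
  simp only [tsub_self, pow_zero, sub_self, zero_mul, zero_div, add_zero]
  rw [← sum_add_distrib]
  refine sum_congr rfl fun i hi => ?_
  obtain ⟨d, rfl⟩ := Nat.exists_eq_add_of_le (Nat.lt_succ_iff.1 (mem_range.1 hi))
  have h1 : i + d + 1 - i = d + 1 := by omega
  have h2 : i + d + 1 - (i + 1) = d := by omega
  have h3 : i + d - i = d := by omega
  rw [h1, h2, h3, qPoch_succ, qPoch_succ]
  have e1 := qPoch_self_ne_zero hq d
  have e2 := qPoch_self_ne_zero hq i
  have e3 : 1 - q * q ^ d ≠ 0 := by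
    rw [← pow_succ', sub_ne_zero]; exact (hq _ (by omega)).symm
  have e4 : 1 - q * q ^ i ≠ 0 := by
    rw [← pow_succ', sub_ne_zero]; exact (hq _ (by omega)).symm
  rw [pow_succ' q d, pow_succ' q i]
  field_simp

/-- The second `q`-Pascal rule, for a weighted sum. -/
theorem pascal_sum' {q : K} (hq : ∀ n, 1 ≤ n → q ^ n ≠ 1) (N : ℕ) (x : ℕ → K) :
    (1 - q ^ (N + 1)) * ∑ i ∈ range (N + 2), x i / (qPoch q q (N + 1 - i) * qPoch q q i) =
      ∑ i ∈ range (N + 1), (x (i + 1) + q ^ i * x i) /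
        (qPoch q q (N - i) * qPoch q q i) := by
  -- The reflection `i ↦ N + 1 - i` swaps the two `q`-factorials and turns the first rule into the
  -- second.
  have h := pascal_sum hq N fun i => x (N + 1 - i)
  rw [← sum_range_reflect _ (N + 2), ← sum_range_reflect _ (N + 1)] at h
  convert h using 1
  · congr 1
    refine sum_congr rfl fun i hi => ?_
    have := mem_range.1 hi
    have h1 : N + 1 - (N + 2 - 1 - i) = i := by omega
    have h2 : N + 2 - 1 - i = N + 1 - i := by omega
    rw [h1, h2, mul_comm (qPoch q q _)]
  · refine sum_congr rfl fun i hi => ?_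
    have := mem_range.1 hi
    have h1 : N + 1 - 1 - i = N - i := by omega
    have h2 : N + 1 - (N - i) = i + 1 := by omega
    have h3 : N + 1 - (N - i + 1) = i := by omega
    have h4 : N - (N - i) = i := by omega
    rw [h1, h2, h3, h4, mul_comm (qPoch q q _)]

/-- The `q`-Chu–Vandermonde sum. -/
theorem chu_vandermonde {q : K} (hq : ∀ n, 1 ≤ n → q ^ n ≠ 1) (d : K) (N : ℕ) :
    ∀ c : K, (∀ n, c * d * q ^ n ≠ 1) →
    ∑ i ∈ range (N + 1), (-1) ^ i * q ^ (i.choose 2) * d ^ i * qPoch c q i / qPoch (c * d) q i /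
      (qPoch q q (N - i) * qPoch q q i) =
      qPoch d q N / qPoch (c * d) q N / qPoch q q N := by
  induction N with
  | zero => intro c _; simp
  | succ N ih =>
    intro c hcd
    have hcd' : ∀ n, c * q * d * q ^ n ≠ 1 := fun n => by
      have := hcd (n + 1); rwa [pow_succ', ← mul_assoc, mul_right_comm c d q] at this
    have e0 : (1 - q ^ (N + 1)) ≠ 0 := sub_ne_zero.2 (hq _ (by omega)).symm
    apply mul_left_cancel₀ e0
    rw [pascal_sum hq]
    have e1 := qPoch_self_ne_zero hq N
    have e2 : ∀ n, qPoch (c * d) q n ≠ 0 := fun n => qPoch_ne_zero fun t _ => hcd t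
    have e4 : 1 - c * d ≠ 0 := by
      rw [sub_ne_zero]; simpa using (hcd 0).symm
    -- Pascal's rule splits the sum for `N + 1` into sums for `N`, one with the same `c` and one
    -- with `c` replaced by `c q`. Hence `c` is quantified inside the induction while `d` stays
    -- fixed.
    have : ∀ i ∈ range (N + 1), ((-1) ^ i * q ^ (i.choose 2) * d ^ i * qPoch c q i /
        qPoch (c * d) q i + q ^ (N - i) * ((-1) ^ (i + 1) * q ^ ((i + 1).choose 2) * d ^ (i + 1) *
          qPoch c q (i + 1) / qPoch (c * d) q (i + 1))) / (qPoch q q (N - i) * qPoch q q i) =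
        (-1) ^ i * q ^ (i.choose 2) * d ^ i * qPoch c q i / qPoch (c * d) q i /
          (qPoch q q (N - i) * qPoch q q i) -
        d * q ^ N * (1 - c) / (1 - c * d) * ((-1) ^ i * q ^ (i.choose 2) * d ^ i *
          qPoch (c * q) q i / qPoch (c * q * d) q i / (qPoch q q (N - i) * qPoch q q i)) := by
      intro i hi
      have hN : q ^ N = q ^ (N - i) * q ^ i := by
        rw [← pow_add]; congr 1; have := mem_range.1 hi; omega
      have h2 : (i + 1).choose 2 = i + i.choose 2 := by
        rw [Nat.choose_succ_succ' i 1, Nat.choose_one_right]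
      rw [hN, h2, qPoch_succ' c, qPoch_succ' (c * d), mul_right_comm c d q, pow_add q]
      have e5 : qPoch (c * q * d) q i ≠ 0 := qPoch_ne_zero fun t _ => hcd' t
      have e6 := e2 i
      field_simp
      ring
    rw [sum_congr rfl this, sum_sub_distrib, ← mul_sum, ih c hcd, ih (c * q) hcd']
    have e5 : qPoch (c * d) q (N + 1) = (1 - c * d) * qPoch (c * q * d) q N := by
      rw [qPoch_succ', mul_right_comm c d q]
    have e6 : qPoch (c * q * d) q N ≠ 0 := qPoch_ne_zero fun t _ => hcd' t
    have e7 := qPoch_succ (c * d) q N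
    have e8 := e2 N
    have e9 : 1 - c * d * q ^ N ≠ 0 := sub_ne_zero.2 (hcd N).symm
    have e10 : d * q ^ N * (1 - c) / (1 - c * d) *
        (qPoch d q N / qPoch (c * q * d) q N / qPoch q q N) =
        d * q ^ N * (1 - c) * qPoch d q N / qPoch (c * d) q (N + 1) / qPoch q q N := by
      rw [e5]; field_simp
    rw [e10, e7, qPoch_succ d, qPoch_succ q, ← pow_succ']
    field_simp
    ring

/-- The limiting case of `chu_vandermonde` for the first forward move. -/
theorem chu_vandermonde_limit {q : K} (hq : ∀ n, 1 ≤ n → q ^ n ≠ 1) (N : ℕ) :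
    ∀ b : K, (∀ n, 1 ≤ n → b * q ^ n ≠ 1) →
    ∑ i ∈ range (N + 1), b ^ i * q ^ (i ^ 2) / qPoch (b * q) q i /
      (qPoch q q (N - i) * qPoch q q i) = 1 / qPoch (b * q) q N / qPoch q q N := by
  induction N with
  | zero => intro b _; simp
  | succ N ih =>
    intro b hb
    have hb' : ∀ n, 1 ≤ n → b * q * q ^ n ≠ 1 := fun n hn => by
      have := hb (n + 1) (by omega); rwa [pow_succ', ← mul_assoc] at this
    have e0 : (1 - q ^ (N + 1)) ≠ 0 := sub_ne_zero.2 (hq _ (by omega)).symm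
    apply mul_left_cancel₀ e0
    rw [pascal_sum hq]
    have e1 := qPoch_self_ne_zero hq N
    have e2 := qPoch_base_ne_zero hb
    have e3 := qPoch_base_ne_zero hb'
    have e4 : 1 - b * q ≠ 0 := by
      rw [sub_ne_zero]; simpa using (hb 1 le_rfl).symm
    -- The case `c → ∞`, `d → 0`, `c d = b q` of Chu–Vandermonde. Pascal's rule now produces the
    -- sums for `b` and `b q`.
    have : ∀ i ∈ range (N + 1), (b ^ i * q ^ (i ^ 2) / qPoch (b * q) q i +
        q ^ (N - i) * (b ^ (i + 1) * q ^ ((i + 1) ^ 2) / qPoch (b * q) q (i + 1))) /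
          (qPoch q q (N - i) * qPoch q q i) =
        b ^ i * q ^ (i ^ 2) / qPoch (b * q) q i / (qPoch q q (N - i) * qPoch q q i) +
        b * q ^ (N + 1) / (1 - b * q) * ((b * q) ^ i * q ^ (i ^ 2) / qPoch (b * q * q) q i /
          (qPoch q q (N - i) * qPoch q q i)) := by
      intro i hi
      have hN : q ^ (N + 1) = q ^ (N - i) * q ^ (i + 1) := by
        rw [← pow_add]; congr 1; have := mem_range.1 hi; omega
      rw [hN, qPoch_succ', add_div]
      congr 1
      have e5 := e3 i
      field_simp
      ring
    rw [sum_congr rfl this, sum_add_distrib, ← mul_sum, ih b hb, ih (b * q) hb']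
    have e5 := qPoch_succ' (b * q) q N
    have e6 := e3 N
    have e7 := qPoch_succ (b * q) q N
    have e8 := e2 N
    have e9 : 1 - b * q * q ^ N ≠ 0 := by
      rw [mul_assoc, ← pow_succ', sub_ne_zero]; exact (hb _ (by omega)).symm
    have e10 : b * q ^ (N + 1) / (1 - b * q) * (1 / qPoch (b * q * q) q N / qPoch q q N) =
        b * q ^ (N + 1) / qPoch (b * q) q (N + 1) / qPoch q q N := by
      rw [e5]; field_simp
    rw [e10, e7, qPoch_succ q, ← pow_succ']
    field_simp
    ring

/-- The summation formula for the first backward move. -/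
theorem chu_vandermonde_inverse {q : K} (hq : ∀ n, 1 ≤ n → q ^ n ≠ 1) (N : ℕ) :
    ∀ b : K, (∀ n, 1 ≤ n → b * q ^ n ≠ 1) →
    ∑ i ∈ range (N + 1), (-1) ^ (N - i) * q ^ ((N - i).choose 2) / qPoch (b * q) q i /
      (qPoch q q (N - i) * qPoch q q i) = b ^ N * q ^ (N ^ 2) / qPoch (b * q) q N / qPoch q q N := by
  induction N with
  | zero => intro b _; simp
  | succ N ih =>
    intro b hb
    have hb' : ∀ n, 1 ≤ n → b * q * q ^ n ≠ 1 := fun n hn => by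
      have := hb (n + 1) (by omega); rwa [pow_succ', ← mul_assoc] at this
    have e0 : (1 - q ^ (N + 1)) ≠ 0 := sub_ne_zero.2 (hq _ (by omega)).symm
    apply mul_left_cancel₀ e0
    -- The weight depends on `N + 1 - i`, so the second rule is the suitable one: it keeps the
    -- distance to the upper end when `i` moves to `i + 1`.
    rw [pascal_sum' hq]
    have e1 := qPoch_self_ne_zero hq N
    have e2 := qPoch_base_ne_zero hb
    have e3 := qPoch_base_ne_zero hb'
    have e4 : 1 - b * q ≠ 0 := by
      rw [sub_ne_zero]; simpa using (hb 1 le_rfl).symm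
    have : ∀ i ∈ range (N + 1), ((-1) ^ (N + 1 - (i + 1)) * q ^ ((N + 1 - (i + 1)).choose 2) /
          qPoch (b * q) q (i + 1) +
        q ^ i * ((-1) ^ (N + 1 - i) * q ^ ((N + 1 - i).choose 2) / qPoch (b * q) q i)) /
          (qPoch q q (N - i) * qPoch q q i) =
        1 / (1 - b * q) * ((-1) ^ (N - i) * q ^ ((N - i).choose 2) / qPoch (b * q * q) q i /
          (qPoch q q (N - i) * qPoch q q i)) -
        q ^ N * ((-1) ^ (N - i) * q ^ ((N - i).choose 2) / qPoch (b * q) q i /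
          (qPoch q q (N - i) * qPoch q q i)) := by
      intro i hi
      obtain ⟨d, rfl⟩ := Nat.exists_eq_add_of_le (Nat.lt_succ_iff.1 (mem_range.1 hi))
      have h1 : i + d + 1 - i = d + 1 := by omega
      have h2 : i + d + 1 - (i + 1) = d := by omega
      have h3 : i + d - i = d := by omega
      have h4 : (d + 1).choose 2 = d + d.choose 2 := by
        rw [Nat.choose_succ_succ' d 1, Nat.choose_one_right]
      rw [h1, h2, h3, h4, qPoch_succ']
      have e5 := e3 i
      have e6 := e2 i
      field_simp
      ring
    rw [sum_congr rfl this, sum_sub_distrib, ← mul_sum, ← mul_sum, ih b hb, ih (b * q) hb']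
    have e5 := qPoch_succ' (b * q) q N
    have e6 := e3 N
    have e7 := qPoch_succ (b * q) q N
    have e8 := e2 N
    have e9 : 1 - b * q * q ^ N ≠ 0 := by
      rw [mul_assoc, ← pow_succ', sub_ne_zero]; exact (hb _ (by omega)).symm
    have e10 : 1 / (1 - b * q) * ((b * q) ^ N * q ^ (N ^ 2) / qPoch (b * q * q) q N /
        qPoch q q N) =
        (b * q) ^ N * q ^ (N ^ 2) / qPoch (b * q) q (N + 1) / qPoch q q N := by
      rw [e5]; field_simp
    rw [e10, e7, qPoch_succ q, ← pow_succ']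
    field_simp
    ring

/-! ### The moves preserve Bailey pairs -/

/-- A kernel that maps the rows of the Bailey matrix to multiples of rows maps Bailey pairs to
Bailey pairs. -/
theorem IsBaileyPair.of_kernel {q : K} {P P' : SeqPair K} (hP : IsBaileyPair q P)
    (hbase : P'.base = P.base) (g : ℕ → ℕ → K) (γ : ℕ → K)
    (hβ : ∀ n, P'.β n = ∑ j ∈ range (n + 1), g n j * P.β j) (hα : ∀ n, P'.α n = γ n * P.α n)
    (hg : ∀ t N, ∑ i ∈ range (N + 1), g (t + N) (t + i) /
      (qPoch q q i * qPoch (P.base * q ^ (2 * t) * q) q i) =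
      γ t / (qPoch q q N * qPoch (P.base * q ^ (2 * t) * q) q N)) :
    IsBaileyPair q P' := by
  intro n
  -- The factor `(aq)_{2t}` is common to all terms belonging to `α_t`. What is left is the zeroth
  -- column of the Bailey matrix for the base `a q^{2t}`, which is where `hg` applies.
  have hsplit : ∀ t i, qPoch (P.base * q) q (t + (t + i)) =
      qPoch (P.base * q) q (2 * t) * qPoch (P.base * q ^ (2 * t) * q) q i := by
    intro t i
    rw [← add_assoc, ← two_mul, qPoch_add]
    congr 2; ring
  have h1 : ∀ j ∈ range (n + 1), g n j * P.β j = ∑ t ∈ range (j + 1),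
      g n (t + (j - t)) * (P.α t / (qPoch q q (j - t) * qPoch (P.base * q) q (t + (t + (j - t))))) := by
    intro j _
    rw [hP j, mul_sum]
    refine sum_congr rfl fun t ht => ?_
    have : t + (j - t) = j := by have := mem_range.1 ht; omega
    rw [this, add_comm t j]
  rw [hβ, sum_congr rfl h1, sum_range_diag_flip (n + 1) fun t i =>
    g n (t + i) * (P.α t / (qPoch q q i * qPoch (P.base * q) q (t + (t + i))))]
  refine sum_congr rfl fun t ht => ?_
  obtain ⟨N, rfl⟩ := Nat.exists_eq_add_of_le (Nat.lt_succ_iff.1 (mem_range.1 ht))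
  have h3 : t + N + 1 - t = N + 1 := by omega
  have h4 : t + N - t = N := by omega
  rw [h3, h4, hα, hbase, add_comm (t + N) t, hsplit]
  have := congrArg (fun x => x * (P.α t / qPoch (P.base * q) q (2 * t))) (hg t N)
  simp only [sum_mul] at this
  convert this using 1
  · refine sum_congr rfl fun i _ => ?_
    rw [hsplit, div_mul_div_comm, mul_div_assoc']
    congr 1; ring
  · rw [div_mul_div_comm]
    congr 1; ring

theorem shifted_base_ne_one {a q : K} (ha : ∀ n, 1 ≤ n → a * q ^ n ≠ 1) (t : ℕ) :
    ∀ n, 1 ≤ n → a * q ^ (2 * t) * q ^ n ≠ 1 := fun n hn => by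
  rw [mul_assoc, ← pow_add]; exact ha _ (by omega)

/-- This is `chu_vandermonde_limit` with `b = a q^{2t}`: the cross term of `(t+i)² = t² + 2ti + i²`
is what changes `a^i` into `b^i`. -/
theorem IsBaileyPair.moveF1 {q : K} (hq : ∀ n, 1 ≤ n → q ^ n ≠ 1) {P : SeqPair K}
    (ha : ∀ n, 1 ≤ n → P.base * q ^ n ≠ 1) (hP : IsBaileyPair q P) :
    IsBaileyPair q (moveF1 q P) := by
  refine hP.of_kernel rfl (fun n j => P.base ^ j * q ^ (j ^ 2) / qPoch q q (n - j))
    (fun n => P.base ^ n * q ^ (n ^ 2)) (fun _ => rfl) (fun _ => rfl) fun t N => ?_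
  have h := chu_vandermonde_limit hq N _ (shifted_base_ne_one ha t)
  have := congrArg (fun x => P.base ^ t * q ^ (t ^ 2) * x) h
  simp only [mul_sum] at this
  convert this using 1
  · refine sum_congr rfl fun i _ => ?_
    have h4 : t + N - (t + i) = N - i := by omega
    rw [h4]
    simp only [div_div, mul_div_assoc']
    congr 1 <;> ring
  · simp only [div_div, mul_div_assoc']
    congr 1 <;> ring

theorem choose_two_add (t i : ℕ) : (t + i).choose 2 = t.choose 2 + i.choose 2 + t * i := by
  induction i with
  | zero => simp
  | succ i ih =>
    rw [← add_assoc, Nat.choose_succ_succ' (t + i) 1, Nat.choose_succ_succ' i 1, ih,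
      Nat.choose_one_right, Nat.choose_one_right]
    ring

/-- On `α` this move is inverse to F1. The summation needed is `chu_vandermonde_inverse` with `b = a
q^{2t}`. -/
theorem IsBaileyPair.moveB1 {q : K} (hq0 : q ≠ 0) (hq : ∀ n, 1 ≤ n → q ^ n ≠ 1) {P : SeqPair K}
    (ha0 : P.base ≠ 0) (ha : ∀ n, 1 ≤ n → P.base * q ^ n ≠ 1) (hP : IsBaileyPair q P) :
    IsBaileyPair q (moveB1 q P) := by
  refine hP.of_kernel rfl (fun n j => (-1) ^ n * (P.base ^ n)⁻¹ * (q ^ (n ^ 2))⁻¹ *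
      ((-1) ^ j * q ^ ((n - j).choose 2) / qPoch q q (n - j)))
    (fun n => (P.base ^ n)⁻¹ * (q ^ (n ^ 2))⁻¹)
    (fun n => by simp only [A22.moveB1, mul_sum, mul_assoc]) (fun _ => rfl) fun t N => ?_
  have h := chu_vandermonde_inverse hq N _ (shifted_base_ne_one ha t)
  have := congrArg (fun x => (P.base ^ (t + N))⁻¹ * (q ^ ((t + N) ^ 2))⁻¹ * x) h
  simp only [mul_sum] at this
  convert this using 1
  · refine sum_congr rfl fun i hi => ?_
    have h4 : t + N - (t + i) = N - i := by omega
    have h5 : (-1 : K) ^ (t + N) * (-1) ^ (t + i) = (-1) ^ (N - i) := by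
      have : t + N + (t + i) = (N - i) + 2 * (t + i) := by have := mem_range.1 hi; omega
      rw [← pow_add, this, pow_add, pow_mul]; simp
    rw [h4, ← h5]
    simp only [div_div, mul_div_assoc']
    congr 1 <;> ring
  · simp only [div_div, mul_div_assoc']
    rw [mul_comm (qPoch q q N)]
    congr 1
    have : (P.base * q ^ (2 * t)) ^ N * q ^ (N ^ 2) * (P.base ^ t * q ^ (t ^ 2)) =
        P.base ^ (t + N) * q ^ ((t + N) ^ 2) := by ring
    rw [← mul_inv, ← mul_inv, inv_eq_iff_eq_inv, mul_inv_rev, inv_inv, eq_inv_mul_iff_mul_eq₀,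
      this]
    exact mul_ne_zero (pow_ne_zero _ (mul_ne_zero ha0 (pow_ne_zero _ hq0))) (pow_ne_zero _ hq0)

theorem IsBaileyPair.moveF2 {q : K} (hq : ∀ n, 1 ≤ n → q ^ n ≠ 1) {P : SeqPair K}
    (ha : ∀ n, 1 ≤ n → P.base * q ^ n ≠ 1) (ha' : ∀ n, -P.base * q ^ n ≠ 1)
    (hP : IsBaileyPair q P) : IsBaileyPair q (moveF2 q P) := by
  refine hP.of_kernel rfl (fun n j => qPoch (-q) q j * q ^ (j.choose 2) * P.base ^ j /
      (qPoch q q (n - j) * qPoch (-P.base) q n))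
    (fun n => qPoch (-q) q n * q ^ (n.choose 2) * P.base ^ n / qPoch (-P.base) q n)
    (fun _ => rfl) (fun _ => rfl) fun t N => ?_
  -- With `c = -q^{t+1}` and `d = -a q^t` the product `c d` is the parameter `a q^{2t+1}` of the
  -- Bailey denominators. Moreover `(-q)_t (c)_i = (-q)_{t+i}`, and `(d)_N` cancels against
  -- `(-a)_{t+N} = (-a)_t (d)_N`.
  have hcd : -q * q ^ t * (-P.base * q ^ t) = P.base * q ^ (2 * t) * q := by ring
  have h := chu_vandermonde hq (-P.base * q ^ t) N (-q * q ^ t) fun n => by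
    rw [hcd, mul_assoc _ q, ← pow_succ']
    exact shifted_base_ne_one ha t _ (by omega)
  rw [hcd] at h
  have e : ∀ n, qPoch (-P.base) q n ≠ 0 := fun n => qPoch_ne_zero fun t _ => ha' t
  have e' : qPoch (-P.base * q ^ t) q N ≠ 0 := qPoch_ne_zero fun s _ => by
    rw [mul_assoc, ← pow_add]; exact ha' _
  have := congrArg (fun x => qPoch (-q) q t * q ^ (t.choose 2) * P.base ^ t /
    qPoch (-P.base) q (t + N) * x) h
  simp only [mul_sum] at this
  convert this using 1
  · refine sum_congr rfl fun i _ => ?_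
    have h4 : t + N - (t + i) = N - i := by omega
    have h5 : (-1 : K) ^ i * (-P.base * q ^ t) ^ i = P.base ^ i * q ^ (t * i) := by
      rw [← mul_pow, pow_mul, ← mul_pow]; congr 1; ring
    have h6 : (-1) ^ i * q ^ (i.choose 2) * (-P.base * q ^ t) ^ i =
        q ^ (i.choose 2) * (P.base ^ i * q ^ (t * i)) := by rw [← h5]; ring
    rw [h4, qPoch_add (-q), choose_two_add, h6]
    simp only [div_div, div_mul_div_comm]
    congr 1 <;> ring
  · rw [qPoch_add]
    have := e t
    simp only [div_div, mul_div_assoc']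
    rw [← div_div _ (qPoch (-P.base) q t) (qPoch (-P.base * q ^ t) q N), div_mul_cancel₀ _ e',
      div_div]
    congr 1; ring

/-- The change of base from `a` to `a / q` that keeps the sequence `β`. -/
def changeBase (q : K) (P : SeqPair K) : SeqPair K where
  base := P.base / q
  α := fun n => if n = 0 then P.α 0 else bracket q P n
  β := P.β

/-- The reason is `1 - a q^{2t} = (1 - a q^{n+t}) - a q^{2t} (1 - q^{n-t})`. The first part lowers
`(aq)_{n+t}` to `(a)_{n+t}` up to the factor `1 - a`. The second lowers `(q)_{n-t}` to
`(q)_{n-t-1}`, and after `t ↦ t + 1` has the same denominators as the first; together they form the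
bracket. -/
theorem IsBaileyPair.changeBase {q : K} (hq0 : q ≠ 0) (hq : ∀ n, 1 ≤ n → q ^ n ≠ 1)
    {P : SeqPair K} (ha : ∀ n, P.base * q ^ n ≠ 1) (hP : IsBaileyPair q P) :
    IsBaileyPair q (changeBase q P) := by
  intro n
  have e1 : ∀ n, qPoch P.base q n ≠ 0 := fun n => qPoch_ne_zero fun t _ => ha t
  have e2 := qPoch_self_ne_zero hq
  have e3 : ∀ n, 1 - P.base * q ^ n ≠ 0 := fun n => sub_ne_zero.2 (ha n).symm
  have e4 : 1 - P.base ≠ 0 := by simpa using e3 0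
  have e5 := qPoch_base_ne_zero (a := P.base) (q := q) fun n _ => ha n
  have hb : P.base / q * q = P.base := div_mul_cancel₀ _ hq0
  simp only [A22.changeBase, hb]
  rw [hP n]
  have ht0 : P.tilde q 0 = P.α 0 := by simp [SeqPair.tilde, div_self e4]
  -- the two halves of each term
  have key : ∀ t ∈ range (n + 1), P.α t / (qPoch q q (n - t) * qPoch (P.base * q) q (n + t)) =
      P.tilde q t / (qPoch q q (n - t) * qPoch P.base q (n + t)) -
      (1 - q ^ (n - t)) * (P.base * q ^ (2 * t) * P.tilde q t) /
        (qPoch q q (n - t) * qPoch P.base q (n + t + 1)) := by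
    intro t ht
    have h1 : q ^ (n + t) = q ^ (n - t) * q ^ (2 * t) := by
      rw [← pow_add]; congr 1; have := mem_range.1 ht; omega
    have h2 : qPoch P.base q (n + t + 1) = (1 - P.base) * qPoch (P.base * q) q (n + t) :=
      qPoch_succ' _ _ _
    have h3 := qPoch_succ P.base q (n + t)
    have h4 : P.tilde q t / (qPoch q q (n - t) * qPoch P.base q (n + t)) =
        (1 - P.base * q ^ (n + t)) * P.tilde q t /
          (qPoch q q (n - t) * qPoch P.base q (n + t + 1)) := by
      rw [h3]
      have := e1 (n + t)
      have := e2 (n - t)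
      have := e3 (n + t)
      field_simp
    rw [h4, h2, SeqPair.tilde, h1]
    have := e5 (n + t)
    have := e2 (n - t)
    have := e3 (2 * t)
    field_simp
    ring
  rw [sum_congr rfl key, sum_sub_distrib, sum_range_succ' (fun t => P.tilde q t / _),
    sum_range_succ (fun t => _ * _ / _), sum_range_succ' (fun t => ite _ _ _ / _)]
  simp only [tsub_self, pow_zero, sub_self, zero_mul, zero_div, add_zero, ht0, if_true]
  rw [add_sub_right_comm, ← sum_sub_distrib]
  congr 1
  refine sum_congr rfl fun t ht => ?_
  obtain ⟨d, rfl⟩ := Nat.exists_eq_add_of_lt (mem_range.1 ht)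
  have h1 : t + d + 1 - t = d + 1 := by omega
  have h2 : t + d + 1 - (t + 1) = d := by omega
  have h3 : 2 * (t + 1) - 2 = 2 * t := by omega
  rw [if_neg (Nat.succ_ne_zero t), bracket, h1, h2, h3, sub_div, qPoch_succ q q d, ← pow_succ',
    add_tsub_cancel_right, ← add_assoc]
  have h4 : 1 - q ^ (d + 1) ≠ 0 := sub_ne_zero.2 (hq _ (by omega)).symm
  congr 1
  rw [mul_comm (qPoch q q d), mul_assoc (1 - q ^ (d + 1)), mul_div_mul_left _ _ h4]

/-- Since `a^n q^{n²-n} = (a/q)^n q^{n²}`, the base change moves need no summation formula of their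
own. -/
theorem moveBC1_eq {q : K} (hq0 : q ≠ 0) (P : SeqPair K) :
    moveBC1 q P = moveF1 q (changeBase q P) := by
  have h : ∀ n, P.base ^ n * q ^ (n ^ 2 - n) = (P.base / q) ^ n * q ^ (n ^ 2) := fun n => by
    have : q ^ (n ^ 2) = q ^ (n ^ 2 - n) * q ^ n := by
      rw [← pow_add, Nat.sub_add_cancel (Nat.le_self_pow two_ne_zero n)]
    rw [this, div_pow]
    have := pow_ne_zero n hq0
    field_simp
  simp only [moveBC1, moveF1, changeBase, SeqPair.mk.injEq, true_and]
  constructor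
  · funext n
    rw [h]
    split_ifs with hn
    · simp [hn]
    · rfl
  · funext n
    simp only [h]

theorem moveBC2_eq {q : K} (hq0 : q ≠ 0) (P : SeqPair K) :
    moveBC2 q P = moveF2 q (changeBase q P) := by
  have h : ∀ n : ℕ, P.base ^ n * q ^ ((n.choose 2 : ℤ) - n) = q ^ (n.choose 2) * (P.base / q) ^ n :=
    fun n => by
      rw [zpow_sub₀ hq0, zpow_natCast, zpow_natCast, div_pow]
      ring
  simp only [moveBC2, moveF2, changeBase, SeqPair.mk.injEq, true_and]
  constructor
  · funext n
    rw [mul_assoc (qPoch (-q) q n), h, ← mul_assoc]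
    split_ifs with hn
    · simp [hn]
    · rfl
  · funext n
    refine sum_congr rfl fun j _ => ?_
    rw [h]
    simp only [div_mul_div_comm]
    congr 2 <;> ring

end Finite

end A22

namespace A22

section InitialPairs

variable {K : Type*} [Field K]

/-! ### The initial pairs -/

/-- `1 / (q; q)_m`, which is `0` for `m < 0`. -/
def invPoch (q : K) (m : ℤ) : K := if 0 ≤ m then (qPoch q q m.toNat)⁻¹ else 0

theorem invPoch_natCast (q : K) (m : ℕ) : invPoch q m = (qPoch q q m)⁻¹ := by simp [invPoch]

theorem invPoch_of_neg (q : K) {m : ℤ} (hm : m < 0) : invPoch q m = 0 := by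
  simp [invPoch, hm]

/-- With the convention `1/(q)_m = 0` for `m < 0` the recurrence crosses `m = 0` because `1 - q^0 =
0`. Telescoping arguments then need no separate treatment of boundary indices. -/
theorem invPoch_sub_one {q : K} (hq : ∀ n, 1 ≤ n → q ^ n ≠ 1) (m : ℤ) :
    invPoch q (m - 1) = (1 - q ^ m) * invPoch q m := by
  rcases lt_trichotomy m 0 with h | rfl | h
  · rw [invPoch_of_neg q h, invPoch_of_neg q (by omega), mul_zero]
  · rw [invPoch_of_neg q (by omega)]; simp
  · obtain ⟨n, rfl⟩ : ∃ n : ℕ, m = n + 1 := ⟨(m - 1).toNat, by omega⟩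
    have h1 : ((n : ℤ) + 1) = ((n + 1 : ℕ) : ℤ) := by push_cast; rfl
    rw [add_sub_cancel_right, h1, invPoch_natCast, invPoch_natCast, qPoch_succ, zpow_natCast,
      ← pow_succ']
    have h2 := qPoch_self_ne_zero hq n
    have h3 : 1 - q ^ (n + 1) ≠ 0 := sub_ne_zero.2 (hq _ (by omega)).symm
    field_simp

theorem sum_range_three_mul {M : Type*} [AddCommMonoid M] (f : ℕ → M) (R : ℕ) :
    ∑ t ∈ range (3 * R), f t = ∑ r ∈ range R, (f (3 * r) + f (3 * r + 1) + f (3 * r + 2)) := by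
  induction R with
  | zero => simp
  | succ R ih =>
    rw [sum_range_succ _ R, ← ih, mul_add_one, sum_range_succ, sum_range_succ, sum_range_succ]
    simp only [add_assoc]

/-- A bilateral sum that satisfies a telescoping recurrence. -/
theorem telescoping_recurrence {q : K} (hq0 : q ≠ 0) (hq : ∀ n, 1 ≤ n → q ^ n ≠ 1) {e : ℤ}
    (he : e ≤ 2) {w : ℤ → K} {W : K → K} (hW : ∀ r : ℤ, w (r + 1) = w r * W (q ^ (3 * r)))
    {c d : K} {g : K → K} {n : ℕ}
    (hwz : ∀ y : K, y ≠ 0 → c * (1 - q ^ e * y ^ 2) -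
      d * (1 - q ^ e * y ^ 2) * (1 - q * q ^ n / y) * (1 - q ^ (e + 1) * q ^ n * y) =
      W y * g (q ^ 3 * y) * ((1 - q * q ^ n / y) * (1 - q ^ n / y) * (1 - q ^ n / (q * y))) -
      g y * ((1 - q ^ (e + 1) * q ^ n * y) * (1 - q ^ e * q ^ n * y) *
        (1 - q ^ (e - 1) * q ^ n * y)))
    {F : ℤ → ℤ → K} (hF : ∀ n r, F n r =
      w r * (1 - q ^ (6 * r + e)) * invPoch q (n - 3 * r) * invPoch q (n + 3 * r + e))
    {R : ℕ} (hR : n + 2 ≤ R) :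
    c * ∑ r ∈ range R, (F (n + 1 : ℕ) r + F (n + 1 : ℕ) (-r - 1)) =
      d * ∑ r ∈ range R, (F n r + F n (-r - 1)) := by
  -- The companion of `F` in the sense of Wilf and Zeilberger, with `g` as the rational certificate.
  set G : ℤ → K := fun r =>
    w r * g (q ^ (3 * r)) * invPoch q (n + 1 - 3 * r) * invPoch q (n + 3 * r + e - 2) with hG
  -- Every `invPoch` here is a product of binomials times `invPoch q (n + 1 - 3 r)` or `invPoch q (n
  -- + 3 r + e + 1)`. After removing these two and `w r`, the claim is the rational identity `hwz`
  -- at `y = q^{3r}`.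
  have hwz' : ∀ r : ℤ, c * F (n + 1 : ℕ) r - d * F n r = G (r + 1) - G r := by
    intro r
    have hy : q ^ (3 * r) ≠ 0 := zpow_ne_zero _ hq0
    have hm := hwz _ hy
    have z1 : q ^ (6 * r + e) = q ^ e * (q ^ (3 * r)) ^ 2 := by
      rw [← zpow_natCast, ← zpow_mul, ← zpow_add₀ hq0]; congr 1; push_cast; ring
    have z2 : q ^ (3 * (r + 1)) = q ^ 3 * q ^ (3 * r) := by
      rw [← zpow_natCast, ← zpow_add₀ hq0]; congr 1; push_cast; ring
    have a1 : invPoch q ((n : ℤ) - 3 * r) =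
        (1 - q * q ^ n / q ^ (3 * r)) * invPoch q (n + 1 - 3 * r) := by
      have := invPoch_sub_one hq ((n : ℤ) + 1 - 3 * r)
      rw [zpow_sub₀ hq0, zpow_add_one₀ hq0, zpow_natCast, mul_comm (q ^ n) q] at this
      rw [← this]; congr 1; ring
    have a2 : invPoch q ((n : ℤ) - 1 - 3 * r) =
        (1 - q ^ n / q ^ (3 * r)) * invPoch q (n - 3 * r) := by
      have := invPoch_sub_one hq ((n : ℤ) - 3 * r)
      rw [zpow_sub₀ hq0, zpow_natCast] at this
      rw [← this]; congr 1; ring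
    have a3 : invPoch q ((n : ℤ) + 1 - 3 * (r + 1)) =
        (1 - q ^ n / (q * q ^ (3 * r))) * invPoch q (n - 1 - 3 * r) := by
      have := invPoch_sub_one hq ((n : ℤ) - 1 - 3 * r)
      rw [zpow_sub₀ hq0, zpow_sub_one₀ hq0, zpow_natCast, ← div_eq_mul_inv, div_div] at this
      rw [← this]; congr 1; ring
    have b1 : invPoch q ((n : ℤ) + 3 * r + e) =
        (1 - q ^ (e + 1) * q ^ n * q ^ (3 * r)) * invPoch q (n + 3 * r + e + 1) := by
      have := invPoch_sub_one hq ((n : ℤ) + 3 * r + e + 1)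
      rw [show q ^ ((n : ℤ) + 3 * r + e + 1) = q ^ (e + 1) * q ^ n * q ^ (3 * r) by
        rw [← zpow_natCast, ← zpow_add₀ hq0, ← zpow_add₀ hq0]; congr 1; ring] at this
      rw [← this]; congr 1; ring
    have b2 : invPoch q ((n : ℤ) + 3 * r + e - 1) =
        (1 - q ^ e * q ^ n * q ^ (3 * r)) * invPoch q (n + 3 * r + e) := by
      have := invPoch_sub_one hq ((n : ℤ) + 3 * r + e)
      rw [show q ^ ((n : ℤ) + 3 * r + e) = q ^ e * q ^ n * q ^ (3 * r) by
        rw [← zpow_natCast, ← zpow_add₀ hq0, ← zpow_add₀ hq0]; congr 1; ring] at this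
      rw [← this]
    have b3 : invPoch q ((n : ℤ) + 3 * r + e - 2) =
        (1 - q ^ (e - 1) * q ^ n * q ^ (3 * r)) * invPoch q (n + 3 * r + e - 1) := by
      have := invPoch_sub_one hq ((n : ℤ) + 3 * r + e - 1)
      rw [show q ^ ((n : ℤ) + 3 * r + e - 1) = q ^ (e - 1) * q ^ n * q ^ (3 * r) by
        rw [← zpow_natCast, ← zpow_add₀ hq0, ← zpow_add₀ hq0]; congr 1; ring] at this
      rw [← this]; congr 1; ring
    have b4 : (n : ℤ) + 3 * (r + 1) + e - 2 = n + 3 * r + e + 1 := by ring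
    have b5 : ((n + 1 : ℕ) : ℤ) + 3 * r + e = n + 3 * r + e + 1 := by push_cast; ring
    simp only [hG, hF, hW]
    rw [b4, b5, a3, a2, a1, b3, b2, b1, z1, z2]
    push_cast
    linear_combination (w r * invPoch q (n + 1 - 3 * r) * invPoch q (n + 3 * r + e + 1)) * hm
  have hvan : ∀ r : ℤ, (n + 2 : ℤ) ≤ r → G r = 0 ∧ G (-r) = 0 := fun r hr => by
    constructor
    · simp only [hG]
      rw [invPoch_of_neg q (m := (n : ℤ) + 1 - 3 * r) (by omega)]; ring
    · simp only [hG]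
      rw [invPoch_of_neg q (m := (n : ℤ) + 3 * -r + e - 2) (by omega)]; ring
  -- The indices `r` and `-r - 1` for `r < R` fill the interval from `-R` to `R - 1`. The sum
  -- telescopes to `G R - G (-R)`, and both terms vanish; `e ≤ 2` is used for the second.
  have hsum : ∑ r ∈ range R, ((G ((r + 1 : ℕ) : ℤ) - G (-((r + 1 : ℕ) : ℤ))) -
      (G (r : ℤ) - G (-(r : ℤ)))) = 0 := by
    rw [sum_range_sub (fun r : ℕ => G (r : ℤ) - G (-(r : ℤ)))]
    have := hvan R (by exact_mod_cast hR)
    rw [this.1, this.2]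
    simp
  rw [← sub_eq_zero, mul_sum, mul_sum, ← sum_sub_distrib, ← hsum]
  refine sum_congr rfl fun r _ => ?_
  have h1 := hwz' r
  have h2 := hwz' (-r - 1)
  rw [sub_add_cancel] at h2
  have h3 : -((r + 1 : ℕ) : ℤ) = -r - 1 := by push_cast; ring
  rw [h3]
  push_cast at h1 h2 ⊢
  linear_combination h1 + h2

/-- A Bailey pair with base `q^e` from a bilateral sum with telescoping recurrence. -/
theorem IsBaileyPair.of_telescoping {q : K} (hq0 : q ≠ 0) (hq : ∀ n, 1 ≤ n → q ^ n ≠ 1) {e : ℕ}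
    (he0 : 1 ≤ e) (he : e ≤ 2) {P : SeqPair K} (hbase : P.base = q ^ e) {A : ℕ → K}
    (hα : ∀ n, P.α n = (1 - P.base * q ^ (2 * n)) / (1 - P.base) * A n) (hA0 : A 0 = 1)
    {w : ℤ → K} {W : K → K} (hW : ∀ r : ℤ, w (r + 1) = w r * W (q ^ (3 * r)))
    (hA : ∀ (n : ℤ) (r : ℕ), ∀ f : ℕ → K,
      (∀ t, f t = (1 - q ^ (2 * t + e)) * A t * invPoch q (n - t) * invPoch q (n + t + e)) →
      f (3 * r) + f (3 * r + 1) + f (3 * r + 2) =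
      w r * (1 - q ^ (6 * (r : ℤ) + e)) * invPoch q (n - 3 * r) * invPoch q (n + 3 * r + e) +
      w (-r - 1) * (1 - q ^ (6 * (-r - 1 : ℤ) + e)) * invPoch q (n - 3 * (-r - 1)) *
        invPoch q (n + 3 * (-r - 1) + e))
    {c d : ℕ → K} {g : ℕ → K → K} (hc : ∀ n, c n ≠ 0) (hβ0 : P.β 0 = 1)
    (hβ : ∀ n, c n * P.β (n + 1) = d n * P.β n)
    (hwz : ∀ (n : ℕ) (y : K), y ≠ 0 → c n * (1 - q ^ e * y ^ 2) -
      d n * (1 - q ^ e * y ^ 2) * (1 - q * q ^ n / y) * (1 - q ^ (e + 1) * q ^ n * y) =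
      W y * g n (q ^ 3 * y) * ((1 - q * q ^ n / y) * (1 - q ^ n / y) * (1 - q ^ n / (q * y))) -
      g n y * ((1 - q ^ (e + 1) * q ^ n * y) * (1 - q ^ e * q ^ n * y) *
        (1 - q ^ (e - 1) * q ^ n * y))) :
    IsBaileyPair q P := by
  set F : ℤ → ℤ → K := fun n r =>
    w r * (1 - q ^ (6 * r + e)) * invPoch q (n - 3 * r) * invPoch q (n + 3 * r + e) with hF
  set S : ℕ → K := fun n =>
    ∑ t ∈ range (n + 1), P.α t / (qPoch q q (n - t) * qPoch (P.base * q) q (n + t)) with hS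
  have ha : 1 - P.base ≠ 0 := by rw [hbase, sub_ne_zero]; exact (hq e he0).symm
  -- The prefactor comes from `(q)_{e+n+t} = (q)_e (q^{e+1})_{n+t}`. Blocks beyond `n` contribute
  -- zero, so `R` is free, and the sums for `n` and `n + 1` can share `R = n + 2`.
  have hSF : ∀ n R : ℕ, n + 1 ≤ R → S n = qPoch q q e / (1 - P.base) *
      ∑ r ∈ range R, (F n r + F n (-r - 1)) := by
    intro n R hR
    set f : ℕ → K := fun t =>
      (1 - q ^ (2 * t + e)) * A t * invPoch q (n - t) * invPoch q (n + t + e) with hf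
    have h1 : ∑ r ∈ range R, (F n r + F n (-r - 1)) = ∑ t ∈ range (3 * R), f t := by
      rw [sum_range_three_mul]
      refine sum_congr rfl fun r _ => ?_
      rw [hA n r f fun t => rfl]
    have h2 : ∑ t ∈ range (3 * R), f t = ∑ t ∈ range (n + 1), f t := by
      symm
      refine sum_subset (range_mono (by omega)) fun t _ ht => ?_
      have : (n : ℤ) - t < 0 := by have := mt mem_range.2 ht; omega
      simp only [hf]
      rw [invPoch_of_neg q this]; ring
    rw [h1, h2, mul_sum]
    refine sum_congr rfl fun t ht => ?_
    have ht' : t ≤ n := Nat.lt_succ_iff.1 (mem_range.1 ht)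
    simp only [hf]
    have h3 : (n : ℤ) - t = (n - t : ℕ) := by push_cast [ht']; ring
    have h4 : (n : ℤ) + t + e = (e + (n + t) : ℕ) := by push_cast; ring
    have h5 : qPoch q q (e + (n + t)) = qPoch q q e * qPoch (P.base * q) q (n + t) := by
      rw [qPoch_add, hbase, mul_comm q]
    rw [h3, h4, invPoch_natCast, invPoch_natCast, h5, hα, hbase]
    have h6 := qPoch_self_ne_zero hq (n - t)
    have h7 := qPoch_self_ne_zero hq e
    have h8 : qPoch (q ^ e * q) q (n + t) ≠ 0 := qPoch_base_ne_zero (fun m hm => by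
      rw [← pow_add]; exact hq _ (by omega)) _
    rw [hbase] at ha
    rw [← pow_add, add_comm e]
    field_simp
  have hrec : ∀ n, c n * S (n + 1) = d n * S n := by
    intro n
    have := telescoping_recurrence (n := n) (R := n + 2) (e := e) hq0 hq (by exact_mod_cast he) hW
      (c := c n) (d := d n) (g := g n) (fun y hy => by
        have := hwz n y hy
        have h1 : (q : K) ^ ((e : ℤ) - 1) = q ^ (e - 1) := by
          rw [← zpow_natCast]; congr 1; push_cast [he0]; ring
        have h2 : (q : K) ^ ((e : ℤ) + 1) = q ^ (e + 1) := by
          rw [← zpow_natCast]; congr 1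
        rw [h1, h2, zpow_natCast]
        exact this) (F := F) (fun _ _ => rfl) le_rfl
    rw [hSF n (n + 2) (by omega), hSF (n + 1) (n + 2) le_rfl]
    linear_combination (qPoch q q e / (1 - P.base)) * this
  intro n
  -- Both sequences start at 1 and satisfy the same recurrence, whose leading coefficient `c n` is
  -- nonzero.
  change P.β n = S n
  induction n with
  | zero => simp [hS, hβ0, hα, hA0, ha]
  | succ n ih =>
    apply mul_left_cancel₀ (hc n)
    rw [hβ, hrec, ih]

theorem natCast_div_eq {X d : ℕ} {Y : ℤ} (hd : 0 < d) (h : (X : ℤ) = d * Y) :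
    ((X / d : ℕ) : ℤ) = Y := by
  rw [Int.natCast_ediv, h]
  exact Int.mul_ediv_cancel_left _ (by omega)

/-- For base `q` the reflection `t ↦ -t - 1` exchanges `n - t` and `n + t + 1` and sends `3r + 2` to
`3(-r-1)`. So residue 2 supplies the negative half of the bilateral sum; the power of `q` in `h2`
compensates for the change of `1 - q^{2t+1}`. -/
theorem block_eq_of_base_one {q : K} (hq0 : q ≠ 0) {A : ℕ → K} {w : ℤ → K}
    (h0 : ∀ r : ℕ, A (3 * r) = w r) (h1 : ∀ r, A (3 * r + 1) = 0)
    (h2 : ∀ r : ℕ, A (3 * r + 2) = -(w (-r - 1) * q ^ (-(6 * (r : ℤ) + 5)))) :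
    ∀ (n : ℤ) (r : ℕ), ∀ f : ℕ → K,
      (∀ t, f t = (1 - q ^ (2 * t + 1)) * A t * invPoch q (n - t) *
        invPoch q (n + t + (1 : ℕ))) →
      f (3 * r) + f (3 * r + 1) + f (3 * r + 2) =
      w r * (1 - q ^ (6 * (r : ℤ) + (1 : ℕ))) * invPoch q (n - 3 * r) *
        invPoch q (n + 3 * r + (1 : ℕ)) +
      w (-r - 1) * (1 - q ^ (6 * (-r - 1 : ℤ) + (1 : ℕ))) * invPoch q (n - 3 * (-r - 1)) *
        invPoch q (n + 3 * (-r - 1) + (1 : ℕ)) := by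
  intro n r f hf
  rw [hf, hf, hf, h0, h1, h2]
  have e1 : q ^ (2 * (3 * r) + 1) = q ^ (6 * (r : ℤ) + (1 : ℕ)) := by
    rw [← zpow_natCast]; congr 1; push_cast; ring
  have e2 : q ^ (2 * (3 * r + 2) + 1) = (q ^ (-(6 * (r : ℤ) + 5)))⁻¹ := by
    rw [← zpow_neg, ← zpow_natCast]; congr 1; push_cast; ring
  have e3 : 6 * (-r - 1 : ℤ) + (1 : ℕ) = -(6 * (r : ℤ) + 5) := by push_cast; ring
  have e4 : n - (3 * r + 2 : ℕ) = n + 3 * (-r - 1) + (1 : ℕ) := by push_cast; ring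
  have e5 : n + (3 * r + 2 : ℕ) + (1 : ℕ) = n - 3 * (-r - 1) := by push_cast; ring
  rw [e1, e2, e3, e4, e5]
  have : q ^ (-(6 * (r : ℤ) + 5)) ≠ 0 := zpow_ne_zero _ hq0
  push_cast
  field_simp
  ring

/-- For base `q²` the reflection is `t ↦ -t - 2`, which sends `3r + 1` to `3(-r-1)`; residue 1 plays
the part that residue 2 has for base `q`. -/
theorem block_eq_of_base_two {q : K} (hq0 : q ≠ 0) {A : ℕ → K} {w : ℤ → K}
    (h0 : ∀ r : ℕ, A (3 * r) = w r)
    (h1 : ∀ r : ℕ, A (3 * r + 1) = -(w (-r - 1) * q ^ (-(6 * (r : ℤ) + 4))))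
    (h2 : ∀ r, A (3 * r + 2) = 0) :
    ∀ (n : ℤ) (r : ℕ), ∀ f : ℕ → K,
      (∀ t, f t = (1 - q ^ (2 * t + 2)) * A t * invPoch q (n - t) *
        invPoch q (n + t + (2 : ℕ))) →
      f (3 * r) + f (3 * r + 1) + f (3 * r + 2) =
      w r * (1 - q ^ (6 * (r : ℤ) + (2 : ℕ))) * invPoch q (n - 3 * r) *
        invPoch q (n + 3 * r + (2 : ℕ)) +
      w (-r - 1) * (1 - q ^ (6 * (-r - 1 : ℤ) + (2 : ℕ))) * invPoch q (n - 3 * (-r - 1)) *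
        invPoch q (n + 3 * (-r - 1) + (2 : ℕ)) := by
  intro n r f hf
  rw [hf, hf, hf, h0, h1, h2]
  have e1 : q ^ (2 * (3 * r) + 2) = q ^ (6 * (r : ℤ) + (2 : ℕ)) := by
    rw [← zpow_natCast]; congr 1; push_cast; ring
  have e2 : q ^ (2 * (3 * r + 1) + 2) = (q ^ (-(6 * (r : ℤ) + 4)))⁻¹ := by
    rw [← zpow_neg, ← zpow_natCast]; congr 1; push_cast; ring
  have e3 : 6 * (-r - 1 : ℤ) + (2 : ℕ) = -(6 * (r : ℤ) + 4) := by push_cast; ring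
  have e4 : n - (3 * r + 1 : ℕ) = n + 3 * (-r - 1) + (2 : ℕ) := by push_cast; ring
  have e5 : n + (3 * r + 1 : ℕ) + (2 : ℕ) = n - 3 * (-r - 1) := by push_cast; ring
  rw [e1, e2, e3, e4, e5]
  have : q ^ (-(6 * (r : ℤ) + 4)) ≠ 0 := zpow_ne_zero _ hq0
  push_cast
  field_simp
  ring

theorem byResidue_zero {K : Type*} (f₀ f₁ f₂ : ℕ → K) (r : ℕ) : byResidue f₀ f₁ f₂ (3 * r) = f₀ (3 * r) := by
  simp [byResidue]

theorem byResidue_one {K : Type*} (f₀ f₁ f₂ : ℕ → K) (r : ℕ) :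
    byResidue f₀ f₁ f₂ (3 * r + 1) = f₁ (3 * r + 1) := by
  simp [byResidue, Nat.add_mod]

theorem byResidue_two {K : Type*} (f₀ f₁ f₂ : ℕ → K) (r : ℕ) :
    byResidue f₀ f₁ f₂ (3 * r + 2) = f₂ (3 * r + 2) := by
  simp [byResidue, Nat.add_mod]

/-- The exponent `E` with `α̃_{3 r} = q^{E(r)}`. -/
def PairNo.expo : PairNo → ℤ → ℤ
  | one, r => 6 * r ^ 2 - r
  | two, r => 6 * r ^ 2 + r
  | three, r => 3 * r ^ 2 - 2 * r
  | four, r => 3 * r ^ 2 - r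
  | five, r => (9 * r ^ 2 - 3 * r) / 2

theorem PairNo.two_mul_expo_five (r : ℤ) : 2 * PairNo.expo .five r = 9 * r ^ 2 - 3 * r := by
  have h : (2 : ℤ) ∣ 9 * r ^ 2 - 3 * r := by
    obtain ⟨k, rfl | rfl⟩ := r.even_or_odd'
    · exact ⟨18 * k ^ 2 - 3 * k, by ring⟩
    · exact ⟨18 * k ^ 2 + 15 * k + 3, by ring⟩
  exact Int.mul_ediv_cancel' h

/-- The exponent of the base of an initial pair. -/
def PairNo.exponent : PairNo → ℕ
  | one => 1
  | two => 2
  | three => 1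
  | four => 2
  | five => 1

theorem PairNo.base_eq (q : K) (p : PairNo) : p.base q = q ^ p.exponent := by
  cases p <;> simp [PairNo.base, PairNo.exponent]

theorem PairNo.alphaTilde_three_mul (q : K) (p : PairNo) (r : ℕ) :
    p.alphaTilde q (3 * r) = q ^ p.expo r := by
  have h1 : r ≤ r ^ 2 := Nat.le_self_pow two_ne_zero r
  cases p <;> simp only [PairNo.alphaTilde, PairNo.expo, byResidue_zero] <;> rw [← zpow_natCast]
  · congr 1
    refine natCast_div_eq (by norm_num) ?_
    rw [Nat.cast_sub (by nlinarith)]; push_cast; ring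
  · congr 1
    refine natCast_div_eq (by norm_num) ?_
    push_cast; ring
  · congr 1
    refine natCast_div_eq (by norm_num) ?_
    rw [Nat.cast_sub (by nlinarith)]; push_cast; ring
  · congr 1
    refine natCast_div_eq (by norm_num) ?_
    rw [Nat.cast_sub (by nlinarith)]; push_cast; ring
  · congr 1
    refine natCast_div_eq (by norm_num) ?_
    have := PairNo.two_mul_expo_five r
    simp only [PairNo.expo] at this
    rw [Nat.cast_sub (by nlinarith)]; push_cast; rw [this]; ring

/-- The exponent is written as that of residue 0 at the reflected index `-r - 1`, with the
correction required by `block_eq_of_base_two`. -/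
theorem PairNo.alphaTilde_one_mod (q : K) (p : PairNo) (r : ℕ) :
    p.alphaTilde q (3 * r + 1) = if p.exponent = 1 then 0 else
      -q ^ (p.expo (-r - 1) - (6 * r + 4)) := by
  have h1 : r ≤ r ^ 2 := Nat.le_self_pow two_ne_zero r
  cases p <;> simp only [PairNo.alphaTilde, PairNo.expo, byResidue_one, PairNo.exponent,
    if_true, OfNat.ofNat_ne_one, if_false] <;> rw [← zpow_natCast]
  · congr 2
    refine natCast_div_eq (by norm_num) ?_
    push_cast; ring
  · congr 2
    refine natCast_div_eq (by norm_num) ?_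
    rw [Nat.cast_sub (by nlinarith)]; push_cast; ring

theorem PairNo.alphaTilde_two_mod (q : K) (p : PairNo) (r : ℕ) :
    p.alphaTilde q (3 * r + 2) = if p.exponent = 1 then
      -q ^ (p.expo (-r - 1) - (6 * r + 5)) else 0 := by
  have h1 : r ≤ r ^ 2 := Nat.le_self_pow two_ne_zero r
  cases p <;> simp only [PairNo.alphaTilde, PairNo.expo, byResidue_two, PairNo.exponent,
    if_true, OfNat.ofNat_ne_one, if_false] <;> rw [← zpow_natCast]
  · congr 2
    refine natCast_div_eq (by norm_num) ?_
    rw [Nat.cast_sub (by nlinarith)]; push_cast; ring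
  · congr 2
    refine natCast_div_eq (by norm_num) ?_
    rw [Nat.cast_sub (by nlinarith)]; push_cast; ring
  · congr 2
    refine natCast_div_eq (by norm_num) ?_
    have := PairNo.two_mul_expo_five (-r - 1)
    simp only [PairNo.expo] at this
    rw [Nat.cast_sub (by nlinarith)]; push_cast; linear_combination -this

theorem PairNo.alphaTilde_zero (q : K) (p : PairNo) : p.alphaTilde q 0 = 1 := by
  cases p <;> simp [PairNo.alphaTilde, byResidue]

theorem PairNo.isBaileyPair_of_telescoping {q : K} (hq0 : q ≠ 0) (hq : ∀ n, 1 ≤ n → q ^ n ≠ 1)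
    (p : PairNo) (W : K → K)
    (hW : ∀ r : ℤ, q ^ p.expo (r + 1) = q ^ p.expo r * W (q ^ (3 * r)))
    {c d : ℕ → K} {g : ℕ → K → K} (hc : ∀ n, c n ≠ 0)
    (hβ : ∀ n, c n * p.beta q (n + 1) = d n * p.beta q n)
    (hwz : ∀ (n : ℕ) (y : K), y ≠ 0 → c n * (1 - q ^ p.exponent * y ^ 2) -
      d n * (1 - q ^ p.exponent * y ^ 2) * (1 - q * q ^ n / y) *
        (1 - q ^ (p.exponent + 1) * q ^ n * y) =
      W y * g n (q ^ 3 * y) * ((1 - q * q ^ n / y) * (1 - q ^ n / y) * (1 - q ^ n / (q * y))) -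
      g n y * ((1 - q ^ (p.exponent + 1) * q ^ n * y) * (1 - q ^ p.exponent * q ^ n * y) *
        (1 - q ^ (p.exponent - 1) * q ^ n * y))) :
    IsBaileyPair q (p.pair q) := by
  refine IsBaileyPair.of_telescoping (e := p.exponent) hq0 hq (by cases p <;> simp [exponent])
    (by cases p <;> simp [exponent]) (p.base_eq q) (fun _ => rfl) (p.alphaTilde_zero q)
    (w := fun r => q ^ p.expo r) hW ?_ hc (by cases p <;> simp [pair, beta]) hβ hwz
  have h : p.exponent = 1 ∨ p.exponent = 2 := by cases p <;> simp [exponent]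
  rcases h with h | h <;> rw [h]
  · refine block_eq_of_base_one hq0 (A := p.alphaTilde q) (w := fun r => q ^ p.expo r) (p.alphaTilde_three_mul q)
      (fun r => by rw [p.alphaTilde_one_mod, if_pos h]) (fun r => ?_)
    rw [p.alphaTilde_two_mod, if_pos h, ← zpow_add₀ hq0]; rfl
  · refine block_eq_of_base_two hq0 (A := p.alphaTilde q) (w := fun r => q ^ p.expo r) (p.alphaTilde_three_mul q) (fun r => ?_)
      (fun r => by rw [p.alphaTilde_two_mod, if_neg (by omega)])
    rw [p.alphaTilde_one_mod, if_neg (by omega), ← zpow_add₀ hq0]; rfl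

/-- The five initial pairs are Bailey pairs. -/
theorem PairNo.isBaileyPair {q : K} (hq0 : q ≠ 0) (hq : ∀ n, 1 ≤ n → q ^ n ≠ 1)
    (h2 : (2 : K) ≠ 0) (p : PairNo) : IsBaileyPair q (p.pair q) := by
  have hn : ∀ n, 1 - q * q ^ n ≠ 0 := fun n => by
    rw [← pow_succ', sub_ne_zero]; exact (hq _ (by omega)).symm
  have hn1 : ∀ n, 1 - q * q ^ (2 * n) ≠ 0 := fun n => hn _
  have hn2 : ∀ n, 1 - q * q ^ (2 * n + 1) ≠ 0 := fun n => hn _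
  have hn3 : ∀ n, 1 - q ^ 2 * q ^ (2 * n) ≠ 0 := fun n => by
    have := hn (2 * n + 1); rwa [pow_succ', ← mul_assoc, ← pow_two] at this
  have hn4 : ∀ n, 1 - q ^ 2 * q ^ (2 * n + 1) ≠ 0 := fun n => by
    have := hn (2 * n + 2); rwa [pow_succ', ← mul_assoc, ← pow_two] at this
  have hp := qPoch_self_ne_zero hq
  have hp2 : ∀ n, qPoch (q ^ 2) q n ≠ 0 := fun n => by
    rw [pow_two]
    exact qPoch_base_ne_zero (fun m _ => by rw [← pow_succ']; exact hq _ (by omega)) n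
  -- For `n = 0` this is `2 ≠ 0`, needed because `(-1)_n`, which occurs in pair 5, has the factor 2
  -- for `n ≥ 1`.
  have hm : ∀ n, 1 + q ^ n ≠ 0 := fun n h => by
    rcases Nat.eq_zero_or_pos n with rfl | hpos
    · apply h2; rw [← h]; norm_num
    · apply hq (2 * n) (by omega)
      rw [mul_comm, pow_mul, eq_neg_of_add_eq_zero_right h]; norm_num
  -- In each case `W` is the ratio of consecutive weights in terms of `y = q^{3r}`, `d / c` is the
  -- ratio `β_{n+1} / β_n`, and `g` is the certificate. What remains is a rational identity in `q`,
  -- `x = q^n` and `y`.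
  cases p
  · refine isBaileyPair_of_telescoping hq0 hq _ (fun y => q ^ 5 * y ^ 4)
      (fun r => ?_) (c := fun n => (1 - q * q ^ (2 * n)) * (1 - q * q ^ (2 * n + 1)))
      (d := fun _ => 1) (g := fun n y => -q ^ n * q / y)
      (fun n => mul_ne_zero (hn1 n) (hn2 n)) (fun n => ?_) fun n y hy => ?_
    · simp only [expo]
      rw [← zpow_natCast, ← zpow_natCast, ← zpow_mul, ← zpow_add₀ hq0, ← zpow_add₀ hq0]
      congr 1; push_cast; ring
    · simp only [beta]
      rw [mul_add_one, qPoch_succ, qPoch_succ]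
      have := hp (2 * n); have := hn1 n; have := hn2 n
      field_simp
    · simp only [exponent]
      rw [pow_succ _ (2 * n), mul_comm 2 n, pow_mul]
      generalize q ^ n = x
      field_simp
      ring
  · refine isBaileyPair_of_telescoping hq0 hq _ (fun y => q ^ 7 * y ^ 4)
      (fun r => ?_) (c := fun n => (1 - q ^ 2 * q ^ (2 * n)) * (1 - q ^ 2 * q ^ (2 * n + 1)))
      (d := fun _ => 1) (g := fun n y => -q ^ n * q / y)
      (fun n => mul_ne_zero (hn3 n) (hn4 n)) (fun n => ?_) fun n y hy => ?_
    · simp only [expo]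
      rw [← zpow_natCast, ← zpow_natCast, ← zpow_mul, ← zpow_add₀ hq0, ← zpow_add₀ hq0]
      congr 1; push_cast; ring
    · simp only [beta]
      rw [mul_add_one, qPoch_succ, qPoch_succ]
      have := hp2 (2 * n); have := hn3 n; have := hn4 n
      field_simp
    · simp only [exponent]
      rw [pow_succ _ (2 * n), mul_comm 2 n, pow_mul]
      generalize q ^ n = x
      field_simp
      ring
  · refine isBaileyPair_of_telescoping hq0 hq _ (fun y => q * y ^ 2)
      (fun r => ?_) (c := fun n => (1 - q * q ^ (2 * n)) * (1 - q * q ^ (2 * n + 1)))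
      (d := fun n => q ^ (2 * n)) (g := fun _ _ => -1)
      (fun n => mul_ne_zero (hn1 n) (hn2 n)) (fun n => ?_) fun n y hy => ?_
    · simp only [expo]
      rw [← zpow_natCast, ← zpow_mul, ← zpow_one_add₀ hq0, ← zpow_add₀ hq0]
      congr 1; push_cast; ring
    · simp only [beta]
      have : q ^ ((n + 1) ^ 2 - (n + 1)) = q ^ (2 * n) * q ^ (n ^ 2 - n) := by
        rw [← pow_add]; congr 1
        have := Nat.le_self_pow two_ne_zero n
        have h3 : (n + 1) ^ 2 = n ^ 2 + 2 * n + 1 := by ring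
        omega
      rw [mul_add_one, qPoch_succ, qPoch_succ, this]
      have := hp (2 * n); have := hn1 n; have := hn2 n
      field_simp
    · simp only [exponent]
      rw [pow_succ _ (2 * n), mul_comm 2 n, pow_mul]
      generalize q ^ n = x
      field_simp
      ring
  · refine isBaileyPair_of_telescoping hq0 hq _ (fun y => q ^ 2 * y ^ 2)
      (fun r => ?_) (c := fun n => (1 - q ^ 2 * q ^ (2 * n)) * (1 - q ^ 2 * q ^ (2 * n + 1)))
      (d := fun n => q * q ^ (2 * n)) (g := fun _ _ => -1)
      (fun n => mul_ne_zero (hn3 n) (hn4 n)) (fun n => ?_) fun n y hy => ?_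
    · simp only [expo]
      rw [← zpow_natCast, ← zpow_natCast, ← zpow_mul, ← zpow_add₀ hq0, ← zpow_add₀ hq0]
      congr 1; push_cast; ring
    · simp only [beta]
      have : q ^ ((n + 1) ^ 2) = q * q ^ (2 * n) * q ^ (n ^ 2) := by ring
      rw [mul_add_one, qPoch_succ, qPoch_succ, this]
      have := hp2 (2 * n); have := hn3 n; have := hn4 n
      field_simp
    · simp only [exponent]
      rw [pow_succ _ (2 * n), mul_comm 2 n, pow_mul]
      generalize q ^ n = x
      field_simp
      ring
  · refine isBaileyPair_of_telescoping hq0 hq _ (fun y => q ^ 3 * y ^ 3)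
      (fun r => ?_) (c := fun n => (1 + q ^ n) * ((1 - q * q ^ (2 * n)) * (1 - q * q ^ (2 * n + 1))))
      (d := fun n => 1 + q ^ (3 * n)) (g := fun n y => -q ^ n * (1 + q / y))
      (fun n => mul_ne_zero (hm n) (mul_ne_zero (hn1 n) (hn2 n))) (fun n => ?_) fun n y hy => ?_
    · rw [← zpow_natCast, ← zpow_natCast, ← zpow_mul, ← zpow_add₀ hq0, ← zpow_add₀ hq0]
      congr 1
      have h3 := two_mul_expo_five r
      have h4 := two_mul_expo_five (r + 1)
      have h5 : (r + 1) ^ 2 = r ^ 2 + 2 * r + 1 := by ring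
      push_cast
      rw [h5] at h4
      omega
    · simp only [beta]
      rw [mul_add_one, qPoch_succ q, qPoch_succ q, qPoch_succ (-1), qPoch_succ (-1)]
      have := hp (2 * n); have := hn1 n; have := hn2 n; have := hm n
      have h6 : qPoch (-1) q n ≠ 0 := qPoch_ne_zero fun t _ h => hm t (by
        rw [← h]; ring)
      have h7 : 1 - (-1) * q ^ n ≠ 0 := by rwa [neg_one_mul, sub_neg_eq_add]
      rw [neg_one_mul, sub_neg_eq_add, neg_one_mul, sub_neg_eq_add, ← pow_mul]
      field_simp
    · simp only [exponent]
      rw [pow_succ _ (2 * n), mul_comm 2 n, mul_comm 3 n, pow_mul, pow_mul]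
      generalize q ^ n = x
      field_simp
      ring

end InitialPairs

end A22

namespace A22

/-! ### Decreasing tuples and the removal of their first entry -/

section Chains

theorem mem_chains {r n : ℕ} {J : Fin r → ℕ} :
    J ∈ chains r n ↔ (∀ i, J i ≤ n) ∧ Antitone J := by
  simp [chains, Fintype.mem_piFinset]

theorem entry_one {r : ℕ} (J : Fin (r + 1) → ℕ) : entry J 1 = J 0 := by
  simp [entry]

theorem entry_cons_succ {r : ℕ} (N : ℕ) (J : Fin r → ℕ) {m : ℕ} (hm : 1 ≤ m) :
    entry (Fin.cons N J : Fin (r + 1) → ℕ) (m + 1) = entry J m := by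
  unfold entry
  by_cases h : m ≤ r
  · rw [dif_pos ⟨by omega, by omega⟩, dif_pos ⟨hm, h⟩]
    have : (⟨m + 1 - 1, by omega⟩ : Fin (r + 1)) = Fin.succ ⟨m - 1, by omega⟩ := by
      ext; simp; omega
    rw [this, Fin.cons_succ]
  · rw [dif_neg (by omega), dif_neg (by omega)]

theorem mem_chainsFrom {r N : ℕ} {J : Fin (r + 1) → ℕ} :
    J ∈ chainsFrom (r + 1) N ↔ J 0 = N ∧ Antitone J := by
  rw [chainsFrom, mem_filter, mem_chains, entry_one]
  constructor
  · rintro ⟨⟨_, h⟩, h'⟩; exact ⟨h', h⟩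
  · rintro ⟨h, h'⟩; exact ⟨⟨fun i => h ▸ h' (Fin.zero_le i), h'⟩, h⟩

/-- Used alternately with `sum_chainsFrom_eq`, this peels off the outermost index, so that a sum
over chains becomes an iterated sum. -/
theorem sum_chains_eq {M : Type*} [AddCommMonoid M] (r n : ℕ) (f : (Fin (r + 1) → ℕ) → M) :
    ∑ J ∈ chains (r + 1) n, f J = ∑ N ∈ range (n + 1), ∑ J ∈ chainsFrom (r + 1) N, f J := by
  rw [← sum_fiberwise_of_maps_to (g := fun J => J 0) (t := range (n + 1))
    fun J hJ => mem_range.2 (Nat.lt_succ_iff.2 ((mem_chains.1 hJ).1 0))]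
  refine sum_congr rfl fun N hN => sum_congr ?_ fun _ _ => rfl
  ext J
  rw [mem_filter, mem_chains, mem_chainsFrom]
  have := mem_range.1 hN
  constructor
  · rintro ⟨⟨_, h⟩, h'⟩; exact ⟨h', h⟩
  · rintro ⟨h, h'⟩; exact ⟨⟨fun i => (h' (Fin.zero_le i)).trans (by omega), h'⟩, h⟩

theorem sum_chainsFrom_eq {M : Type*} [AddCommMonoid M] (r N : ℕ) (f : (Fin (r + 1) → ℕ) → M) :
    ∑ J ∈ chainsFrom (r + 1) N, f J = ∑ J ∈ chains r N, f (Fin.cons N J) := by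
  refine sum_bij' (fun J _ => Fin.tail J) (fun J _ => Fin.cons N J) ?_ ?_ ?_ ?_ ?_
  · intro J hJ
    obtain ⟨h0, h⟩ := mem_chainsFrom.1 hJ
    exact mem_chains.2 ⟨fun i => h0 ▸ h (Fin.zero_le _), fun a b hab =>
      h (Fin.succ_le_succ_iff.2 hab)⟩
  · intro J hJ
    obtain ⟨h0, h⟩ := mem_chains.1 hJ
    refine mem_chainsFrom.2 ⟨rfl, fun a b hab => ?_⟩
    induction a using Fin.cases with
    | zero =>
      induction b using Fin.cases with
      | zero => exact le_rfl
      | succ b => simpa using h0 b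
    | succ a =>
      induction b using Fin.cases with
      | zero => simp at hab
      | succ b => simpa using h (Fin.succ_le_succ_iff.1 hab)
  · intro J hJ
    have h0 := (mem_chainsFrom.1 hJ).1
    rw [← h0]
    exact Fin.cons_self_tail J
  · intro J _
    exact Fin.tail_cons (α := fun _ => ℕ) N J
  · intro J hJ
    have h0 := (mem_chainsFrom.1 hJ).1
    congr 1
    rw [← h0]
    exact (Fin.cons_self_tail J).symm

theorem chains_zero (n : ℕ) : chains 0 n = {Fin.elim0} := by
  ext J
  simp only [mem_chains, mem_singleton]
  exact ⟨fun _ => Subsingleton.elim _ _, fun _ => ⟨fun i => i.elim0, fun i => i.elim0⟩⟩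

end Chains

/-! ### Composition of kernels and the explicit multi-sums -/

section Kernels

variable {K : Type*} [Field K]

/-- The iterated sum obtained by applying a list of kernels, the first one last. -/
def pathSum : List (ℕ → ℕ → K) → (ℕ → K) → ℕ → K
  | [], b, n => b n
  | g :: l, b, n => ∑ j ∈ range (n + 1), g n j * pathSum l b j

/-- The weight of a path `j_u, j_{u+1}, …` with respect to a list of kernels. -/
def pathWeight : List (ℕ → ℕ → K) → (ℕ → ℕ) → ℕ → K
  | [], _, _ => 1
  | g :: l, j, u => g (j u) (j (u + 1)) * pathWeight l j (u + 1)

theorem pathSum_append (l l' : List (ℕ → ℕ → K)) (b : ℕ → K) :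
    pathSum (l ++ l') b = pathSum l (pathSum l' b) := by
  induction l with
  | nil => rfl
  | cons g l ih =>
    funext n
    rw [List.cons_append, pathSum, pathSum, ih]

theorem pathWeight_append (l l' : List (ℕ → ℕ → K)) (j : ℕ → ℕ) (u : ℕ) :
    pathWeight (l ++ l') j u = pathWeight l j u * pathWeight l' j (u + l.length) := by
  induction l generalizing u with
  | nil => simp [pathWeight]
  | cons g l ih =>
    rw [List.cons_append, pathWeight, pathWeight, ih, List.length_cons, mul_assoc,
      add_assoc u 1, add_comm 1]

theorem pathWeight_congr (l : List (ℕ → ℕ → K)) {j j' : ℕ → ℕ} {u u' : ℕ}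
    (h : ∀ m, j (u + m) = j' (u' + m)) : pathWeight l j u = pathWeight l j' u' := by
  induction l generalizing u u' with
  | nil => rfl
  | cons g l ih =>
    rw [pathWeight, pathWeight, ih (u := u + 1) (u' := u' + 1) fun m => by
      rw [add_assoc, add_assoc]; exact h _]
    have h0 := h 0
    rw [add_zero, add_zero] at h0
    rw [h0, h 1]

/-- A list of `s` kernels links `s + 1` indices. The first, `j_1 = N`, is the free index of the
iterated sum, and the last is the argument of the initial sequence. -/
theorem sum_chainsFrom_pathWeight (l : List (ℕ → ℕ → K)) (b : ℕ → K) (N : ℕ) :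
    ∑ J ∈ chainsFrom (l.length + 1) N,
      pathWeight l (entry J) 1 * b (entry J (l.length + 1)) = pathSum l b N := by
  induction l generalizing N with
  | nil =>
    rw [sum_chainsFrom_eq]
    simp [chains_zero, pathWeight, pathSum, entry]
  | cons g l ih =>
    rw [sum_chainsFrom_eq, List.length_cons, sum_chains_eq, pathSum]
    refine sum_congr rfl fun n _ => ?_
    rw [← ih, mul_sum]
    refine sum_congr rfl fun J hJ => ?_
    have h1 : entry (Fin.cons N J : Fin (l.length + 1 + 1) → ℕ) 1 = N := by simp [entry_one]
    have h2 : entry (Fin.cons N J : Fin (l.length + 1 + 1) → ℕ) (1 + 1) = n := by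
      rw [entry_cons_succ N J le_rfl, entry_one, (mem_chainsFrom.1 hJ).1]
    rw [pathWeight, h1, h2, entry_cons_succ N J (by omega), mul_assoc]
    congr 2
    refine pathWeight_congr l fun m => ?_
    rw [show 1 + 1 + m = (1 + m) + 1 by ring, entry_cons_succ N J (by omega)]

/-- The kernel of the first forward move with base `a`. -/
def kernelF1 (q a : K) (n j : ℕ) : K := a ^ j * q ^ (j ^ 2) / qPoch q q (n - j)

/-- The kernel of the first backward move with base `a`. -/
def kernelB1 (q a : K) (n j : ℕ) : K :=
  (-1) ^ n * (a ^ n)⁻¹ * (q ^ (n ^ 2))⁻¹ * ((-1) ^ j * q ^ ((n - j).choose 2) / qPoch q q (n - j))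

/-- The kernel of the second forward move with base `a`. -/
def kernelF2 (q a : K) (n j : ℕ) : K :=
  qPoch (-q) q j * q ^ (j.choose 2) * a ^ j / (qPoch q q (n - j) * qPoch (-a) q n)

theorem moveF1_iterate_base (q : K) (s : ℕ) (P : SeqPair K) :
    ((moveF1 q)^[s] P).base = P.base := by
  induction s with
  | zero => rfl
  | succ s ih => rw [Function.iterate_succ_apply']; exact ih

theorem moveB1_iterate_base (q : K) (s : ℕ) (P : SeqPair K) :
    ((moveB1 q)^[s] P).base = P.base := by
  induction s with
  | zero => rfl
  | succ s ih => rw [Function.iterate_succ_apply']; exact ih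

theorem moveF1_iterate_beta (q : K) (s : ℕ) (P : SeqPair K) :
    ((moveF1 q)^[s] P).β = pathSum (List.replicate s (kernelF1 q P.base)) P.β := by
  induction s with
  | zero => rfl
  | succ s ih =>
    rw [Function.iterate_succ_apply', List.replicate_succ]
    funext n
    rw [pathSum, ← ih]
    simp only [moveF1, kernelF1, moveF1_iterate_base]

theorem moveB1_iterate_beta (q : K) (s : ℕ) (P : SeqPair K) :
    ((moveB1 q)^[s] P).β = pathSum (List.replicate s (kernelB1 q P.base)) P.β := by
  induction s with
  | zero => rfl
  | succ s ih =>
    rw [Function.iterate_succ_apply', List.replicate_succ]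
    funext n
    rw [pathSum, ← ih]
    simp only [moveB1, kernelB1, moveB1_iterate_base, mul_sum, mul_assoc]

/-- The kernels of `shiftMoves`. -/
def shiftKernels (q a : K) (d : ℤ) : List (ℕ → ℕ → K) :=
  List.replicate d.natAbs (if 0 ≤ d then kernelF1 q a else kernelB1 q a)

theorem shiftMoves_base (q : K) (d : ℤ) (P : SeqPair K) : (shiftMoves q d P).base = P.base := by
  unfold shiftMoves
  split_ifs
  · exact moveF1_iterate_base _ _ _
  · exact moveB1_iterate_base _ _ _

theorem shiftMoves_beta (q : K) (d : ℤ) (P : SeqPair K) :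
    (shiftMoves q d P).β = pathSum (shiftKernels q P.base d) P.β := by
  unfold shiftMoves shiftKernels
  split_ifs
  · exact moveF1_iterate_beta _ _ _
  · exact moveB1_iterate_beta _ _ _

/-- The moves of the first kind and the base change, without the last move. -/
def coreMoves (q : K) (d i : ℕ) (P : SeqPair K) : SeqPair K :=
  if i = 0 then (moveF1 q)^[d - 1] P
  else (moveF1 q)^[i - 1] (changeBase q (shiftMoves q ((d : ℤ) - i) P))

/-- The base after the moves: `a` if `i = 0`, and `a / q` otherwise. -/
def finalBase (q a : K) (i : ℕ) : K := if i = 0 then a else a / q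

/-- The kernels of `coreMoves`. -/
def coreKernels (q a : K) (d i : ℕ) : List (ℕ → ℕ → K) :=
  if i = 0 then List.replicate (d - 1) (kernelF1 q a)
  else List.replicate (i - 1) (kernelF1 q (a / q)) ++ shiftKernels q a ((d : ℤ) - i)

theorem coreMoves_base (q : K) (d i : ℕ) (P : SeqPair K) :
    (coreMoves q d i P).base = finalBase q P.base i := by
  unfold coreMoves finalBase
  split_ifs
  · rw [moveF1_iterate_base]
  · rw [moveF1_iterate_base, changeBase, shiftMoves_base]

theorem coreMoves_beta (q : K) (d i : ℕ) (P : SeqPair K) :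
    (coreMoves q d i P).β = pathSum (coreKernels q P.base d i) P.β := by
  unfold coreMoves coreKernels
  split_ifs
  · rw [moveF1_iterate_beta]
  · rw [moveF1_iterate_beta, pathSum_append]
    simp only [changeBase, shiftMoves_base, shiftMoves_beta]

theorem length_coreKernels (q a : K) {d i : ℕ} (h : 1 ≤ d ∨ 1 ≤ i) :
    (coreKernels q a d i).length + 1 = if i ≤ d then d else 2 * i - d := by
  unfold coreKernels shiftKernels
  split_ifs <;> simp <;> omega

theorem pathWeight_replicate_F1 {q a : K} (j : ℕ → ℕ) (l u : ℕ) :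
    pathWeight (List.replicate l (kernelF1 q a)) j u =
      a ^ (∑ m ∈ Ico (u + 1) (u + l + 1), j m) * q ^ (∑ m ∈ Ico (u + 1) (u + l + 1), j m ^ 2) /
        ∏ m ∈ Ico u (u + l), qPoch q q (j m - j (m + 1)) := by
  induction l generalizing u with
  | zero => simp [pathWeight]
  | succ l ih =>
    rw [List.replicate_succ, pathWeight, ih, sum_eq_sum_Ico_succ_bot (show u + 1 < u + (l + 1) + 1 by omega),
      sum_eq_sum_Ico_succ_bot (show u + 1 < u + (l + 1) + 1 by omega),
      prod_eq_prod_Ico_succ_bot (show u < u + (l + 1) by omega),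
      kernelF1, show u + (l + 1) = u + 1 + l by ring, div_mul_div_comm, pow_add, pow_add]
    congr 1
    ring

/-- Unlike F1, the backward kernel carries its powers on the outer index, so the sums include `j_u`
and omit `j_{u+l}`. The signs of intermediate indices occur twice and cancel. -/
theorem pathWeight_replicate_B1 {q a : K} (hq0 : q ≠ 0) (ha : a ≠ 0) (j : ℕ → ℕ) (l u : ℕ) :
    pathWeight (List.replicate l (kernelB1 q a)) j u =
      (-1) ^ (j u + j (u + l)) * a ^ (-∑ m ∈ Ico u (u + l), (j m : ℤ)) *
        q ^ (-∑ m ∈ Ico u (u + l), (j m : ℤ) ^ 2 +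
          ∑ m ∈ Ico u (u + l), ((j m - j (m + 1)).choose 2 : ℤ)) /
        ∏ m ∈ Ico u (u + l), qPoch q q (j m - j (m + 1)) := by
  induction l generalizing u with
  | zero => simp [pathWeight, ← two_mul]
  | succ l ih =>
    rw [List.replicate_succ, pathWeight, ih, prod_eq_prod_Ico_succ_bot (show u < u + (l + 1) by omega),
      sum_eq_sum_Ico_succ_bot (show u < u + (l + 1) by omega),
      sum_eq_sum_Ico_succ_bot (show u < u + (l + 1) by omega),
      sum_eq_sum_Ico_succ_bot (show u < u + (l + 1) by omega),
      kernelB1, show u + (l + 1) = u + 1 + l by ring,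
      mul_div_assoc' _ _ (qPoch q q (j u - j (u + 1))), div_mul_div_comm]
    congr 1
    have h1 : (-1 : K) ^ (j u + j (u + 1 + l)) =
        (-1) ^ j u * (-1) ^ j (u + 1) * (-1) ^ (j (u + 1) + j (u + 1 + l)) := by
      have : (-1 : K) ^ j (u + 1) * (-1) ^ j (u + 1) = 1 := by rw [← mul_pow]; simp
      rw [pow_add, pow_add]
      linear_combination (-((-1 : K) ^ j u) * (-1) ^ j (u + 1 + l)) * this
    have h2 : ∀ x y : ℤ,
        q ^ (-((j u : ℤ) ^ 2 + x) + (((j u - j (u + 1)).choose 2 : ℕ) + y)) =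
        (q ^ (j u ^ 2))⁻¹ * q ^ ((j u - j (u + 1)).choose 2) * q ^ (-x + y) := by
      intro x y
      rw [← zpow_natCast, ← zpow_natCast, ← zpow_neg, ← zpow_add₀ hq0, ← zpow_add₀ hq0]
      congr 1; push_cast; ring
    have h3 : ∀ x : ℤ, a ^ (-((j u : ℤ) + x)) = (a ^ j u)⁻¹ * a ^ (-x) := by
      intro x
      rw [← zpow_natCast, ← zpow_neg, ← zpow_add₀ ha]
      congr 1; ring
    rw [h1, h2, h3]
    ring

theorem lin_add (j : ℕ → ℕ) {u m v : ℕ} (h1 : u ≤ m + 1) (h2 : m ≤ v) :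
    lin j u v = lin j u m + lin j (m + 1) v := by
  simp only [lin, ← Finset.Ico_add_one_right_eq_Icc]
  exact (sum_Ico_consecutive _ h1 (by omega)).symm

theorem sqr_add (j : ℕ → ℕ) {u m v : ℕ} (h1 : u ≤ m + 1) (h2 : m ≤ v) :
    sqr j u v = sqr j u m + sqr j (m + 1) v := by
  simp only [sqr, ← Finset.Ico_add_one_right_eq_Icc]
  exact (sum_Ico_consecutive _ h1 (by omega)).symm

@[simp] theorem lin_self (j : ℕ → ℕ) (u : ℕ) : lin j u u = j u := by simp [lin]

@[simp] theorem sqr_self (j : ℕ → ℕ) (u : ℕ) : sqr j u u = (j u : ℤ) ^ 2 := by simp [sqr]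

theorem den_eq (q : K) (j : ℕ → ℕ) {r : ℕ} (hr : 1 ≤ r) :
    den q j r = ∏ m ∈ Ico 1 r, qPoch q q (j m - j (m + 1)) := by
  rw [den, ← Finset.Ico_add_one_right_eq_Icc, Nat.sub_add_cancel hr]

theorem pathWeight_F1_eq {q a : K} (j : ℕ → ℕ) (l u : ℕ) :
    pathWeight (List.replicate l (kernelF1 q a)) j u =
      a ^ lin j (u + 1) (u + l) * q ^ sqr j (u + 1) (u + l) /
        ∏ m ∈ Ico u (u + l), qPoch q q (j m - j (m + 1)) := by
  rw [pathWeight_replicate_F1, ← zpow_natCast, ← zpow_natCast]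
  simp only [lin, sqr, ← Finset.Ico_add_one_right_eq_Icc]
  push_cast
  rfl

theorem pathWeight_B1_eq {q a : K} (hq0 : q ≠ 0) (ha : a ≠ 0) (j : ℕ → ℕ) {l : ℕ} (hl : 1 ≤ l)
    (u : ℕ) :
    pathWeight (List.replicate l (kernelB1 q a)) j u =
      (-1) ^ (j u + j (u + l)) * a ^ (-lin j u (u + l - 1)) *
        q ^ (-sqr j u (u + l - 1) + bin j u (u + l - 1)) /
        ∏ m ∈ Ico u (u + l), qPoch q q (j m - j (m + 1)) := by
  have : u + l - 1 + 1 = u + l := by omega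
  rw [pathWeight_replicate_B1 hq0 ha]
  simp only [lin, sqr, bin, ← Finset.Ico_add_one_right_eq_Icc, this]

/-- The weight of the last move (of the first kind) times the weight of the path. -/
theorem coreWeight_eq {q a : K} (hq0 : q ≠ 0) (ha : a ≠ 0) {d i : ℕ} (h : 1 ≤ d ∨ 1 ≤ i)
    (j : ℕ → ℕ) :
    finalBase q a i ^ j 1 * q ^ (j 1 ^ 2) * pathWeight (coreKernels q a d i) j 1 =
      if i ≤ d then a ^ lin j 1 d * q ^ (sqr j 1 d - lin j 1 i) / den q j d
      else (-1) ^ (j i + j (2 * i - d)) *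
        a ^ (lin j 1 (i - 1) - lin j (i + 1) (2 * i - d - 1)) *
        q ^ (sqr j 1 (i - 1) - sqr j (i + 1) (2 * i - d - 1) - lin j 1 i +
          bin j i (2 * i - d - 1)) / den q j (2 * i - d) := by
  have hF : ∀ (A : K) (l : ℕ), A ≠ 0 → A ^ j 1 * q ^ (j 1 ^ 2) *
      pathWeight (List.replicate l (kernelF1 q A)) j 1 =
      A ^ lin j 1 (1 + l) * q ^ sqr j 1 (1 + l) /
        ∏ m ∈ Ico 1 (1 + l), qPoch q q (j m - j (m + 1)) := by
    intro A l hA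
    rw [pathWeight_F1_eq, lin_add j (u := 1) (m := 1) (v := 1 + l) (by omega) (by omega),
      sqr_add j (u := 1) (m := 1) (v := 1 + l) (by omega) (by omega), zpow_add₀ hA, zpow_add₀ hq0, lin_self, sqr_self,
      zpow_natCast, ← Nat.cast_pow, zpow_natCast]
    ring
  have hlin0 : lin j 1 0 = 0 := by simp [lin]
  unfold coreKernels finalBase
  rcases Nat.eq_zero_or_pos i with rfl | hi
  · have hd : 1 + (d - 1) = d := by omega
    rw [if_pos rfl, if_pos rfl, if_pos (Nat.zero_le d), hF a _ ha, hd, hlin0, sub_zero,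
      den_eq q j (by omega)]
  · have hi' : 1 + (i - 1) = i := by omega
    rw [if_neg (by omega), if_neg (by omega), pathWeight_append, ← mul_assoc,
      hF _ _ (div_ne_zero ha hq0), List.length_replicate, hi', shiftKernels, div_zpow]
    split_ifs with h1 h2 h2
    · have hn : ((d : ℤ) - i).natAbs = d - i := by omega
      have hd : i + (d - i) = d := by omega
      rw [hn, pathWeight_F1_eq, hd, den_eq q j (by omega),
        ← prod_Ico_consecutive _ (show 1 ≤ i from hi) h2,
        lin_add j (show 1 ≤ i + 1 by omega) h2, sqr_add j (show 1 ≤ i + 1 by omega) h2,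
        zpow_sub₀ hq0, zpow_add₀ hq0, zpow_add₀ ha, div_mul_div_comm]
      congr 1
      have := zpow_ne_zero (lin j 1 i) hq0
      field_simp
    · omega
    · omega
    · have hn : ((d : ℤ) - i).natAbs = i - d := by omega
      have hd : i + (i - d) = 2 * i - d := by omega
      have hl : lin j 1 i = lin j 1 (i - 1) + j i := by
        rw [lin_add j (show 1 ≤ i - 1 + 1 by omega) (show i - 1 ≤ i by omega),
          Nat.sub_add_cancel hi, lin_self]
      have hs : sqr j 1 i = sqr j 1 (i - 1) + (j i : ℤ) ^ 2 := by
        rw [sqr_add j (show 1 ≤ i - 1 + 1 by omega) (show i - 1 ≤ i by omega),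
          Nat.sub_add_cancel hi, sqr_self]
      have hl' : lin j i (2 * i - d - 1) = j i + lin j (i + 1) (2 * i - d - 1) := by
        rw [lin_add j (show i ≤ i + 1 by omega) (by omega), lin_self]
      have hs' : sqr j i (2 * i - d - 1) = (j i : ℤ) ^ 2 + sqr j (i + 1) (2 * i - d - 1) := by
        rw [sqr_add j (show i ≤ i + 1 by omega) (by omega), sqr_self]
      rw [hn, pathWeight_B1_eq hq0 ha j (by omega), hd, den_eq q j (by omega),
        ← prod_Ico_consecutive _ (show 1 ≤ i from hi) (show i ≤ 2 * i - d by omega),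
        div_mul_div_comm]
      congr 1
      -- The index `j_i` is the inner index of a forward kernel, or of the last move if `i = 1`, and
      -- the outer index of a backward one. Hence `a^{j_i}` and `q^{j_i²}` cancel. The powers of
      -- `a/q` in the forward part leave `q^{-(j_1 + ⋯ + j_i)}`.
      have e1 : a ^ (lin j 1 (i - 1) - lin j (i + 1) (2 * i - d - 1)) =
          a ^ lin j 1 i * a ^ (-lin j i (2 * i - d - 1)) := by
        rw [← zpow_add₀ ha]; congr 1; rw [hl, hl']; ring
      have e2 : q ^ (sqr j 1 (i - 1) - sqr j (i + 1) (2 * i - d - 1) - lin j 1 i +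
          bin j i (2 * i - d - 1)) = q ^ sqr j 1 i * (q ^ lin j 1 i)⁻¹ *
          q ^ (-sqr j i (2 * i - d - 1) + bin j i (2 * i - d - 1)) := by
        rw [← zpow_neg, ← zpow_add₀ hq0, ← zpow_add₀ hq0]; congr 1; rw [hs, hs']; ring
      rw [e1, e2]
      ring

/-- Whether the last move is of the second kind. -/
def MoveSeq.lastF2 (k i : ℕ) : MoveSeq → Bool
  | noF2 => false
  | F2End => true
  | F2Begin => decide (k = 1 ∧ i = 0)

/-- The moves without the last one, which is preceded by the base change if `i = 1`. -/
def MoveSeq.penultimate (q : K) (k i : ℕ) (P : SeqPair K) : MoveSeq → SeqPair K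
  | noF2 => coreMoves q k i P
  | F2End => coreMoves q k i P
  | F2Begin => if k = 1 ∧ i = 0 then P else coreMoves q (k - 1) i (moveF2 q P)

theorem MoveSeq.penultimate_base (q : K) (k i : ℕ) (P : SeqPair K) (μ : MoveSeq) :
    (μ.penultimate q k i P).base = finalBase q P.base i := by
  cases μ
  · exact coreMoves_base _ _ _ _
  · exact coreMoves_base _ _ _ _
  · simp only [penultimate]
    split_ifs with h
    · simp [finalBase, h.2]
    · exact coreMoves_base _ _ _ _

/-- As BC1 is `changeBase` followed by F1, a sequence containing BC1 can be regrouped so that its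
last move is always a plain F1. -/
theorem moveF1_coreMoves {q : K} (hq0 : q ≠ 0) {d i : ℕ} (h : 1 ≤ d ∨ 1 ≤ i) (P : SeqPair K) :
    moveF1 q (coreMoves q d i P) = if i = 0 then (moveF1 q)^[d] P
      else (moveF1 q)^[i - 1] (moveBC1 q (shiftMoves q ((d : ℤ) - i) P)) := by
  unfold coreMoves
  split_ifs
  · rw [← Function.iterate_succ_apply' (moveF1 q), Nat.succ_eq_add_one, Nat.sub_add_cancel (by omega)]
  · rw [moveBC1_eq hq0, ← Function.iterate_succ_apply, Function.iterate_succ_apply']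

/-- This leaves only two kinds of last move for the limit argument. In kind (III) with `k = 1` and
`i = 0` the initial F2 is also the last move. -/
theorem MoveSeq.run_eq {q : K} (hq0 : q ≠ 0) {k : ℕ} (hk : 1 ≤ k) (i : ℕ) (P : SeqPair K)
    (μ : MoveSeq) :
    μ.run q k i P = if μ.lastF2 k i then moveF2 q (μ.penultimate q k i P)
      else moveF1 q (μ.penultimate q k i P) := by
  cases μ
  · simp only [run, lastF2, penultimate, Bool.false_eq_true, if_false]
    rw [moveF1_coreMoves hq0 (Or.inl hk)]
    simp [shiftMoves]
  · simp only [run, lastF2, penultimate, if_true, coreMoves]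
    split_ifs with h0 h1
    · rfl
    · subst h1
      have h2 : ((k : ℤ) - (1 : ℕ)).natAbs = k - 1 := by omega
      have h3 : 0 ≤ (k : ℤ) - (1 : ℕ) := by omega
      rw [moveBC2_eq hq0, shiftMoves, if_pos h3, h2]
      rfl
    · have h2 : i - 1 = (i - 2) + 1 := by omega
      rw [h2, moveBC1_eq hq0, ← Function.iterate_succ_apply]
  · simp only [run, lastF2, penultimate, decide_eq_true_eq]
    by_cases h : k = 1 ∧ i = 0
    · rw [if_pos h, if_pos h, if_pos h.2, h.1]
      simp [shiftMoves]
    · rw [if_neg h, if_neg h, moveF1_coreMoves hq0 (by omega)]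
      have h2 : ((k - 1 : ℕ) : ℤ) = k - 1 := by omega
      have h3 : (k : ℤ) - 1 - i = k - i - 1 := by ring
      rw [h2, h3]
      split_ifs with h1
      · have h4 : ((k : ℤ) - 1).natAbs = k - 1 := by omega
        rw [shiftMoves, if_pos (by omega), h4]
      · rfl

/-- The weight of the last move at the first summation index. -/
def MoveSeq.lastWeight (q a : K) (k i : ℕ) (μ : MoveSeq) (N : ℕ) : K :=
  if μ.lastF2 k i then qPoch (-q) q N * q ^ (N.choose 2) * finalBase q a i ^ N
  else finalBase q a i ^ N * q ^ (N ^ 2)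

/-- The kernels of `penultimate`. -/
def MoveSeq.kernels (q a : K) (k i : ℕ) : MoveSeq → List (ℕ → ℕ → K)
  | noF2 => coreKernels q a k i
  | F2End => coreKernels q a k i
  | F2Begin => if k = 1 ∧ i = 0 then [] else coreKernels q a (k - 1) i ++ [kernelF2 q a]

theorem MoveSeq.penultimate_beta (q : K) (k i : ℕ) (P : SeqPair K) (μ : MoveSeq) :
    (μ.penultimate q k i P).β = pathSum (μ.kernels q P.base k i) P.β := by
  cases μ
  · exact coreMoves_beta _ _ _ _
  · exact coreMoves_beta _ _ _ _
  · simp only [penultimate, kernels]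
    split_ifs with h
    · rfl
    · rw [coreMoves_beta, pathSum_append]; rfl

theorem MoveSeq.length_kernels (q a : K) {k : ℕ} (hk : 1 ≤ k) (i : ℕ) (μ : MoveSeq) :
    (μ.kernels q a k i).length + 1 = μ.len k i := by
  cases μ
  · exact length_coreKernels q a (Or.inl hk)
  · exact length_coreKernels q a (Or.inl hk)
  · simp only [kernels, len]
    split_ifs with h h1 h1
    · simp [h.1]
    · omega
    · rw [List.length_append, List.length_singleton, length_coreKernels q a (by omega), if_pos (by omega)]
      omega
    · rw [List.length_append, List.length_singleton, length_coreKernels q a (by omega)]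
      split_ifs <;> omega

/-- This ties the closed formula to the moves: the last move contributes its weight at `j_1`, the
earlier ones contribute their kernels. The factors depending on the outer index `n` are kept apart.
-/
theorem MoveSeq.summand_eq {q a : K} (hq0 : q ≠ 0) (ha : a ≠ 0) {k : ℕ} (hk : 1 ≤ k) (i : ℕ)
    (μ : MoveSeq) (β : ℕ → K) (j : ℕ → ℕ) :
    μ.summand q a β k i j = μ.lastWeight q a k i (j 1) *
      (pathWeight (μ.kernels q a k i) j 1 * β (j (μ.len k i))) := by
  have hc := coreWeight_eq hq0 ha (d := k) (i := i) (Or.inl hk) j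
  cases μ
  · simp only [summand, lastWeight, lastF2, Bool.false_eq_true, if_false, kernels, len]
    rw [← mul_assoc, hc]
    split_ifs <;> rfl
  · simp only [summand, lastWeight, lastF2, if_true, kernels, len]
    have hq1 : q ^ (j 1 ^ 2) ≠ 0 := pow_ne_zero _ hq0
    have h1 : qPoch (-q) q (j 1) * q ^ (j 1).choose 2 * finalBase q a i ^ j 1 *
        (pathWeight (coreKernels q a k i) j 1 * β (j (if i ≤ k then k else 2 * i - k))) =
        qPoch (-q) q (j 1) * (q ^ (j 1).choose 2 / q ^ (j 1 ^ 2)) *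
        (finalBase q a i ^ j 1 * q ^ (j 1 ^ 2) * pathWeight (coreKernels q a k i) j 1) *
        β (j (if i ≤ k then k else 2 * i - k)) := by
      field_simp
    -- A final F2 differs from a final F1 at `j_1` by this power of `q` and the factor `(-q)_{j_1}`,
    -- so the formula for kind (II) follows from the one for kind (I).
    have h2 : q ^ (j 1).choose 2 / q ^ (j 1 ^ 2) = q ^ (((j 1).choose 2 : ℤ) - (j 1 : ℤ) ^ 2) := by
      rw [zpow_sub₀ hq0, ← Nat.cast_pow, zpow_natCast, zpow_natCast]
    rw [h1, hc, h2]
    split_ifs with h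
    · have h3 : ((j 1).choose 2 : ℤ) + sqr j 2 k - lin j 1 i =
          (((j 1).choose 2 : ℤ) - (j 1 : ℤ) ^ 2) + (sqr j 1 k - lin j 1 i) := by
        rw [sqr_add j (show 1 ≤ 1 + 1 by omega) hk, sqr_self]; ring
      rw [h3, zpow_add₀ hq0]
      ring
    · have h3 : ((j 1).choose 2 : ℤ) + sqr j 2 (i - 1) - sqr j (i + 1) (2 * i - k - 1) -
            lin j 1 i + bin j i (2 * i - k - 1) =
          (((j 1).choose 2 : ℤ) - (j 1 : ℤ) ^ 2) + (sqr j 1 (i - 1) -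
            sqr j (i + 1) (2 * i - k - 1) - lin j 1 i + bin j i (2 * i - k - 1)) := by
        rw [sqr_add j (show 1 ≤ 1 + 1 by omega) (show 1 ≤ i - 1 by omega), sqr_self]; ring
      rw [h3, zpow_add₀ hq0 (((j 1).choose 2 : ℤ) - (j 1 : ℤ) ^ 2)]
      ring
  · simp only [summand, lastWeight, lastF2, decide_eq_true_eq, kernels, len]
    by_cases h : k = 1 ∧ i = 0
    · obtain ⟨rfl, rfl⟩ := h
      simp [pathWeight, finalBase, den, lin, sqr]
      left
      ring
    · rw [if_neg h, if_neg h, pathWeight_append, ← mul_assoc, ← mul_assoc,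
        coreWeight_eq hq0 ha (by omega)]
      have hlen := length_coreKernels q a (d := k - 1) (i := i) (by omega)
      by_cases h1 : i + 1 ≤ k
      · have h2 : i ≤ k - 1 := by omega
        have h3 : ¬ k = 1 := by omega
        rw [if_pos h2] at hlen
        rw [if_pos h1, if_pos h1, if_pos h2, if_neg h3, add_comm 1, hlen, pathWeight, pathWeight,
          kernelF2, den_eq q j hk, den_eq q j (by omega),
          ← prod_Ico_consecutive _ (show 1 ≤ k - 1 by omega) (show k - 1 ≤ k by omega)]
        have h4 : Ico (k - 1) k = {k - 1} := by
          ext m; simp only [mem_Ico, mem_singleton]; omega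
        have h5 : k - 1 + 1 = k := by omega
        have h6 : lin j 1 k = lin j 1 (k - 1) + j k := by
          rw [lin_add j (show 1 ≤ k - 1 + 1 by omega) (show k - 1 ≤ k by omega), h5, lin_self]
        rw [h4, prod_singleton, h5, h6, zpow_add₀ ha, zpow_add₀ hq0, zpow_natCast, zpow_natCast]
        ring
      · have h2 : ¬ i ≤ k - 1 := by omega
        have e1 : 2 * i - (k - 1) = 2 * i - k + 1 := by omega
        have e2 : 2 * i - k + 1 - 1 = 2 * i - k := by omega
        have e3 : 2 * i + 2 - k = 2 * i - k + 2 := by omega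
        rw [if_neg h2, e1] at hlen
        rw [if_neg h1, if_neg h1, if_neg h2, add_comm 1, hlen, pathWeight, pathWeight,
          kernelF2, e1, e2, e3, den_eq q j (by omega), den_eq q j (by omega),
          prod_Ico_succ_top (show 1 ≤ 2 * i - k + 1 by omega), zpow_add₀ ha,
          zpow_add₀ hq0 _ ((j (2 * i - k + 2)).choose 2 : ℤ), zpow_natCast, zpow_natCast]
        ring

theorem MoveSeq.sum_summand {q : K} (hq0 : q ≠ 0) {P : SeqPair K} (ha : P.base ≠ 0) {k : ℕ}
    (hk : 1 ≤ k) (i N : ℕ) (μ : MoveSeq) :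
    ∑ J ∈ chainsFrom (μ.len k i) N, μ.summand q P.base P.β k i (entry J) =
      μ.lastWeight q P.base k i N * (μ.penultimate q k i P).β N := by
  rw [penultimate_beta, ← sum_chainsFrom_pathWeight, mul_sum, length_kernels q P.base hk i μ]
  refine sum_congr rfl fun J hJ => ?_
  have h1 : entry J 1 = N := (mem_filter.1 hJ).2
  rw [summand_eq hq0 ha hk, h1]

theorem MoveSeq.len_pos {k : ℕ} (hk : 1 ≤ k) (i : ℕ) (μ : MoveSeq) : 1 ≤ μ.len k i := by
  cases μ <;> simp only [len] <;> split_ifs <;> omega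

/-- Grouping the chains by `j_1 = N`, the inner sums are values of the penultimate `β` by
`MoveSeq.sum_summand`; the sum over `N` is the last move. -/
theorem MoveSeq.run_beta_eq_multiSum {q : K} (hq0 : q ≠ 0) {k : ℕ} (hk : 1 ≤ k) (i n : ℕ)
    (p : PairNo) (μ : MoveSeq) :
    (μ.run q k i (p.pair q)).β n = multiSum q p μ k i n := by
  have ha : (p.pair q).base ≠ 0 := by
    change p.base q ≠ 0
    rw [p.base_eq]; exact pow_ne_zero _ hq0
  obtain ⟨r, hr⟩ := Nat.exists_eq_add_of_le' (μ.len_pos hk i)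
  rw [multiSum, hr, sum_chains_eq, ← hr, run_eq hq0 hk]
  have h1 : ∀ N ∈ range (n + 1), ∑ J ∈ chainsFrom (μ.len k i) N,
      μ.summand q (p.base q) (p.beta q) k i (entry J) /
        (qPoch q q (n - entry J 1) * μ.outer (fun x => qPoch x q n) q (p.base q) k i) =
      μ.lastWeight q (p.base q) k i N * (μ.penultimate q k i (p.pair q)).β N /
        (qPoch q q (n - N) * μ.outer (fun x => qPoch x q n) q (p.base q) k i) := by
    intro N _
    have h2 : ∑ J ∈ chainsFrom (μ.len k i) N,
        μ.summand q (p.base q) (p.beta q) k i (entry J) =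
        μ.lastWeight q (p.base q) k i N * (μ.penultimate q k i (p.pair q)).β N :=
      μ.sum_summand hq0 ha hk i N
    rw [← h2, sum_div]
    refine sum_congr rfl fun J hJ => ?_
    have h1 : entry J 1 = N := (mem_filter.1 hJ).2
    rw [h1]
  rw [sum_congr rfl h1]
  have hb := μ.penultimate_base q k i (p.pair q)
  have hb' : (p.pair q).base = p.base q := rfl
  rw [hb'] at hb
  split_ifs with h
  · simp only [moveF2, lastWeight, if_pos h, hb]
    have ho : μ.outer (fun x => qPoch x q n) q (p.base q) k i =
        qPoch (-finalBase q (p.base q) i) q n := by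
      cases μ
      · exact absurd h Bool.false_ne_true
      · simp only [outer, finalBase]; split_ifs <;> rfl
      · simp only [outer, finalBase, if_pos (of_decide_eq_true h), if_pos (of_decide_eq_true h).2]
    rw [ho]
    exact sum_congr rfl fun N _ => by ring
  · simp only [moveF1, lastWeight, if_neg h, hb]
    have ho : μ.outer (fun x => qPoch x q n) q (p.base q) k i = 1 := by
      cases μ
      · rfl
      · exact absurd rfl h
      · simp only [outer, if_neg (mt decide_eq_true h)]
    simp only [ho, mul_one]
    exact sum_congr rfl fun N _ => by ring

end Kernels

end A22

namespace A22

section Analysis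

variable {K : Type*} [NormedField K] {q : K}

/-! ### Infinite `q`-products and limits of Bailey pairs -/

theorem pow_ne_one_of_norm_lt_one (hq1 : ‖q‖ < 1) (n : ℕ) (hn : 1 ≤ n) : q ^ n ≠ 1 := fun h => by
  have h1 := congrArg norm h
  rw [norm_pow, norm_one] at h1
  exact (pow_lt_one₀ (norm_nonneg _) hq1 (by omega)).ne h1

theorem summable_norm_neg_mul_pow (hq1 : ‖q‖ < 1) (a : K) :
    Summable fun t : ℕ => ‖-(a * q ^ t)‖ := by
  simp only [norm_neg, norm_mul, norm_pow]
  exact (summable_geometric_of_lt_one (norm_nonneg _) hq1).mul_left _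

theorem exists_norm_le_of_tendsto {f : ℕ → K} {L : K} (h : Tendsto f atTop (𝓝 L)) :
    ∃ C : ℝ, 0 ≤ C ∧ ∀ n, ‖f n‖ ≤ C := by
  obtain ⟨C, hC⟩ := (Metric.isBounded_range_of_tendsto f h).exists_norm_le
  exact ⟨C, (norm_nonneg _).trans (hC (f 0) ⟨0, rfl⟩), fun n => hC _ ⟨n, rfl⟩⟩

theorem mul_pow_ne_one_of_norm (hq1 : ‖q‖ < 1) {a : K} (ha : ‖a‖ < 1) (n : ℕ) : a * q ^ n ≠ 1 :=
  fun h => by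
    have h1 := congrArg norm h
    rw [norm_mul, norm_pow, norm_one] at h1
    have := pow_le_one₀ (n := n) (norm_nonneg q) hq1.le
    nlinarith [norm_nonneg a]

theorem neg_mul_pow_ne_one_of_norm (hq1 : ‖q‖ < 1) {a : K} (ha : ‖a‖ < 1) (n : ℕ) :
    -a * q ^ n ≠ 1 :=
  mul_pow_ne_one_of_norm hq1 (by rwa [norm_neg]) n

variable [CompleteSpace K]

theorem multipliable_qPoch (hq1 : ‖q‖ < 1) (a : K) : Multipliable fun t : ℕ => 1 - a * q ^ t := by
  simpa only [sub_eq_add_neg] using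
    multipliable_one_add_of_summable (summable_norm_neg_mul_pow hq1 a)

theorem tendsto_qPoch (hq1 : ‖q‖ < 1) (a : K) :
    Tendsto (fun n => qPoch a q n) atTop (𝓝 (qPochInf a q)) :=
  (multipliable_qPoch hq1 a).tendsto_prod_tprod_nat

theorem qPochInf_ne_zero (hq1 : ‖q‖ < 1) {a : K} (ha : ∀ n, a * q ^ n ≠ 1) :
    qPochInf a q ≠ 0 := by
  unfold qPochInf
  simp only [sub_eq_add_neg]
  refine tprod_one_add_ne_zero_of_summable (fun t => ?_) (summable_norm_neg_mul_pow hq1 a)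
  rw [← sub_eq_add_neg, sub_ne_zero]
  exact (ha t).symm

theorem qPochInf_eq_mul (hq1 : ‖q‖ < 1) (a : K) :
    qPochInf a q = (1 - a) * qPochInf (a * q) q := by
  refine tendsto_nhds_unique ((tendsto_qPoch hq1 a).comp (tendsto_add_atTop_nat 1)) ?_
  simp only [Function.comp_def, qPoch_succ']
  exact (tendsto_qPoch hq1 _).const_mul _

theorem exists_norm_qPoch_le (hq1 : ‖q‖ < 1) (a : K) : ∃ C : ℝ, 0 ≤ C ∧ ∀ n, ‖qPoch a q n‖ ≤ C :=
  exists_norm_le_of_tendsto (tendsto_qPoch hq1 a)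

theorem exists_norm_inv_qPoch_le (hq1 : ‖q‖ < 1) {a : K} (ha : ∀ n, a * q ^ n ≠ 1) :
    ∃ C : ℝ, 0 ≤ C ∧ ∀ n, ‖(qPoch a q n)⁻¹‖ ≤ C :=
  exists_norm_le_of_tendsto ((tendsto_qPoch hq1 a).inv₀ (qPochInf_ne_zero hq1 ha))

/-- Tannery's theorem for triangular sums. -/
theorem tendsto_triangular_sum {x : ℕ → K} (hx : Summable fun n => ‖x n‖) {c : ℕ → ℕ → K} {C : ℝ}
    (hC : ∀ n t, t ≤ n → ‖c n t‖ ≤ C) {L : K} (hc : ∀ t, Tendsto (fun n => c n t) atTop (𝓝 L)) :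
    Tendsto (fun n => ∑ t ∈ range (n + 1), x t * c n t) atTop (𝓝 ((∑' t, x t) * L)) := by
  rw [← tsum_mul_right]
  have h : ∀ n, ∑ t ∈ range (n + 1), x t * c n t =
      ∑' t, if t ∈ range (n + 1) then x t * c n t else 0 := fun n => by
    rw [tsum_eq_sum (s := range (n + 1)) fun t ht => if_neg ht]
    exact sum_congr rfl fun t ht => (if_pos ht).symm
  simp only [h]
  have hC0 : 0 ≤ C := (norm_nonneg _).trans (hC 0 0 le_rfl)
  refine tendsto_tsum_of_dominated_convergence (bound := fun t => ‖x t‖ * C) (hx.mul_right C)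
    (fun t => ?_) (Eventually.of_forall fun n t => ?_)
  · refine ((hc t).const_mul (x t)).congr' ?_
    filter_upwards [eventually_ge_atTop t] with n hn
    rw [if_pos (mem_range.2 (by omega))]
  · split_ifs with ht
    · rw [norm_mul]
      exact mul_le_mul_of_nonneg_left (hC n t (by have := mem_range.1 ht; omega)) (norm_nonneg _)
    · rw [norm_zero]; positivity

/-- The limit of `(q)_∞ β_n`, where `β` is the result of a forward move, and its expansion. -/
theorem IsBaileyPair.tendsto_and_hasSum (hq1 : ‖q‖ < 1) {P F : SeqPair K}
    (hP : IsBaileyPair q P) (hF : IsBaileyPair q F) (hbase : F.base = P.base)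
    (ha : ∀ n, 1 ≤ n → P.base * q ^ n ≠ 1) {w e : ℕ → K} {eInf : K}
    (he : Tendsto e atTop (𝓝 eInf)) (heInf : eInf ≠ 0) (he0 : ∀ n, e n ≠ 0) (hw : ∀ n, w n ≠ 0)
    (hβ : ∀ n, F.β n = ∑ j ∈ range (n + 1), w j / (qPoch q q (n - j) * e n) * P.β j)
    (hα : ∀ n, F.α n = w n / e n * P.α n) {C : ℝ}
    (hC : ∀ t N, t ≤ N → ‖w N‖ ≤ C * ‖q‖ ^ (N - t) * ‖w t‖)
    {A : K} (hs : Summable fun n => ‖F.α n‖) (hA : HasSum F.α A) :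
    Tendsto (fun n => qPochInf q q * F.β n) atTop (𝓝 (A / qPochInf (P.base * q) q)) ∧
      HasSum (fun N => w N * P.β N / eInf) (A / qPochInf (P.base * q) q) := by
  have hqq : ∀ n, q * q ^ n ≠ 1 := mul_pow_ne_one_of_norm hq1 hq1
  have haq : ∀ n, P.base * q * q ^ n ≠ 1 := fun n => by
    rw [mul_assoc, ← pow_succ']; exact ha _ (by omega)
  have hI := qPochInf_ne_zero hq1 hqq
  have hI' := qPochInf_ne_zero hq1 haq
  obtain ⟨C1, hC10, hC1⟩ := exists_norm_inv_qPoch_le hq1 hqq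
  obtain ⟨C2, hC20, hC2⟩ := exists_norm_inv_qPoch_le hq1 haq
  obtain ⟨C3, hC30, hC3⟩ := exists_norm_le_of_tendsto he
  obtain ⟨C4, hC40, hC4⟩ := exists_norm_le_of_tendsto (he.inv₀ heInf)
  have hshift : ∀ t, Tendsto (fun n : ℕ => n - t) atTop atTop := tendsto_sub_atTop_nat
  have hshift' : ∀ t, Tendsto (fun n : ℕ => n + t) atTop atTop := tendsto_add_atTop_nat
  have h1 : Tendsto (fun n => qPochInf q q * F.β n) atTop
      (𝓝 (A / qPochInf (P.base * q) q)) := by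
    have h := tendsto_triangular_sum hs
      (c := fun n t => qPochInf q q * (qPoch q q (n - t))⁻¹ * (qPoch (P.base * q) q (n + t))⁻¹)
      (C := ‖qPochInf q q‖ * C1 * C2) (fun n t _ => by
        rw [norm_mul, norm_mul]
        exact mul_le_mul (mul_le_mul_of_nonneg_left (hC1 _) (norm_nonneg _)) (hC2 _)
          (norm_nonneg _) (by positivity))
      (fun t => ((((tendsto_qPoch hq1 q).comp (hshift t)).inv₀ hI).const_mul _).mul
        (((tendsto_qPoch hq1 (P.base * q)).comp (hshift' t)).inv₀ hI'))
    rw [hA.tsum_eq, mul_inv_cancel₀ hI, one_mul, ← div_eq_mul_inv] at h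
    refine h.congr fun n => ?_
    rw [hF n, mul_sum, hbase]
    exact sum_congr rfl fun t _ => by rw [div_eq_mul_inv, mul_inv]; ring
  -- No bound on `P.α` is available, so it is expressed as `F.α * e / w`. By `hC` the quotient `w N
  -- / w t` decays geometrically in `N - t`, and the sum is dominated by the Cauchy product of
  -- `‖F.α‖` with a geometric series.
  have h2 : Summable fun N => ‖w N * P.β N‖ := by
    have hsum := summable_norm_sum_mul_range_of_summable_norm (f := fun t => ‖F.α t‖)
      (g := fun n => ‖q‖ ^ n) (by simpa using hs)
      (by simpa using summable_geometric_of_lt_one (norm_nonneg q) hq1)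
    refine Summable.of_nonneg_of_le (fun _ => norm_nonneg _) (fun N => ?_)
      (hsum.mul_left (C * C3 * C1 * C2))
    have h3 : w N * P.β N = ∑ t ∈ range (N + 1), w N * (F.α t * (e t / w t) *
        ((qPoch q q (N - t))⁻¹ * (qPoch (P.base * q) q (N + t))⁻¹)) := by
      rw [hP N, mul_sum]
      refine sum_congr rfl fun t _ => ?_
      rw [hα t]
      have := hw t
      have := he0 t
      rw [div_eq_mul_inv, mul_inv]
      field_simp
    rw [h3, Real.norm_of_nonneg (sum_nonneg fun t _ => by positivity), mul_sum]
    refine (norm_sum_le _ _).trans (sum_le_sum fun t ht => ?_)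
    have ht' : t ≤ N := Nat.lt_succ_iff.1 (mem_range.1 ht)
    have hwt : 0 < ‖w t‖ := norm_pos_iff.2 (hw t)
    rw [norm_mul, norm_mul, norm_mul, norm_mul, norm_div]
    calc ‖w N‖ * (‖F.α t‖ * (‖e t‖ / ‖w t‖) * (‖(qPoch q q (N - t))⁻¹‖ *
          ‖(qPoch (P.base * q) q (N + t))⁻¹‖))
        ≤ (C * ‖q‖ ^ (N - t) * ‖w t‖) * (‖F.α t‖ * (C3 / ‖w t‖) * (C1 * C2)) := by
          have hb := hC t N ht'
          have hb0 := (norm_nonneg _).trans hb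
          gcongr
          · exact hC3 t
          · exact hC1 _
          · exact hC2 _
      _ = C * C3 * C1 * C2 * (‖F.α t‖ * ‖q‖ ^ (N - t)) := by field_simp
  refine ⟨h1, ?_⟩
  -- A second passage to the limit, now in the expression of `F.β` through `P.β`. Uniqueness of
  -- limits identifies the sum of the series with the value found from `α`.
  have h := tendsto_triangular_sum h2 (c := fun n t => qPochInf q q * (qPoch q q (n - t))⁻¹ *
      (e n)⁻¹) (C := ‖qPochInf q q‖ * C1 * C4) (fun n t _ => by
        rw [norm_mul, norm_mul]
        exact mul_le_mul (mul_le_mul_of_nonneg_left (hC1 _) (norm_nonneg _)) (hC4 _)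
          (norm_nonneg _) (by positivity))
    (fun t => ((((tendsto_qPoch hq1 q).comp (hshift t)).inv₀ hI).const_mul _).mul
      (he.inv₀ heInf))
  rw [mul_inv_cancel₀ hI, one_mul, ← div_eq_mul_inv] at h
  have h4 : Tendsto (fun n => qPochInf q q * F.β n) atTop
      (𝓝 ((∑' N, w N * P.β N) / eInf)) := by
    refine h.congr fun n => ?_
    rw [hβ n, mul_sum]
    exact sum_congr rfl fun t _ => by rw [div_eq_mul_inv, mul_inv]; ring
  rw [tendsto_nhds_unique h1 h4]
  exact h2.of_norm.hasSum.div_const _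

/-- The square in the exponent supplies the decay in `N - t`, so a base of norm 1 is allowed; base 1
does occur after a base change from `q`. -/
theorem IsBaileyPair.moveF1_limit (hq0 : q ≠ 0) (hq1 : ‖q‖ < 1) {P : SeqPair K}
    (hP : IsBaileyPair q P) (ha : ∀ n, 1 ≤ n → P.base * q ^ n ≠ 1) (ha0 : P.base ≠ 0)
    (ha1 : ‖P.base‖ ≤ 1) {A : K} (hs : Summable fun n => ‖(A22.moveF1 q P).α n‖)
    (hA : HasSum (A22.moveF1 q P).α A) :
    Tendsto (fun n => qPochInf q q * (A22.moveF1 q P).β n) atTop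
        (𝓝 (A / qPochInf (P.base * q) q)) ∧
      HasSum (fun N => P.base ^ N * q ^ (N ^ 2) * P.β N) (A / qPochInf (P.base * q) q) := by
  have h := hP.tendsto_and_hasSum hq1 (hP.moveF1 (pow_ne_one_of_norm_lt_one hq1) ha) rfl ha
    (w := fun n => P.base ^ n * q ^ (n ^ 2)) (e := fun _ => 1) (eInf := 1) tendsto_const_nhds
    one_ne_zero (fun _ => one_ne_zero) (fun n => mul_ne_zero (pow_ne_zero _ ha0)
      (pow_ne_zero _ hq0)) (fun n => by simp only [A22.moveF1, mul_one])
    (fun n => by simp only [A22.moveF1, div_one]) (C := 1) (fun t N htN => ?_) hs hA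
  · simpa only [div_one] using h
  · rw [norm_mul, norm_mul, norm_pow, norm_pow, norm_pow, norm_pow]
    obtain ⟨d, rfl⟩ := Nat.exists_eq_add_of_le htN
    have h1 : ‖P.base‖ ^ (t + d) ≤ ‖P.base‖ ^ t :=
      pow_le_pow_of_le_one (norm_nonneg _) ha1 (by omega)
    have h2 : ‖q‖ ^ ((t + d) ^ 2) ≤ ‖q‖ ^ (d + t ^ 2) :=
      pow_le_pow_of_le_one (norm_nonneg _) hq1.le
        (by nlinarith [Nat.le_self_pow two_ne_zero d, Nat.zero_le (t * d)])
    rw [add_tsub_cancel_left, one_mul]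
    calc ‖P.base‖ ^ (t + d) * ‖q‖ ^ ((t + d) ^ 2) ≤ ‖P.base‖ ^ t * ‖q‖ ^ (d + t ^ 2) := by gcongr
      _ = _ := by rw [pow_add]; ring

/-- Here the decay in `N - t` is drawn from the powers of the base, hence the stronger bound
`‖P.base‖ ≤ ‖q‖`. It also keeps `(-P.base)_n` away from zero. -/
theorem IsBaileyPair.moveF2_limit (hq0 : q ≠ 0) (hq1 : ‖q‖ < 1) {P : SeqPair K}
    (hP : IsBaileyPair q P) (ha : ∀ n, 1 ≤ n → P.base * q ^ n ≠ 1) (ha0 : P.base ≠ 0)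
    (ha1 : ‖P.base‖ ≤ ‖q‖) {A : K} (hs : Summable fun n => ‖(A22.moveF2 q P).α n‖)
    (hA : HasSum (A22.moveF2 q P).α A) :
    Tendsto (fun n => qPochInf q q * (A22.moveF2 q P).β n) atTop
        (𝓝 (A / qPochInf (P.base * q) q)) ∧
      HasSum (fun N => qPoch (-q) q N * q ^ (N.choose 2) * P.base ^ N * P.β N /
        qPochInf (-P.base) q) (A / qPochInf (P.base * q) q) := by
  have hb := neg_mul_pow_ne_one_of_norm hq1 (ha1.trans_lt hq1)
  have hb' := neg_mul_pow_ne_one_of_norm hq1 hq1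
  obtain ⟨C1, hC10, hC1⟩ := exists_norm_qPoch_le hq1 (-q)
  obtain ⟨C2, hC20, hC2⟩ := exists_norm_inv_qPoch_le hq1 hb'
  have hne : ∀ n, qPoch (-q) q n ≠ 0 := fun n => qPoch_ne_zero fun t _ => hb' t
  refine hP.tendsto_and_hasSum hq1 (hP.moveF2 (pow_ne_one_of_norm_lt_one hq1) ha hb) rfl ha
    (w := fun n => qPoch (-q) q n * q ^ (n.choose 2) * P.base ^ n) (tendsto_qPoch hq1 _)
    (qPochInf_ne_zero hq1 hb) (fun n => qPoch_ne_zero fun t _ => hb t)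
    (fun n => mul_ne_zero (mul_ne_zero (hne n) (pow_ne_zero _ hq0)) (pow_ne_zero _ ha0))
    (fun n => rfl) (fun n => rfl) (C := C1 * C2) (fun t N htN => ?_) hs hA
  simp only [norm_mul, norm_pow]
  obtain ⟨d, rfl⟩ := Nat.exists_eq_add_of_le htN
  have h1 : ‖q‖ ^ ((t + d).choose 2) ≤ ‖q‖ ^ (t.choose 2) :=
    pow_le_pow_of_le_one (norm_nonneg _) hq1.le (Nat.choose_le_choose 2 htN)
  have h2 : ‖P.base‖ ^ (t + d) ≤ ‖P.base‖ ^ t * ‖q‖ ^ d := by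
    rw [pow_add]; gcongr
  -- `‖w t‖` contains the factor `‖(-q)_t‖`, which may be small; boundedness of its inverse allows
  -- it to be inserted on the right.
  have h3 : 1 ≤ C2 * ‖qPoch (-q) q t‖ := by
    have := hC2 t
    rw [norm_inv] at this
    rwa [← inv_le_iff_one_le_mul₀ (norm_pos_iff.2 (hne t))]
  rw [add_tsub_cancel_left]
  calc ‖qPoch (-q) q (t + d)‖ * ‖q‖ ^ ((t + d).choose 2) * ‖P.base‖ ^ (t + d)
      ≤ C1 * ‖q‖ ^ (t.choose 2) * (‖P.base‖ ^ t * ‖q‖ ^ d) := by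
        gcongr
        exact hC1 _
    _ ≤ (C1 * ‖q‖ ^ (t.choose 2) * (‖P.base‖ ^ t * ‖q‖ ^ d)) * (C2 * ‖qPoch (-q) q t‖) :=
        le_mul_of_one_le_right (by positivity) h3
    _ = _ := by ring

end Analysis

end A22

namespace A22

section FiniteQuintuple

variable {K : Type*} [Field K]

/-! ### A finite form of the quintuple product identity -/

theorem invPoch_neg_one (q : K) : invPoch q (-1) = 0 := invPoch_of_neg q (by norm_num)

/-- A terminating very-well-poised sum. -/
theorem finite_quintuple {q z : K} (hq0 : q ≠ 0) (hq : ∀ n, 1 ≤ n → q ^ n ≠ 1)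
    (hz : ∀ n, z ^ 2 * q ^ n ≠ 1) (hz' : ∀ n, z * q ^ n ≠ 1) (n : ℕ) :
    ∑ k ∈ range (n + 1), (1 + z * q ^ k) * z ^ k * q ^ (k ^ 2) * invPoch q k *
      invPoch q ((n : ℤ) - k) / qPoch (z ^ 2 * q ^ k) q (n + 1) =
      1 / (qPoch q q n * qPoch z q (n + 1)) := by
  have hzP : ∀ k m, qPoch (z ^ 2 * q ^ k) q m ≠ 0 := fun k m => qPoch_ne_zero fun t _ => by
    rw [mul_assoc, ← pow_add]; exact hz _
  have hzQ : ∀ m, qPoch z q m ≠ 0 := fun m => qPoch_ne_zero fun t _ => hz' t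
  have hqP := qPoch_self_ne_zero hq
  induction n with
  | zero =>
    have h1 := hz' 0
    have h2 := hz 0
    rw [pow_zero, mul_one] at h1 h2
    have h3 : 1 - z ≠ 0 := sub_ne_zero.2 h1.symm
    have h4 : 1 - z ^ 2 ≠ 0 := sub_ne_zero.2 h2.symm
    have h5 : invPoch q 0 = 1 := by simp [invPoch]
    simp [qPoch_succ, h5]
    field_simp
    ring
  | succ n ih =>
    set F : ℕ → ℕ → K := fun n k => (1 + z * q ^ k) * z ^ k * q ^ (k ^ 2) * invPoch q k *
      invPoch q ((n : ℤ) - k) / qPoch (z ^ 2 * q ^ k) q (n + 1) with hF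
    -- A telescoping companion in `k`. Dividing `hrec` by the common factors leaves a rational
    -- identity in `q`, `z`, `q^n` and `q^k`.
    set G : ℕ → K := fun k => -(q * q ^ n / q ^ k) * z ^ k * q ^ (k ^ 2) * invPoch q ((k : ℤ) - 1) *
      invPoch q ((n : ℤ) + 1 - k) / qPoch (z ^ 2 * q ^ k) q (n + 1) with hG
    have hrec : ∀ k, (1 - q ^ (n + 1)) * (1 - z * q ^ (n + 1)) * F (n + 1) k - F n k =
        G (k + 1) - G k := by
      intro k
      have hy : q ^ k ≠ 0 := pow_ne_zero _ hq0
      have a1 : invPoch q ((n : ℤ) - k) = (1 - q * q ^ n / q ^ k) * invPoch q ((n : ℤ) + 1 - k) := by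
        have := invPoch_sub_one hq ((n : ℤ) + 1 - k)
        rw [zpow_sub₀ hq0, zpow_add_one₀ hq0, zpow_natCast, zpow_natCast, mul_comm (q ^ n) q] at this
        rw [← this]; congr 1; ring
      have a2 : invPoch q ((k : ℤ) - 1) = (1 - q ^ k) * invPoch q k := by
        rw [invPoch_sub_one hq, zpow_natCast]
      have b1 : qPoch (z ^ 2 * q ^ k) q (n + 1 + 1) =
          qPoch (z ^ 2 * q ^ k) q (n + 1) * (1 - z ^ 2 * q * q ^ n * q ^ k) := by
        rw [qPoch_succ]; ring
      have b2 : qPoch (z ^ 2 * q ^ k) q (n + 1 + 1) =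
          (1 - z ^ 2 * q ^ k) * qPoch (z ^ 2 * q ^ (k + 1)) q (n + 1) := by
        rw [qPoch_succ', mul_assoc (z ^ 2), ← pow_succ]
      set U := qPoch (z ^ 2 * q ^ k) q (n + 1 + 1) with hU
      have hU0 : U ≠ 0 := hzP _ _
      have c1 : (qPoch (z ^ 2 * q ^ k) q (n + 1))⁻¹ = (1 - z ^ 2 * q * q ^ n * q ^ k) / U := by
        rw [inv_eq_one_div, div_eq_div_iff (hzP _ _) hU0, b1]; ring
      have c2 : (qPoch (z ^ 2 * q ^ (k + 1)) q (n + 1))⁻¹ = (1 - z ^ 2 * q ^ k) / U := by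
        rw [inv_eq_one_div, div_eq_div_iff (hzP _ _) hU0, b2]; ring
      have d1 : ((k + 1 : ℕ) : ℤ) - 1 = k := by push_cast; ring
      have d2 : (n : ℤ) + 1 - ((k + 1 : ℕ) : ℤ) = n - k := by push_cast; ring
      have d3 : ((n + 1 : ℕ) : ℤ) - k = n + 1 - k := by push_cast; ring
      have d4 : q ^ ((k + 1) ^ 2) = q ^ (k ^ 2) * (q ^ k) ^ 2 * q := by ring
      simp only [hF, hG]
      rw [div_eq_mul_inv _ (qPoch (z ^ 2 * q ^ k) q (n + 1)),
        div_eq_mul_inv _ (qPoch (z ^ 2 * q ^ k) q (n + 1)),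
        div_eq_mul_inv _ (qPoch (z ^ 2 * q ^ (k + 1)) q (n + 1)), ← hU, c1, c2, d1, d2, d3, d4,
        a1, a2, pow_succ q k, pow_succ z k, pow_succ q n]
      generalize invPoch q k = I1
      generalize invPoch q ((n : ℤ) + 1 - k) = I2
      generalize q ^ (k ^ 2) = y2
      generalize z ^ k = zk
      generalize q ^ n = x at *
      generalize q ^ k = y at *
      clear_value U
      field_simp
      ring
    -- At both ends `G` contains `invPoch q (-1) = 0`, so the sum over `k` has a two-term recurrence
    -- in `n`, the same as that of the right-hand side.
    have hG0 : G 0 = 0 := by simp [hG, invPoch_neg_one]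
    have hGn : G (n + 2) = 0 := by
      have : (n : ℤ) + 1 - ((n + 2 : ℕ) : ℤ) = -1 := by push_cast; ring
      simp only [hG]; rw [this, invPoch_neg_one]; ring
    have hFn : F n (n + 1) = 0 := by
      have : (n : ℤ) - ((n + 1 : ℕ) : ℤ) = -1 := by push_cast; ring
      simp only [hF]; rw [this, invPoch_neg_one]; ring
    have hsum : (1 - q ^ (n + 1)) * (1 - z * q ^ (n + 1)) * ∑ k ∈ range (n + 2), F (n + 1) k =
        ∑ k ∈ range (n + 1), F n k := by
      have h1 : ∑ k ∈ range (n + 2), F n k = ∑ k ∈ range (n + 1), F n k := by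
        rw [sum_range_succ, hFn, add_zero]
      rw [← h1, ← sub_eq_zero, mul_sum, ← sum_sub_distrib, sum_congr rfl fun k _ => hrec k,
        sum_range_sub, hG0, hGn, sub_zero]
    rw [ih] at hsum
    have e1 : 1 - q ^ (n + 1) ≠ 0 := sub_ne_zero.2 (hq _ (by omega)).symm
    have e2 : 1 - z * q ^ (n + 1) ≠ 0 := sub_ne_zero.2 (hz' _).symm
    apply mul_left_cancel₀ (mul_ne_zero e1 e2)
    refine hsum.trans ?_
    rw [qPoch_succ q q n, ← pow_succ', qPoch_succ z q (n + 1)]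
    have := hqP n
    have := hzQ (n + 1)
    generalize 1 - q ^ (n + 1) = u at *
    generalize 1 - z * q ^ (n + 1) = v at *
    field_simp

theorem two_mul_triangle (n : ℤ) : 2 * (n * (n + 1) / 2) = n * (n + 1) :=
  Int.mul_ediv_cancel' (Int.even_mul_succ_self n).two_dvd

/-- Each factor is turned over by `1 - z q^{-s} = -z q^{-s} (1 - q^s / z)`. This is used to centre
the terminating sum at 0. -/
theorem qPoch_reflect {q z : K} (hq0 : q ≠ 0) (hz0 : z ≠ 0) (m : ℕ) :
    qPoch (z * q ^ (-(m : ℤ))) q m =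
      (-z) ^ m * q ^ (-((m : ℤ) * (m + 1) / 2)) * qPoch (q / z) q m := by
  induction m with
  | zero => simp
  | succ m ih =>
    have h1 : z * q ^ (-((m + 1 : ℕ) : ℤ)) * q = z * q ^ (-(m : ℤ)) := by
      rw [mul_assoc, ← zpow_add_one₀ hq0]; congr 2; push_cast; ring
    have h2 : q ^ (-(((m + 1 : ℕ) : ℤ) * ((m + 1 : ℕ) + 1) / 2)) =
        q ^ (-((m : ℤ) * (m + 1) / 2)) * q ^ (-((m + 1 : ℕ) : ℤ)) := by
      rw [← zpow_add₀ hq0]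
      congr 1
      have h3 := two_mul_triangle m
      have h4 := two_mul_triangle (m + 1 : ℕ)
      push_cast at h4 ⊢
      nlinarith
    have h3 : q ^ m * q * q ^ (-((m + 1 : ℕ) : ℤ)) = 1 := by
      rw [← pow_succ, zpow_neg, zpow_natCast, mul_inv_cancel₀ (pow_ne_zero _ hq0)]
    rw [qPoch_succ', h1, ih, qPoch_succ, h2]
    generalize q ^ (-((m + 1 : ℕ) : ℤ)) = u at *
    generalize q ^ (-((m : ℤ) * (m + 1) / 2)) = v at *
    have h4 : 1 - z * u = -z * u * (1 - q / z * q ^ m) := by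
      have : z * u * (q / z * q ^ m) = 1 := by
        rw [← h3]; field_simp
      linear_combination (-1 : K) * this
    rw [h4]
    ring

/-- The exponent of the quintuple product series. -/
def quintExp (j : ℤ) : ℤ := (3 * j ^ 2 - j) / 2

theorem two_mul_quintExp (j : ℤ) : 2 * quintExp j = 3 * j ^ 2 - j := by
  refine Int.mul_ediv_cancel' ?_
  obtain ⟨k, rfl | rfl⟩ := j.even_or_odd'
  · exact ⟨6 * k ^ 2 - k, by ring⟩
  · exact ⟨6 * k ^ 2 + 5 * k + 1, by ring⟩

/-- The term of the finite bilateral form of the quintuple product identity. -/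
theorem finite_quintuple_bilateral {q z : K} (hq0 : q ≠ 0) (hq : ∀ n, 1 ≤ n → q ^ n ≠ 1)
    (hz0 : z ≠ 0) (hz : ∀ n : ℤ, z ^ 2 * q ^ n ≠ 1) (m : ℕ) :
    ∑ k ∈ range (2 * m + 1), (-1) ^ ((k : ℤ) - m) * (1 + z * q ^ ((k : ℤ) - m)) *
      z ^ (3 * ((k : ℤ) - m)) * q ^ quintExp (k - m) *
      (qPoch q q (2 * m) * (qPoch q q k)⁻¹ * (qPoch q q (2 * m - k))⁻¹ *
        (qPoch (q / z) q m * qPoch z q (m + 1)) *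
        (qPoch (q / z ^ 2) q (2 * m - k))⁻¹ * (qPoch (z ^ 2) q (k + 1))⁻¹) = 1 := by
  have hzz : ∀ n : ℤ, z * q ^ n ≠ 1 := fun n h => hz (2 * n) (by
    rw [mul_comm 2, zpow_mul]
    norm_cast
    rw [← mul_pow]
    rw [h, one_pow])
  have hqm : q ^ (-(m : ℤ)) ≠ 0 := zpow_ne_zero _ hq0
  -- Replacing `z` by `z q^{-m}` and `n` by `2m` makes the summation index `k - m` run symmetrically
  -- from `-m` to `m`.
  have hf := finite_quintuple (z := z * q ^ (-(m : ℤ))) hq0 hq (fun n => by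
    rw [mul_pow, mul_assoc, ← zpow_natCast, ← zpow_natCast, ← zpow_natCast, ← zpow_mul, ← zpow_add₀ hq0]
    exact_mod_cast hz _) (fun n => by
    rw [mul_assoc, ← zpow_natCast, ← zpow_add₀ hq0]; exact hzz _) (2 * m)
  have hqP := qPoch_self_ne_zero hq
  have hzP : ∀ n, qPoch z q n ≠ 0 := fun n => qPoch_ne_zero fun t _ => by
    exact_mod_cast hzz t
  have hzP2 : ∀ n, qPoch (z ^ 2) q n ≠ 0 := fun n => qPoch_ne_zero fun t _ => by
    exact_mod_cast hz t
  have hzR : ∀ n, qPoch (q / z) q n ≠ 0 := fun n => qPoch_ne_zero fun t _ h =>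
    hzz (-(t + 1)) (by
      rw [zpow_neg, ← div_eq_mul_inv, div_eq_one_iff_eq (zpow_ne_zero _ hq0), zpow_add_one₀ hq0,
        zpow_natCast]
      field_simp at h
      rw [← h]; ring)
  have hzR2 : ∀ n, qPoch (q / z ^ 2) q n ≠ 0 := fun n => qPoch_ne_zero fun t _ h =>
    hz (-(t + 1)) (by
      rw [zpow_neg, ← div_eq_mul_inv, div_eq_one_iff_eq (zpow_ne_zero _ hq0), zpow_add_one₀ hq0,
        zpow_natCast]
      field_simp at h
      rw [← h]; ring)
  have hprod : qPoch (z * q ^ (-(m : ℤ))) q (2 * m + 1) =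
      (-z) ^ m * q ^ (-((m : ℤ) * (m + 1) / 2)) * qPoch (q / z) q m * qPoch z q (m + 1) := by
    rw [show 2 * m + 1 = m + (m + 1) by ring, qPoch_add, qPoch_reflect hq0 hz0, mul_assoc z,
      ← zpow_natCast q m, ← zpow_add₀ hq0, neg_add_cancel, zpow_zero, mul_one]
  have hne : qPoch q q (2 * m) * qPoch (z * q ^ (-(m : ℤ))) q (2 * m + 1) ≠ 0 := by
    rw [hprod]
    exact mul_ne_zero (hqP _) (mul_ne_zero (mul_ne_zero (mul_ne_zero (pow_ne_zero _
      (neg_ne_zero.2 hz0)) (zpow_ne_zero _ hq0)) (hzR _)) (hzP _))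
  have hf' := congrArg (fun x => qPoch q q (2 * m) * qPoch (z * q ^ (-(m : ℤ))) q (2 * m + 1) * x) hf
  simp only [mul_one_div_cancel hne] at hf'
  rw [mul_sum] at hf'
  refine Eq.trans (sum_congr rfl fun k hk => ?_) hf'
  obtain ⟨l, hl⟩ := Nat.exists_eq_add_of_le (Nat.lt_succ_iff.1 (mem_range.1 hk))
  have hl' : 2 * m - k = l := by omega
  have hlz : ((2 * m : ℕ) : ℤ) - k = (l : ℕ) := by omega
  have hden : qPoch ((z * q ^ (-(m : ℤ))) ^ 2 * q ^ k) q (2 * m + 1) =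
      (-z ^ 2) ^ l * q ^ (-((l : ℤ) * (l + 1) / 2)) * qPoch (q / z ^ 2) q l *
        qPoch (z ^ 2) q (k + 1) := by
    have h1 : (z * q ^ (-(m : ℤ))) ^ 2 * q ^ k = z ^ 2 * q ^ (-(l : ℤ)) := by
      rw [mul_pow, mul_assoc, ← zpow_natCast (q ^ _), ← zpow_natCast q k, ← zpow_mul,
        ← zpow_add₀ hq0]
      congr 2; push_cast; omega
    rw [h1, show 2 * m + 1 = l + (k + 1) by omega, qPoch_add,
      qPoch_reflect hq0 (pow_ne_zero 2 hz0), mul_assoc (z ^ 2),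
      ← zpow_natCast q l, ← zpow_add₀ hq0, neg_add_cancel, zpow_zero, mul_one]
  rw [hprod, hden, hlz, invPoch_natCast, invPoch_natCast, hl']
  have e1 : z * q ^ (-(m : ℤ)) * q ^ k = z * q ^ ((k : ℤ) - m) := by
    rw [mul_assoc, ← zpow_natCast q k, ← zpow_add₀ hq0]; congr 2; ring
  have e2 : (-1 : K) ^ ((k : ℤ) - m) * (-1) ^ l = (-1) ^ m := by
    rw [← zpow_natCast, ← zpow_natCast, ← zpow_add₀ (by norm_num)]
    congr 1; omega
  have e3 : z ^ (3 * ((k : ℤ) - m)) * z ^ (2 * l) = z ^ m * z ^ k := by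
    rw [← zpow_natCast, ← zpow_natCast, ← zpow_natCast, ← zpow_add₀ hz0, ← zpow_add₀ hz0]
    congr 1; push_cast; omega
  have e4 : q ^ quintExp (k - m) * q ^ (-((l : ℤ) * (l + 1) / 2)) =
      q ^ (-((m : ℤ) * (m + 1) / 2)) * (q ^ (-(m : ℤ))) ^ k * q ^ (k ^ 2) := by
    rw [← zpow_natCast (q ^ (-(m : ℤ))) k, ← zpow_mul, ← zpow_natCast q (k ^ 2), ← zpow_add₀ hq0,
      ← zpow_add₀ hq0, ← zpow_add₀ hq0]
    congr 1
    have h1 := two_mul_quintExp (k - m)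
    have h2 := two_mul_triangle l
    have h3 := two_mul_triangle m
    have h4 : (l : ℤ) = 2 * m - k := by omega
    have h5 : (l : ℤ) * (l + 1) = (2 * m - k) * (2 * m - k + 1) := by rw [h4]
    have : 2 * (quintExp (k - m) + -((l : ℤ) * (l + 1) / 2)) =
        2 * (-((m : ℤ) * (m + 1) / 2) + -(m : ℤ) * k + ((k ^ 2 : ℕ) : ℤ)) := by
      push_cast
      linear_combination h1 - h2 + h3 - h5
    omega
  rw [e1, mul_pow z]
  have hs : (-1 : K) ^ l ≠ 0 := pow_ne_zero _ (by norm_num)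
  have hq4 : q ^ (-((l : ℤ) * (l + 1) / 2)) ≠ 0 := zpow_ne_zero _ hq0
  have hzl : z ^ (2 * l) ≠ 0 := pow_ne_zero _ hz0
  have h1 : (-z ^ 2) ^ l = (-1) ^ l * z ^ (2 * l) := by rw [neg_pow, ← pow_mul]
  have h2 : (-z) ^ m = (-1) ^ m * z ^ m := neg_pow _ _
  rw [h1, h2]
  -- The powers created by reflecting numerator and denominator combine into the sign, the cube of
  -- `z^{k-m}` and the exponent `quintExp (k - m)`.
  have key : (-1 : K) ^ ((k : ℤ) - m) * z ^ (3 * ((k : ℤ) - m)) * q ^ quintExp (k - m) =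
      (-1) ^ m * (z ^ m * z ^ k) * (q ^ (-((m : ℤ) * (m + 1) / 2)) * (q ^ (-(m : ℤ))) ^ k *
        q ^ (k ^ 2)) * (((-1) ^ l)⁻¹ * (z ^ (2 * l))⁻¹ * (q ^ (-((l : ℤ) * (l + 1) / 2)))⁻¹) := by
    rw [← e2, ← e3, ← e4]
    field_simp
  linear_combination ((1 + z * q ^ ((k : ℤ) - m)) *
      (qPoch q q (2 * m) * (qPoch q q k)⁻¹ * (qPoch q q l)⁻¹ *
        (qPoch (q / z) q m * qPoch z q (m + 1)) *
        (qPoch (q / z ^ 2) q l)⁻¹ * (qPoch (z ^ 2) q (k + 1))⁻¹)) * key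

end FiniteQuintuple

section Quintuple

variable {K : Type*} [NormedField K] [CompleteSpace K] {q z : K}

/-! ### The quintuple product identity -/

/-- The term of the quintuple product series. -/
def quintTerm {K : Type*} [Field K] (q z : K) (j : ℤ) : K :=
  (-1) ^ j * (1 + z * q ^ j) * z ^ (3 * j) * q ^ quintExp j

/-- The limit `m → ∞` of `finite_quintuple_bilateral`: the factor multiplying `quintTerm q z j`
tends to a limit independent of `j`, so dominated convergence determines the full series. The
hypothesis `hz` keeps all products involved away from zero. -/
theorem hasSum_quintTerm (hq0 : q ≠ 0) (hq1 : ‖q‖ < 1) (hz0 : z ≠ 0)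
    (hz : ∀ n : ℤ, z ^ 2 * q ^ n ≠ 1) (hs : Summable fun j => ‖quintTerm q z j‖) :
    HasSum (quintTerm q z) (qPochInf q q * qPochInf (q / z ^ 2) q * qPochInf (z ^ 2) q /
      (qPochInf (q / z) q * qPochInf z q)) := by
  have hq := pow_ne_one_of_norm_lt_one hq1
  have hzz : ∀ n : ℤ, z * q ^ n ≠ 1 := fun n h => hz (2 * n) (by
    rw [mul_comm 2, zpow_mul]
    norm_cast
    rw [← mul_pow]
    rw [h, one_pow])
  have hn1 : ∀ n : ℕ, q * q ^ n ≠ 1 := mul_pow_ne_one_of_norm hq1 hq1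
  have hn2 : ∀ n : ℕ, z * q ^ n ≠ 1 := fun n => by exact_mod_cast hzz n
  have hn3 : ∀ n : ℕ, z ^ 2 * q ^ n ≠ 1 := fun n => by exact_mod_cast hz n
  have hn4 : ∀ n : ℕ, q / z * q ^ n ≠ 1 := fun n h => hzz (-(n + 1)) (by
    rw [zpow_neg, ← div_eq_mul_inv, div_eq_one_iff_eq (zpow_ne_zero _ hq0), zpow_add_one₀ hq0,
      zpow_natCast]
    field_simp at h
    rw [← h]; ring)
  have hn5 : ∀ n : ℕ, q / z ^ 2 * q ^ n ≠ 1 := fun n h => hz (-(n + 1)) (by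
    rw [zpow_neg, ← div_eq_mul_inv, div_eq_one_iff_eq (zpow_ne_zero _ hq0), zpow_add_one₀ hq0,
      zpow_natCast]
    field_simp at h
    rw [← h]; ring)
  have i1 := qPochInf_ne_zero hq1 hn1
  have i2 := qPochInf_ne_zero hq1 hn2
  have i3 := qPochInf_ne_zero hq1 hn3
  have i4 := qPochInf_ne_zero hq1 hn4
  have i5 := qPochInf_ne_zero hq1 hn5
  -- For `|j| > m` the truncation by `toNat` gives meaningless but bounded values; they are excluded
  -- by the indicator in `hsum`.
  set c : ℕ → ℤ → K := fun m j =>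
    qPoch q q (2 * m) * (qPoch q q (j + m).toNat)⁻¹ * (qPoch q q (m - j).toNat)⁻¹ *
      (qPoch (q / z) q m * qPoch z q (m + 1)) * (qPoch (q / z ^ 2) q (m - j).toNat)⁻¹ *
      (qPoch (z ^ 2) q ((j + m).toNat + 1))⁻¹ with hc
  have hsum : ∀ m : ℕ, ∑' j, (if j ∈ Icc (-(m : ℤ)) m then quintTerm q z j * c m j else 0) = 1 := by
    intro m
    rw [tsum_eq_sum (s := Icc (-(m : ℤ)) m) fun j hj => if_neg hj,
      ← finite_quintuple_bilateral hq0 hq hz0 hz m]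
    symm
    refine sum_bij' (fun k _ => (k : ℤ) - m) (fun j _ => (j + m).toNat) ?_ ?_ ?_ ?_ ?_
    · intro k hk
      rw [mem_range] at hk
      rw [mem_Icc]
      omega
    · intro j hj
      rw [mem_Icc] at hj
      rw [mem_range]
      omega
    · intro k _
      omega
    · intro j hj
      rw [mem_Icc] at hj
      omega
    · intro k hk
      rw [mem_range] at hk
      have e1 : ((k : ℤ) - m + m).toNat = k := by omega
      have e2 : ((m : ℤ) - (k - m)).toNat = 2 * m - k := by omega
      rw [if_pos (by rw [mem_Icc]; omega)]
      simp only [hc, quintTerm]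
      rw [e1, e2]
  obtain ⟨C1, hC10, hC1⟩ := exists_norm_qPoch_le hq1 q
  obtain ⟨C2, hC20, hC2⟩ := exists_norm_inv_qPoch_le hq1 hn1
  obtain ⟨C3, hC30, hC3⟩ := exists_norm_qPoch_le hq1 (q / z)
  obtain ⟨C4, hC40, hC4⟩ := exists_norm_qPoch_le hq1 z
  obtain ⟨C5, hC50, hC5⟩ := exists_norm_inv_qPoch_le hq1 hn5
  obtain ⟨C6, hC60, hC6⟩ := exists_norm_inv_qPoch_le hq1 hn3
  have hbound : ∀ m j, ‖c m j‖ ≤ C1 * C2 * C2 * (C3 * C4) * C5 * C6 := fun m j => by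
    simp only [hc, norm_mul]
    gcongr
    · exact hC1 _
    · exact hC2 _
    · exact hC2 _
    · exact hC3 _
    · exact hC4 _
    · exact hC5 _
    · exact hC6 _
  have t1 : ∀ j : ℤ, Tendsto (fun m : ℕ => (j + m).toNat) atTop atTop := fun j =>
    tendsto_atTop_mono (f := fun m : ℕ => m - j.natAbs) (fun m => by omega)
      (tendsto_sub_atTop_nat _)
  have t2 : ∀ j : ℤ, Tendsto (fun m : ℕ => ((m : ℤ) - j).toNat) atTop atTop := fun j =>
    tendsto_atTop_mono (f := fun m : ℕ => m - j.natAbs) (fun m => by omega)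
      (tendsto_sub_atTop_nat _)
  have t3 : Tendsto (fun m : ℕ => 2 * m) atTop atTop :=
    tendsto_atTop_mono (f := fun m : ℕ => m) (fun m => by omega) tendsto_id
  have t4 := tendsto_add_atTop_nat 1
  have hlim : ∀ j, Tendsto (fun m => c m j) atTop (𝓝 (qPochInf q q * (qPochInf q q)⁻¹ *
      (qPochInf q q)⁻¹ * (qPochInf (q / z) q * qPochInf z q) * (qPochInf (q / z ^ 2) q)⁻¹ *
      (qPochInf (z ^ 2) q)⁻¹)) := fun j =>
    ((((((tendsto_qPoch hq1 q).comp t3).mul (((tendsto_qPoch hq1 q).comp (t1 j)).inv₀ i1)).mul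
      (((tendsto_qPoch hq1 q).comp (t2 j)).inv₀ i1)).mul
      ((tendsto_qPoch hq1 (q / z)).mul ((tendsto_qPoch hq1 z).comp t4))).mul
      (((tendsto_qPoch hq1 _).comp (t2 j)).inv₀ i5)).mul
      (((tendsto_qPoch hq1 _).comp (t4.comp (t1 j))).inv₀ i3)
  have hT := tendsto_tsum_of_dominated_convergence
    (bound := fun j => ‖quintTerm q z j‖ * (C1 * C2 * C2 * (C3 * C4) * C5 * C6))
    (f := fun (m : ℕ) j => if j ∈ Icc (-(m : ℤ)) m then quintTerm q z j * c m j else 0)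
    (𝓕 := atTop) (hs.mul_right _) (fun j => ((hlim j).const_mul (quintTerm q z j)).congr' (by
      filter_upwards [eventually_ge_atTop j.natAbs] with m hm
      rw [if_pos (by rw [mem_Icc]; omega)])) (Eventually.of_forall fun m j => by
      split_ifs
      · rw [norm_mul]
        exact mul_le_mul_of_nonneg_left (hbound m j) (norm_nonneg _)
      · rw [norm_zero]; positivity)
  simp only [hsum] at hT
  have h1 := tendsto_nhds_unique hT tendsto_const_nhds
  rw [tsum_mul_right] at h1
  have h2 : qPochInf q q * qPochInf (q / z ^ 2) q * qPochInf (z ^ 2) q /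
      (qPochInf (q / z) q * qPochInf z q) = ∑' j, quintTerm q z j := by
    rw [div_eq_iff (mul_ne_zero i4 i2)]
    field_simp at h1
    linear_combination -h1
  rw [h2]
  exact hs.of_norm.hasSum

theorem qPochInf_sq_step (hq1 : ‖q‖ < 1) (a : K) :
    qPochInf a q = qPochInf a (q ^ 2) * qPochInf (a * q) (q ^ 2) := by
  have hq2 : ‖q ^ 2‖ < 1 := by rw [norm_pow]; exact pow_lt_one₀ (norm_nonneg _) hq1 two_ne_zero
  have t3 : Tendsto (fun m : ℕ => 2 * m) atTop atTop :=
    tendsto_atTop_mono (f := fun m : ℕ => m) (fun m => by omega) tendsto_id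
  refine tendsto_nhds_unique ((tendsto_qPoch hq1 a).comp t3) ?_
  refine ((tendsto_qPoch hq2 a).mul (tendsto_qPoch hq2 (a * q))).congr fun m => ?_
  induction m with
  | zero => simp
  | succ m ih =>
    simp only [Function.comp_apply] at ih ⊢
    rw [mul_add_one, qPoch_succ, qPoch_succ, qPoch_succ, qPoch_succ, ← ih]
    ring

theorem qPochInf_sq_arg (hq1 : ‖q‖ < 1) (a : K) :
    qPochInf (a ^ 2) (q ^ 2) = qPochInf a q * qPochInf (-a) q := by
  have hq2 : ‖q ^ 2‖ < 1 := by rw [norm_pow]; exact pow_lt_one₀ (norm_nonneg _) hq1 two_ne_zero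
  refine tendsto_nhds_unique (tendsto_qPoch hq2 _) ?_
  refine ((tendsto_qPoch hq1 a).mul (tendsto_qPoch hq1 (-a))).congr fun m => ?_
  simp only [qPoch]
  rw [← prod_mul_distrib]
  exact prod_congr rfl fun t _ => by ring

/-- The quintuple product identity, in the form with five products. -/
theorem hasSum_quintTerm' (hq0 : q ≠ 0) (hq1 : ‖q‖ < 1) (hz0 : z ≠ 0)
    (hz : ∀ n : ℤ, z ^ 2 * q ^ n ≠ 1) (hs : Summable fun j => ‖quintTerm q z j‖) :
    HasSum (quintTerm q z) (qPochInf (-z) q * qPochInf (-(q / z)) q * qPochInf q q *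
      qPochInf (q / z ^ 2) (q ^ 2) * qPochInf (q * z ^ 2) (q ^ 2)) := by
  convert hasSum_quintTerm hq0 hq1 hz0 hz hs using 1
  have hzz : ∀ n : ℤ, z * q ^ n ≠ 1 := fun n h => hz (2 * n) (by
    rw [mul_comm 2, zpow_mul]
    norm_cast
    rw [← mul_pow]
    rw [h, one_pow])
  have i2 := qPochInf_ne_zero hq1 (a := z) fun n => by exact_mod_cast hzz n
  have i4 := qPochInf_ne_zero hq1 (a := q / z) fun n h => hzz (-(n + 1)) (by
    rw [zpow_neg, ← div_eq_mul_inv, div_eq_one_iff_eq (zpow_ne_zero _ hq0), zpow_add_one₀ hq0,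
      zpow_natCast]
    field_simp at h
    rw [← h]; ring)
  have h1 : q / z ^ 2 * q = (q / z) ^ 2 := by ring
  -- Splitting into even and odd factors gives `(z²; q)_∞ = (z²; q²)_∞ (q z²; q²)_∞`. Then `(z²;
  -- q²)_∞ = (z; q)_∞ (-z; q)_∞` cancels the denominator `(z; q)_∞`; likewise for `q / z²`.
  rw [qPochInf_sq_step hq1 (z ^ 2), qPochInf_sq_step hq1 (q / z ^ 2), h1, qPochInf_sq_arg hq1,
    qPochInf_sq_arg hq1, mul_comm (z ^ 2) q]
  field_simp

end Quintuple

end A22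

namespace A22

section FinalPair

variable {K : Type*} [Field K] {q : K}

/-! ### The pairs produced by the moves -/

theorem moveF1_iterate_alpha (q : K) (s : ℕ) (P : SeqPair K) (m : ℕ) :
    ((moveF1 q)^[s] P).α m = (P.base ^ m * q ^ (m ^ 2)) ^ s * P.α m := by
  induction s with
  | zero => simp
  | succ s ih =>
    rw [Function.iterate_succ_apply', pow_succ', mul_assoc, ← ih]
    simp only [moveF1, moveF1_iterate_base]

theorem moveB1_iterate_alpha (q : K) (s : ℕ) (P : SeqPair K) (m : ℕ) :
    ((moveB1 q)^[s] P).α m = ((P.base ^ m * q ^ (m ^ 2)) ^ s)⁻¹ * P.α m := by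
  induction s with
  | zero => simp
  | succ s ih =>
    rw [Function.iterate_succ_apply', pow_succ', mul_inv, mul_inv, mul_assoc, ← ih]
    simp only [moveB1, moveB1_iterate_base]

theorem shiftMoves_alpha (q : K) (d : ℤ) (P : SeqPair K) (m : ℕ) :
    (shiftMoves q d P).α m = (P.base ^ m * q ^ (m ^ 2)) ^ d * P.α m := by
  unfold shiftMoves
  split_ifs with h
  · rw [moveF1_iterate_alpha, ← zpow_natCast _ d.natAbs, Int.natAbs_of_nonneg h]
  · rw [moveB1_iterate_alpha, ← zpow_natCast _ d.natAbs, ← zpow_neg]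
    congr 2
    omega

theorem shiftMoves_tilde (q : K) (d : ℤ) (P : SeqPair K) (m : ℕ) :
    (shiftMoves q d P).tilde q m = (P.base ^ m * q ^ (m ^ 2)) ^ d * P.tilde q m := by
  simp only [SeqPair.tilde, shiftMoves_base, shiftMoves_alpha]
  ring

theorem moveF1_coreMoves_alpha_zero {d : ℕ} (hd : 1 ≤ d) {P : SeqPair K} {e : ℕ}
    (hb : P.base = q ^ e) (m : ℕ) :
    (moveF1 q (coreMoves q d 0 P)).α m = q ^ (d * (e * m + m ^ 2)) * P.α m := by
  have h : moveF1 q (coreMoves q d 0 P) = (moveF1 q)^[d] P := by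
    rw [coreMoves, if_pos rfl, ← Function.iterate_succ_apply' (moveF1 q), Nat.succ_eq_add_one,
      Nat.sub_add_cancel hd]
  rw [h, moveF1_iterate_alpha, hb, ← pow_mul, ← pow_add, ← pow_mul, mul_comm d]

theorem moveF1_coreMoves_alpha_head {d i : ℕ} (hi : 1 ≤ i) (P : SeqPair K) :
    (moveF1 q (coreMoves q d i P)).α 0 = P.α 0 := by
  have h : ∀ P : SeqPair K, (moveF1 q P).α 0 = P.α 0 := fun P => by simp [moveF1]
  rw [h, coreMoves, if_neg (by omega), moveF1_iterate_alpha]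
  simp [changeBase, shiftMoves_alpha]

/-- There are `d - i` moves at base `q^e` before the base change and `i` moves at base `q^{e-1}`
after it, which lowers the exponent by `i` times the index. In the second term of the bracket `α̃`
has index `m`, but the later factors have index `m + 1`. -/
theorem moveF1_coreMoves_alpha_succ (hq0 : q ≠ 0) {d i : ℕ} (hi : 1 ≤ i) {P : SeqPair K} {e : ℕ}
    (hb : P.base = q ^ e) (m : ℕ) :
    (moveF1 q (coreMoves q d i P)).α (m + 1) =
      q ^ ((d : ℤ) * (e * (m + 1) + (m + 1) ^ 2) - i * (m + 1)) * P.tilde q (m + 1) -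
      q ^ ((d : ℤ) * (e * m + m ^ 2) - i * m + (i + 1) * (2 * m + e)) * P.tilde q m := by
  have h : moveF1 q (coreMoves q d i P) =
      (moveF1 q)^[i] (changeBase q (shiftMoves q ((d : ℤ) - i) P)) := by
    rw [coreMoves, if_neg (by omega), ← Function.iterate_succ_apply' (moveF1 q),
      Nat.succ_eq_add_one, Nat.sub_add_cancel hi]
  have hb' : P.base = q ^ (e : ℤ) := by rw [hb, zpow_natCast]
  rw [h, moveF1_iterate_alpha]
  simp only [changeBase, if_neg (Nat.succ_ne_zero m), bracket, shiftMoves_base, shiftMoves_tilde,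
    add_tsub_cancel_right]
  have h2 : 2 * (m + 1) - 2 = 2 * m := by omega
  have h3 : q ^ (e : ℤ) / q = q ^ ((e : ℤ) - 1) := by rw [zpow_sub_one₀ hq0, div_eq_mul_inv]
  rw [h2, hb', h3]
  simp only [← zpow_natCast, ← zpow_mul, ← zpow_add₀ hq0]
  rw [mul_sub, ← mul_assoc, ← mul_assoc, ← mul_assoc, ← zpow_add₀ hq0, ← zpow_add₀ hq0,
    ← zpow_add₀ hq0]
  congr 3 <;> push_cast <;> ring

theorem two_mul_choose_succ (m : ℕ) : 2 * ((m + 1).choose 2 : ℤ) = m ^ 2 + m := by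
  have h1 := Finset.sum_range_id_mul_two (m + 1)
  rw [Finset.sum_range_id, ← Nat.choose_two_right] at h1
  zify at h1
  rw [add_tsub_cancel_right] at h1
  linear_combination h1

/-- Comparison with F1 rests on `C(m, 2) = m² - C(m+1, 2)`. The quotient of products is 1 for base
`q`. -/
theorem moveF2_alpha_eq (hq0 : q ≠ 0) (P : SeqPair K) (m : ℕ) :
    (moveF2 q P).α m = qPoch (-q) q m / qPoch (-P.base) q m *
      (q ^ (-((m + 1).choose 2 : ℤ)) * (moveF1 q P).α m) := by
  have h1 : q ^ (m.choose 2) = q ^ (-((m + 1).choose 2 : ℤ)) * q ^ (m ^ 2) := by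
    rw [← zpow_natCast q (m.choose 2), ← zpow_natCast q (m ^ 2), ← zpow_add₀ hq0]
    congr 1
    have h2 := two_mul_choose_succ m
    have h3 : (m + 1).choose 2 = m.choose 2 + m := by simpa using choose_two_add m 1
    rw [h3] at h2 ⊢
    push_cast at h2 ⊢
    linear_combination h2
  simp only [moveF2, moveF1]
  rw [h1]
  ring

/-- Base `q²` at the move F2 occurs only in kind (II) with `i = 0`; this is the resulting quotient.
-/
theorem qPoch_neg_ratio (hq' : ∀ n, 1 ≤ n → -q ^ n ≠ 1) (m : ℕ) :
    qPoch (-q) q m / qPoch (-q ^ 2) q m = (1 + q) / (1 + q ^ (m + 1)) := by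
  have h : ∀ n, 1 ≤ n → 1 + q ^ n ≠ 0 := fun n hn h => hq' n hn (by linear_combination -h)
  have h1 : qPoch (-q ^ 2) q m ≠ 0 := qPoch_ne_zero fun t _ => by
    rw [neg_mul, ← pow_add]; exact hq' _ (by omega)
  have h2 := qPoch_succ (-q) q m
  rw [qPoch_succ'] at h2
  have h3 : -q * q = -q ^ 2 := by ring
  rw [h3] at h2
  rw [div_eq_div_iff h1 (h _ (by omega))]
  linear_combination -h2

/-- The move sequences that occur in the list together with a base `q ^ e`. -/
def MoveSeq.Admissible (e : ℕ) : MoveSeq → Prop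
  | noF2 => e = 1 ∨ e = 2
  | F2End => e = 2
  | F2Begin => e = 1

/-- `1` if the second forward move is used, and `0` otherwise. -/
def MoveSeq.usesF2 : MoveSeq → ℤ
  | noF2 => 0
  | F2End => 1
  | F2Begin => 1

/-- `1` if the second forward move is used at the end, and `0` otherwise. -/
def MoveSeq.endsF2 : MoveSeq → ℤ
  | noF2 => 0
  | F2End => 1
  | F2Begin => 0

/-- The first of the two parts of the sequence `α` of the final pair. -/
def partA (q : K) (p : PairNo) (μ : MoveSeq) (k i m : ℕ) : K :=
  q ^ ((k : ℤ) * (p.exponent * m + m ^ 2) - i * m - μ.usesF2 * ((m + 1).choose 2 : ℤ)) *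
    p.alphaTilde q m

/-- The second of the two parts of the sequence `α` of the final pair. -/
def partB (q : K) (p : PairNo) (μ : MoveSeq) (k i m : ℕ) : K :=
  q ^ (((i : ℤ) + 1) * (2 * m + p.exponent) - μ.endsF2 * (m + 1)) * partA q p μ k i m

/-- The constant in the sequence `α` of the final pair if there is no base change. -/
def alphaConst (q : K) (p : PairNo) : MoveSeq → K
  | .F2End => (1 - q)⁻¹
  | _ => (1 - q ^ p.exponent)⁻¹

theorem PairNo.pair_tilde (hq : ∀ n, 1 ≤ n → q ^ n ≠ 1) (p : PairNo) (m : ℕ) :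
    (p.pair q).tilde q m = p.alphaTilde q m := by
  have he : 1 ≤ p.exponent := by cases p <;> simp [exponent]
  have h : ∀ n, 1 ≤ n → 1 - q ^ n ≠ 0 := fun n hn => sub_ne_zero.2 (hq n hn).symm
  have h1 := h _ he
  have h2 := h (p.exponent + 2 * m) (by omega)
  simp only [SeqPair.tilde, pair, base_eq, ← pow_add]
  field_simp

theorem moveF2_alpha_base (hq0 : q ≠ 0) (hq' : ∀ n, 1 ≤ n → -q ^ n ≠ 1) {P : SeqPair K}
    (hb : P.base = q) (m : ℕ) : (moveF2 q P).α m = q ^ ((m + 1).choose 2 : ℤ) * P.α m := by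
  have h1 : qPoch (-q) q m ≠ 0 := qPoch_ne_zero fun t _ => by
    rw [neg_mul, ← pow_succ']; exact hq' _ (by omega)
  rw [moveF2_alpha_eq hq0, hb, div_self h1, one_mul]
  simp only [moveF1]
  rw [hb, ← pow_add, ← zpow_natCast q (m + m ^ 2), ← mul_assoc, ← zpow_add₀ hq0]
  congr 2
  have := two_mul_choose_succ m
  push_cast
  linear_combination -this

theorem moveF2_tilde_base (hq0 : q ≠ 0) (hq' : ∀ n, 1 ≤ n → -q ^ n ≠ 1) {P : SeqPair K}
    (hb : P.base = q) (m : ℕ) :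
    (moveF2 q P).tilde q m = q ^ ((m + 1).choose 2 : ℤ) * P.tilde q m := by
  have h : (moveF2 q P).base = P.base := rfl
  simp only [SeqPair.tilde, moveF2_alpha_base hq0 hq' hb, h]
  ring

/-- The sequence `α` of the final pair without base change. -/
theorem MoveSeq.run_alpha_of_eq_zero (hq0 : q ≠ 0) (hq : ∀ n, 1 ≤ n → q ^ n ≠ 1)
    (hq' : ∀ n, 1 ≤ n → -q ^ n ≠ 1) {k : ℕ} (hk : 1 ≤ k) {p : PairNo} {μ : MoveSeq}
    (hμ : μ.Admissible p.exponent) (m : ℕ) :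
    (μ.run q k 0 (p.pair q)).α m =
      alphaConst q p μ * (partA q p μ k 0 m - partB q p μ k 0 m) := by
  have h1q : 1 - q ≠ 0 := by
    have := hq 1 le_rfl
    rw [pow_one] at this
    exact sub_ne_zero.2 this.symm
  have hb : (p.pair q).base = q ^ p.exponent := p.base_eq q
  have hα : (p.pair q).α m =
      (1 - q ^ p.exponent * q ^ (2 * m)) / (1 - q ^ p.exponent) * p.alphaTilde q m := by
    simp only [PairNo.pair, PairNo.base_eq]
  have hz : q ^ (p.exponent + 2 * m) = q ^ (2 * m + p.exponent : ℤ) := by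
    rw [← zpow_natCast]; congr 1; push_cast; ring
  rw [run_eq hq0 hk]
  cases μ
  · simp only [lastF2, penultimate, Bool.false_eq_true, if_false]
    rw [moveF1_coreMoves_alpha_zero hk hb, hα, ← pow_add, hz, ← zpow_natCast q (k * _)]
    simp only [alphaConst, partA, partB, usesF2, endsF2]
    push_cast
    simp only [zero_mul, sub_zero, one_mul]
    ring
  · have he : p.exponent = 2 := hμ
    simp only [lastF2, penultimate, if_true]
    rw [moveF2_alpha_eq hq0, coreMoves_base, finalBase, if_pos rfl,
      moveF1_coreMoves_alpha_zero hk hb, hα, hb, he, qPoch_neg_ratio hq',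
      ← zpow_natCast q (k * _), ← mul_assoc (q ^ (_ : ℤ)), ← zpow_add₀ hq0]
    have h2 : 1 + q ^ (m + 1) ≠ 0 := fun h => hq' (m + 1) (by omega) (by linear_combination -h)
    have h3 : 1 - q ^ 2 ≠ 0 := sub_ne_zero.2 (hq 2 (by omega)).symm
    simp only [alphaConst, partA, partB, usesF2, endsF2, he]
    have h4 : ((((0 : ℕ) : ℤ) + 1) * (2 * m + (2 : ℕ)) - 1 * (m + 1)) = ((m + 1 : ℕ) : ℤ) := by
      push_cast; ring
    have h5 : -((m + 1).choose 2 : ℤ) + ((k * (2 * m + m ^ 2) : ℕ) : ℤ) =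
        (k : ℤ) * ((2 : ℕ) * m + m ^ 2) - (0 : ℕ) * m - 1 * ((m + 1).choose 2 : ℤ) := by
      push_cast; ring
    rw [h4, h5, zpow_natCast q (m + 1)]
    -- The factor `1 - q^{2m+2}` of `α_m` loses `1 + q^{m+1}`, and `(1 + q) / (1 - q²) = 1 / (1 -
    -- q)`. This explains the term with `endsF2` in `partB` and the special value of `alphaConst`.
    have h6 : q ^ 2 * q ^ (2 * m) = (q ^ (m + 1)) ^ 2 := by ring
    rw [h6]
    field_simp
    ring
  · have he : p.exponent = 1 := hμ
    have hbq : (p.pair q).base = q := by rw [hb, he, pow_one]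
    simp only [lastF2, penultimate, decide_eq_true_eq, and_true]
    have h7 : ((((0 : ℕ) : ℤ) + 1) * (2 * m + (1 : ℕ)) - 0 * (m + 1)) = ((2 * m + 1 : ℕ) : ℤ) := by
      push_cast; ring
    have h6 : q * q ^ (2 * m) = q ^ (2 * m + 1) := by ring
    simp only [alphaConst, partA, partB, usesF2, endsF2, he, pow_one]
    rw [h7, zpow_natCast q (2 * m + 1)]
    have h8 := two_mul_choose_succ m
    split_ifs with h
    · subst h
      have h5 : (((1 : ℕ) : ℤ) * ((1 : ℕ) * m + m ^ 2) - (0 : ℕ) * m - 1 * ((m + 1).choose 2 : ℤ)) =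
          ((m + 1).choose 2 : ℤ) := by
        push_cast; linear_combination -h8
      rw [moveF2_alpha_base hq0 hq' hbq, hα, he, pow_one, h6, h5]
      ring
    · have hb2 : (moveF2 q (p.pair q)).base = q ^ 1 := by rw [pow_one]; exact hbq
      have h5 : (((k - 1) * (1 * m + m ^ 2) : ℕ) : ℤ) + ((m + 1).choose 2 : ℤ) =
          ((k : ℤ) * ((1 : ℕ) * m + m ^ 2) - (0 : ℕ) * m - 1 * ((m + 1).choose 2 : ℤ)) := by
        push_cast [Nat.cast_sub hk]; linear_combination h8
      rw [moveF1_coreMoves_alpha_zero (by omega) hb2, moveF2_alpha_base hq0 hq' hbq, hα, he,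
        pow_one, h6, ← zpow_natCast q (_ * _), ← mul_assoc, ← zpow_add₀ hq0, h5]
      ring

theorem MoveSeq.run_alpha_head (hq0 : q ≠ 0) (hq : ∀ n, 1 ≤ n → q ^ n ≠ 1) {k i : ℕ} (hk : 1 ≤ k)
    (hi : 1 ≤ i) (p : PairNo) (μ : MoveSeq) :
    (μ.run q k i (p.pair q)).α 0 = partA q p μ k i 0 := by
  have hA : partA q p μ k i 0 = 1 := by simp [partA, p.alphaTilde_zero]
  have he : 1 ≤ p.exponent := by cases p <;> simp [PairNo.exponent]
  have h1 : 1 - q ^ p.exponent ≠ 0 := sub_ne_zero.2 (hq _ he).symm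
  have hα : (p.pair q).α 0 = 1 := by
    simp only [PairNo.pair, PairNo.base_eq, p.alphaTilde_zero]
    simp [h1]
  have h2 : ∀ P : SeqPair K, (moveF2 q P).α 0 = P.α 0 := fun P => by simp [moveF2, qPoch_zero]
  have h1 : ∀ P : SeqPair K, (moveF1 q P).α 0 = P.α 0 := fun P => by simp [moveF1]
  have hc : ∀ (d : ℕ) (P : SeqPair K), (coreMoves q d i P).α 0 = P.α 0 := fun d P => by
    rw [← h1, moveF1_coreMoves_alpha_head hi]
  rw [run_eq hq0 hk, hA, ← hα]
  have hp : (μ.penultimate q k i (p.pair q)).α 0 = (p.pair q).α 0 := by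
    cases μ
    · exact hc _ _
    · exact hc _ _
    · simp only [penultimate]
      rw [if_neg (by omega), hc, h2]
  split_ifs
  · rw [h2, hp]
  · rw [h1, hp]

/-- Compared with the case `i = 0`, the base change shifts the second part by one index and removes
the constant, so the total sum is again that of `partA - partB`. -/
theorem MoveSeq.run_alpha_succ (hq0 : q ≠ 0) (hq : ∀ n, 1 ≤ n → q ^ n ≠ 1)
    (hq' : ∀ n, 1 ≤ n → -q ^ n ≠ 1) {k i : ℕ} (hk : 1 ≤ k) (hi : 1 ≤ i) {p : PairNo} {μ : MoveSeq}
    (hμ : μ.Admissible p.exponent) (m : ℕ) :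
    (μ.run q k i (p.pair q)).α (m + 1) = partA q p μ k i (m + 1) - partB q p μ k i m := by
  have hb : (p.pair q).base = q ^ p.exponent := p.base_eq q
  rw [run_eq hq0 hk]
  cases μ
  · simp only [lastF2, penultimate, Bool.false_eq_true, if_false]
    rw [moveF1_coreMoves_alpha_succ hq0 hi hb, p.pair_tilde hq, p.pair_tilde hq]
    simp only [partA, partB, usesF2, endsF2]
    rw [← mul_assoc, ← zpow_add₀ hq0]
    push_cast
    congr 3 <;> ring
  · have he : p.exponent = 2 := hμ
    have h1 : qPoch (-q) q (m + 1) ≠ 0 := qPoch_ne_zero fun t _ => by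
      rw [neg_mul, ← pow_succ']; exact hq' _ (by omega)
    have h2 : finalBase q (p.pair q).base i = q := by
      rw [finalBase, if_neg (by omega), hb, he]; field_simp
    simp only [lastF2, penultimate, if_true]
    rw [moveF2_alpha_eq hq0, coreMoves_base, h2, div_self h1, one_mul,
      moveF1_coreMoves_alpha_succ hq0 hi hb, p.pair_tilde hq, p.pair_tilde hq, mul_sub]
    simp only [partA, partB, usesF2, endsF2]
    simp only [← mul_assoc, ← zpow_add₀ hq0]
    have h3 : (m + 1 + 1).choose 2 = (m + 1).choose 2 + (m + 1) := by
      simpa using choose_two_add (m + 1) 1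
    rw [h3]
    push_cast
    congr 3 <;> ring
  · have he : p.exponent = 1 := hμ
    have hbq : (p.pair q).base = q := by rw [hb, he, pow_one]
    have hb2 : (moveF2 q (p.pair q)).base = q ^ 1 := by rw [pow_one]; exact hbq
    simp only [lastF2, penultimate, decide_eq_true_eq]
    rw [if_neg (by omega), if_neg (by omega), moveF1_coreMoves_alpha_succ hq0 hi hb2,
      moveF2_tilde_base hq0 hq' hbq, moveF2_tilde_base hq0 hq' hbq, p.pair_tilde hq,
      p.pair_tilde hq]
    simp only [partA, partB, usesF2, endsF2, he]
    simp only [← mul_assoc, ← zpow_add₀ hq0]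
    have h3 := two_mul_choose_succ m
    have h4 := two_mul_choose_succ (m + 1)
    push_cast [Nat.cast_sub hk] at h3 h4 ⊢
    congr 3
    · linear_combination h4
    · linear_combination h3

/-! ### The moves produce Bailey pairs -/

theorem IsBaileyPair.moveF1_iterate (hq : ∀ n, 1 ≤ n → q ^ n ≠ 1) {P : SeqPair K}
    (ha : ∀ n, 1 ≤ n → P.base * q ^ n ≠ 1) (hP : IsBaileyPair q P) (s : ℕ) :
    IsBaileyPair q ((A22.moveF1 q)^[s] P) := by
  induction s with
  | zero => exact hP
  | succ s ih =>
    rw [Function.iterate_succ_apply']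
    exact ih.moveF1 hq (by rwa [moveF1_iterate_base])

theorem IsBaileyPair.shiftMoves (hq0 : q ≠ 0) (hq : ∀ n, 1 ≤ n → q ^ n ≠ 1) {P : SeqPair K}
    (ha0 : P.base ≠ 0) (ha : ∀ n, 1 ≤ n → P.base * q ^ n ≠ 1) (hP : IsBaileyPair q P) (d : ℤ) :
    IsBaileyPair q (A22.shiftMoves q d P) := by
  unfold A22.shiftMoves
  split_ifs
  · exact hP.moveF1_iterate hq ha _
  · generalize d.natAbs = s
    induction s with
    | zero => exact hP
    | succ s ih =>
      rw [Function.iterate_succ_apply']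
      exact ih.moveB1 hq0 hq (by rwa [moveB1_iterate_base]) (by rwa [moveB1_iterate_base])

theorem IsBaileyPair.coreMoves (hq0 : q ≠ 0) (hq : ∀ n, 1 ≤ n → q ^ n ≠ 1) {P : SeqPair K}
    (ha0 : P.base ≠ 0) (ha : ∀ n, P.base * q ^ n ≠ 1) (hP : IsBaileyPair q P) (d i : ℕ) :
    IsBaileyPair q (A22.coreMoves q d i P) := by
  unfold A22.coreMoves
  split_ifs
  · exact hP.moveF1_iterate hq (fun n _ => ha n) _
  · refine ((hP.shiftMoves hq0 hq ha0 (fun n _ => ha n) _).changeBase hq0 hq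
      (by rwa [shiftMoves_base])).moveF1_iterate hq (fun n hn => ?_) _
    simp only [A22.changeBase, shiftMoves_base]
    -- The new base `a / q` may be 1, so only exponents `n ≥ 1` are available, and `(a/q) q^{n+1} =
    -- a q^n`.
    obtain ⟨n, rfl⟩ := Nat.exists_eq_add_of_le hn
    rw [add_comm, pow_succ', ← mul_assoc, div_mul_cancel₀ _ hq0]
    exact ha n

theorem MoveSeq.isBaileyPair_penultimate (hq0 : q ≠ 0) (hq : ∀ n, 1 ≤ n → q ^ n ≠ 1)
    (hq' : ∀ n, 1 ≤ n → -q ^ n ≠ 1) (h2 : (2 : K) ≠ 0) (k i : ℕ) (p : PairNo) (μ : MoveSeq) :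
    IsBaileyPair q (μ.penultimate q k i (p.pair q)) := by
  have he : 1 ≤ p.exponent := by cases p <;> simp [PairNo.exponent]
  have hb : (p.pair q).base = q ^ p.exponent := p.base_eq q
  have ha : ∀ n, (p.pair q).base * q ^ n ≠ 1 := fun n => by
    rw [hb, ← pow_add]; exact hq _ (by omega)
  have ha' : ∀ n, -(p.pair q).base * q ^ n ≠ 1 := fun n => by
    rw [hb, neg_mul, ← pow_add]; exact hq' _ (by omega)
  have ha0 : (p.pair q).base ≠ 0 := by rw [hb]; exact pow_ne_zero _ hq0
  have hP := p.isBaileyPair hq0 hq h2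
  cases μ
  · exact hP.coreMoves hq0 hq ha0 ha _ _
  · exact hP.coreMoves hq0 hq ha0 ha _ _
  · simp only [penultimate]
    split_ifs
    · exact hP
    · exact (hP.moveF2 hq (fun n _ => ha n) ha').coreMoves (P := A22.moveF2 q (p.pair q)) hq0 hq
        ha0 ha _ _

end FinalPair

end A22

namespace A22

section Theta

variable {K : Type*} [NormedField K] {q : K}

/-! ### The sum of the sequence `α` of the final pair -/

theorem hasSum_of_residues {E : Type*} [AddCommMonoid E] [TopologicalSpace E] [ContinuousAdd E]
    {f : ℕ → E} {a b c : E} (h0 : HasSum (fun r => f (3 * r)) a)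
    (h1 : HasSum (fun r => f (3 * r + 1)) b) (h2 : HasSum (fun r => f (3 * r + 2)) c) :
    HasSum f (a + b + c) := by
  have key : ∀ (d : ℕ), d < 3 → ∀ x : E, HasSum (fun r => f (3 * r + d)) x →
      HasSum (fun m => if m % 3 = d then f m else 0) x := by
    intro d hd x hx
    have hinj : Function.Injective fun r : ℕ => 3 * r + d := fun r s h => by
      simp only at h; omega
    rw [← hinj.hasSum_iff]
    · convert hx using 2 with r
      simp only [Function.comp_apply]
      rw [if_pos (by omega)]
    · intro m hm
      refine if_neg fun h => hm ⟨m / 3, ?_⟩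
      simp only
      omega
  convert ((key 0 (by omega) a h0).add (key 1 (by omega) b h1)).add (key 2 (by omega) c h2) using 2
    with m
  have : m % 3 = 0 ∨ m % 3 = 1 ∨ m % 3 = 2 := by omega
  rcases this with h | h | h <;> simp [h]

/-- A series over `ℤ` of differences, rearranged in blocks of three as a series over `ℕ`. -/
theorem hasSum_sub_of_blocks [CompleteSpace K] {X Y : ℤ → K} {A B : ℕ → K} {x y : K}
    (hX : Summable fun n => ‖X n‖) (hY : Summable fun n => ‖Y n‖) (hx : HasSum X x)
    (hy : HasSum Y y) (hA0 : ∀ r : ℕ, A (3 * r) = X r) (hB0 : ∀ r : ℕ, B (3 * r) = Y r)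
    (h12 : (∀ r : ℕ, A (3 * r + 1) = 0 ∧ B (3 * r + 1) = 0 ∧ A (3 * r + 2) = -Y (-(r + 1)) ∧
        B (3 * r + 2) = -X (-(r + 1))) ∨
      ∀ r : ℕ, A (3 * r + 2) = 0 ∧ B (3 * r + 2) = 0 ∧ A (3 * r + 1) = -Y (-(r + 1)) ∧
        B (3 * r + 1) = -X (-(r + 1))) :
    (Summable fun m => ‖A m‖) ∧ (Summable fun m => ‖B m‖) ∧ HasSum (fun m => A m - B m) (x - y) := by
  have i1 : Function.Injective fun r : ℕ => (r : ℤ) := Nat.cast_injective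
  have i2 : Function.Injective fun r : ℕ => -((r : ℤ) + 1) := fun r s h => by
    simp only at h; omega
  have hz : Summable (fun _ : ℕ => (0 : ℝ)) := summable_zero
  have hz' : HasSum (fun _ : ℕ => (0 : K)) 0 := hasSum_zero
  have x1 : Summable fun r : ℕ => ‖X r‖ := hX.comp_injective i1
  have x2 : Summable fun r : ℕ => ‖X (-(r + 1))‖ := hX.comp_injective i2
  have y1 : Summable fun r : ℕ => ‖Y r‖ := hY.comp_injective i1
  have y2 : Summable fun r : ℕ => ‖Y (-(r + 1))‖ := hY.comp_injective i2
  have x1' := x1.of_norm.hasSum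
  have x2' := x2.of_norm.hasSum
  have y1' := y1.of_norm.hasSum
  have y2' := y2.of_norm.hasSum
  have ex := hx.unique (x1'.of_nat_of_neg_add_one x2')
  have ey := hy.unique (y1'.of_nat_of_neg_add_one y2')
  have hNA0 : Summable (fun r => ‖A (3 * r)‖) := by simpa only [hA0] using x1
  have hNB0 : Summable (fun r => ‖B (3 * r)‖) := by simpa only [hB0] using y1
  have hA0' : HasSum (fun r => A (3 * r)) (∑' r : ℕ, X r) := by
    rw [funext hA0]; exact x1'
  have hB0' : HasSum (fun r => B (3 * r)) (∑' r : ℕ, Y r) := by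
    rw [funext hB0]; exact y1'
  have hsum : ∀ f : ℕ → ℝ, Summable (fun r => f (3 * r)) → Summable (fun r => f (3 * r + 1)) →
      Summable (fun r => f (3 * r + 2)) → Summable f := fun f h0 h1 h2 =>
    (hasSum_of_residues h0.hasSum h1.hasSum h2.hasSum).summable
  rcases h12 with h | h
  · have a1 := funext fun r => (h r).1
    have b1 := funext fun r => (h r).2.1
    have a2 := funext fun r => (h r).2.2.1
    have b2 := funext fun r => (h r).2.2.2
    refine ⟨hsum _ hNA0 ?_ ?_, hsum _ hNB0 ?_ ?_, ?_⟩
    · simpa only [(h _).1, norm_zero] using hz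
    · simpa only [(h _).2.2.1, norm_neg] using y2
    · simpa only [(h _).2.1, norm_zero] using hz
    · simpa only [(h _).2.2.2, norm_neg] using x2
    · have e := (hasSum_of_residues hA0' (a1 ▸ hz') (a2 ▸ y2'.neg)).sub
        (hasSum_of_residues hB0' (b1 ▸ hz') (b2 ▸ x2'.neg))
      -- The negative halves of the series are attached crosswise and with opposite sign, so that in
      -- `A - B` they recombine to `∑ X - ∑ Y`.
      have e' : ∀ a b c d : K, a + 0 + -d - (c + 0 + -b) = a + b - (c + d) := fun a b c d => by ring
      rwa [e', ← ex, ← ey] at e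
  · have a1 := funext fun r => (h r).1
    have b1 := funext fun r => (h r).2.1
    have a2 := funext fun r => (h r).2.2.1
    have b2 := funext fun r => (h r).2.2.2
    refine ⟨hsum _ hNA0 ?_ ?_, hsum _ hNB0 ?_ ?_, ?_⟩
    · simpa only [(h _).2.2.1, norm_neg] using y2
    · simpa only [(h _).1, norm_zero] using hz
    · simpa only [(h _).2.2.2, norm_neg] using x2
    · simpa only [(h _).2.1, norm_zero] using hz
    · have e := (hasSum_of_residues hA0' (a2 ▸ y2'.neg) (a1 ▸ hz')).sub
        (hasSum_of_residues hB0' (b2 ▸ x2'.neg) (b1 ▸ hz'))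
      have e' : ∀ a b c d : K, a + -d + 0 - (c + -b + 0) = a + b - (c + d) := fun a b c d => by ring
      rwa [e', ← ex, ← ey] at e

/-- The exponents of the positive terms of the quintuple product series. -/
def expX (M σ j : ℤ) : ℤ := M * quintExp j + 3 * j * σ

/-- The exponents of the negative terms of the quintuple product series. -/
def expY (M σ j : ℤ) : ℤ := M * (quintExp j + j) + (3 * j + 1) * σ

/-- Linear growth of the exponents gives absolute convergence. For `σ = s₁ + 1` and `M = s₀ + 2 s₁ +
3` the condition `2σ + 1 ≤ M` is `0 ≤ s₀`. -/
theorem natAbs_le_expX {M σ : ℤ} (hσ : 1 ≤ σ) (hM : 2 * σ + 1 ≤ M) (j : ℤ) :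
    (j.natAbs : ℤ) ≤ expX M σ j := by
  have h := two_mul_quintExp j
  have h2 : 2 * expX M σ j = M * (3 * j ^ 2 - j) + 6 * j * σ := by
    rw [expX, ← h]; ring
  rcases le_total 0 j with hj | hj
  · rw [Int.natAbs_of_nonneg hj]
    have : 0 ≤ j ^ 2 - j := by nlinarith [sq_nonneg j, Int.le_self_sq j]
    nlinarith [mul_nonneg hj (by omega : 0 ≤ σ - 1), mul_nonneg this (by omega : 0 ≤ M), mul_nonneg hj (by omega : 0 ≤ M - 1)]
  · obtain ⟨p, rfl⟩ : ∃ p, j = -p := ⟨-j, by ring⟩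
    have hp : 0 ≤ p := by omega
    rw [Int.natAbs_neg, Int.natAbs_of_nonneg hp]
    have : 0 ≤ p ^ 2 - p := by nlinarith [Int.le_self_sq p]
    nlinarith [mul_nonneg hp (by omega : 0 ≤ M - 1 - 2 * σ), mul_nonneg this (by omega : 0 ≤ M), mul_nonneg hp (by omega : 0 ≤ M)]

theorem natAbs_le_expY {M σ : ℤ} (hσ : 1 ≤ σ) (hM : 2 * σ + 1 ≤ M) (j : ℤ) :
    (j.natAbs : ℤ) ≤ expY M σ j := by
  have h := two_mul_quintExp j
  have h2 : 2 * expY M σ j = M * (3 * j ^ 2 + j) + (6 * j + 2) * σ := by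
    rw [expY]; linear_combination M * h
  rcases le_total 0 j with hj | hj
  · rw [Int.natAbs_of_nonneg hj]
    nlinarith [mul_nonneg hj (by omega : 0 ≤ σ - 1), mul_nonneg (sq_nonneg j) (by omega : 0 ≤ M), mul_nonneg hj (by omega : 0 ≤ M - 1)]
  · rcases hj.eq_or_lt with rfl | hj
    · simp at h2 ⊢; omega
    obtain ⟨p, rfl⟩ : ∃ p, j = -p := ⟨-j, by ring⟩
    have hp : 0 ≤ p - 1 := by omega
    rw [Int.natAbs_neg, Int.natAbs_of_nonneg (by omega)]
    nlinarith [mul_nonneg (by omega : 0 ≤ 3 * p - 1) (by omega : 0 ≤ M - 1 - 2 * σ),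
      mul_nonneg (mul_nonneg hp (by omega : 0 ≤ 3 * p - 1)) (by omega : 0 ≤ M)]

theorem summable_norm_zpow_of_natAbs_le (hq1 : ‖q‖ < 1) {e : ℤ → ℤ}
    (he : ∀ j, (j.natAbs : ℤ) ≤ e j) : Summable fun j => ‖q ^ e j‖ := by
  have hg := summable_geometric_of_lt_one (norm_nonneg q) hq1
  have h : Summable fun j : ℤ => ‖q‖ ^ j.natAbs := by
    refine Summable.of_nat_of_neg ?_ ?_ <;> simpa using hg
  refine h.of_nonneg_of_le (fun _ => norm_nonneg _) fun j => ?_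
  obtain ⟨n, hn⟩ := Int.eq_ofNat_of_zero_le ((Int.natCast_nonneg _).trans (he j))
  have h1 := he j
  rw [hn] at h1 ⊢
  rw [zpow_natCast, norm_pow]
  exact pow_le_pow_of_le_one (norm_nonneg _) hq1.le (by omega)

theorem zpow_ne_one_of_norm_lt_one (hq1 : ‖q‖ < 1) {n : ℤ} (hn : n ≠ 0) : q ^ n ≠ 1 := by
  intro h
  rcases Int.natAbs_eq n with h1 | h1 <;> rw [h1] at h
  · rw [zpow_natCast] at h
    exact pow_ne_one_of_norm_lt_one hq1 _ (by omega) h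
  · rw [zpow_neg, zpow_natCast, inv_eq_one] at h
    exact pow_ne_one_of_norm_lt_one hq1 _ (by omega) h

theorem neg_pow_ne_one_of_norm_lt_one (hq1 : ‖q‖ < 1) (n : ℕ) (hn : 1 ≤ n) : -q ^ n ≠ 1 := fun h => by
  refine pow_ne_one_of_norm_lt_one hq1 (2 * n) (by omega) ?_
  rw [mul_comm, pow_mul]
  linear_combination (1 - q ^ n) * h

/-- The numerator of the principal character as a difference of two theta series. -/
theorem theta_sub_theta [CompleteSpace K] (hq0 : q ≠ 0) (hq1 : ‖q‖ < 1) (s₀ s₁ : ℕ) {x y : K}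
    (hx : HasSum (fun j => q ^ expX (s₀ + 2 * s₁ + 3) (s₁ + 1) j) x)
    (hy : HasSum (fun j => q ^ expY (s₀ + 2 * s₁ + 3) (s₁ + 1) j) y) :
    x - y = principalChar q s₀ s₁ * qPochInf q q := by
  set M := s₀ + 2 * s₁ + 3 with hM
  have hM0 : q ^ M ≠ 0 := pow_ne_zero _ hq0
  have hM1 : ‖q ^ M‖ < 1 := by rw [norm_pow]; exact pow_lt_one₀ (norm_nonneg _) hq1 (by omega)
  have hz0 : -q ^ (s₁ + 1) ≠ 0 := neg_ne_zero.2 (pow_ne_zero _ hq0)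
  have hterm : ∀ j, quintTerm (q ^ M) (-q ^ (s₁ + 1)) j =
      q ^ expX (s₀ + 2 * s₁ + 3) (s₁ + 1) j - q ^ expY (s₀ + 2 * s₁ + 3) (s₁ + 1) j := by
    intro j
    -- With `z = -q^{s₁+1}` the sign of `z^{3j}` cancels `(-1)^j`, and `1 + z q^{Mj}` separates the
    -- two theta series.
    have e1 : (-q ^ (s₁ + 1)) ^ (3 * j) = (-1) ^ j * (q ^ (s₁ + 1)) ^ (3 * j) := by
      rw [neg_eq_neg_one_mul, mul_zpow, zpow_mul]
      norm_num
    have e2 : ((-1 : K) ^ j) * (-1) ^ j = 1 := by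
      rw [← mul_zpow]; norm_num
    have e3 : expX (s₀ + 2 * s₁ + 3) (s₁ + 1) j = (s₁ + 1 : ℕ) * (3 * j) + (M : ℕ) * quintExp j := by
      rw [expX, hM]; push_cast; ring
    have e4 : expY (s₀ + 2 * s₁ + 3) (s₁ + 1) j =
        (s₁ + 1 : ℕ) + (M : ℕ) * j + ((s₁ + 1 : ℕ) * (3 * j) + (M : ℕ) * quintExp j) := by
      rw [expY, hM]; push_cast; ring
    rw [e4, zpow_add₀ hq0 (_ + _), e3, zpow_add₀ hq0, zpow_add₀ hq0, zpow_mul q (M : ℤ) j,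
      zpow_mul q (M : ℤ) (quintExp j), zpow_mul q ((s₁ + 1 : ℕ) : ℤ), zpow_natCast, zpow_natCast, quintTerm, e1]
    linear_combination (1 - q ^ (s₁ + 1) * (q ^ M) ^ j) * (q ^ (s₁ + 1)) ^ (3 * j) *
      (q ^ M) ^ quintExp j * e2
  have hsX : Summable fun j => ‖q ^ expX (s₀ + 2 * s₁ + 3) (s₁ + 1) j‖ :=
    summable_norm_zpow_of_natAbs_le hq1 (natAbs_le_expX (by omega) (by omega))
  have hsY : Summable fun j => ‖q ^ expY (s₀ + 2 * s₁ + 3) (s₁ + 1) j‖ :=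
    summable_norm_zpow_of_natAbs_le hq1 (natAbs_le_expY (by omega) (by omega))
  have hs : Summable fun j => ‖quintTerm (q ^ M) (-q ^ (s₁ + 1)) j‖ :=
    (hsX.add hsY).of_nonneg_of_le (fun _ => norm_nonneg _) fun j => by
      rw [hterm]; exact norm_sub_le _ _
  -- The exponent `2(s₁+1) + M n` is never zero because `0 < 2(s₁+1) < M`.
  have hne : ∀ n : ℤ, (-q ^ (s₁ + 1)) ^ 2 * (q ^ M) ^ n ≠ 1 := fun n => by
    have : (-q ^ (s₁ + 1)) ^ 2 * (q ^ M) ^ n = q ^ (2 * (s₁ + 1) + M * n : ℤ) := by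
      rw [neg_sq, ← pow_mul, ← zpow_natCast q M, ← zpow_mul, ← zpow_natCast, ← zpow_add₀ hq0]
      congr 1
      push_cast; ring
    rw [this]
    refine zpow_ne_one_of_norm_lt_one hq1 fun h => ?_
    rcases le_or_gt 0 n with hn | hn
    · nlinarith [mul_nonneg (Int.natCast_nonneg M) hn]
    · have : (M : ℤ) * n ≤ -M := by nlinarith [Int.natCast_nonneg M]
      omega
  have h := hasSum_quintTerm' hM0 hM1 hz0 hne hs
  have h1 : HasSum (quintTerm (q ^ M) (-q ^ (s₁ + 1))) (x - y) := by
    rw [funext hterm]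
    exact hx.sub hy
  have hqq : qPochInf q q ≠ 0 := qPochInf_ne_zero hq1 (mul_pow_ne_one_of_norm hq1 hq1)
  rw [h1.unique h, principalChar, div_mul_cancel₀ _ hqq, ← hM]
  have c1 : -(q ^ M / -q ^ (s₁ + 1)) = q ^ (s₀ + s₁ + 2) := by
    rw [div_neg, neg_neg, div_eq_iff (pow_ne_zero _ hq0), ← pow_add]
    congr 1; omega
  have c2 : q ^ M / (-q ^ (s₁ + 1)) ^ 2 = q ^ (s₀ + 1) := by
    rw [neg_sq, div_eq_iff (pow_ne_zero _ (pow_ne_zero _ hq0)), ← pow_mul, ← pow_add]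
    congr 1; omega
  have c3 : q ^ M * (-q ^ (s₁ + 1)) ^ 2 = q ^ (s₀ + 4 * s₁ + 5) := by
    rw [neg_sq, ← pow_mul, ← pow_add]
    congr 1; omega
  rw [neg_neg, c1, c2, c3, ← pow_mul, mul_comm M 2]

end Theta

end A22

namespace A22

/-! ### Matching the final exponents with the theta series -/

section Identities

variable {K : Type*} [NormedField K] {q : K}

theorem int_eq_of_two_mul_eq {a b : ℤ} (h : 2 * a = 2 * b) : a = b := by omega

/-- Here `i = s₁`. The class `m = 3r` of `partA` matches the positive series at `-r`, that of
`partB` the negative series at `r`, and residue 2 supplies the other halves. The condition `hexp` is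
the resulting comparison of quadratic polynomials in `r`. -/
theorem hasSum_parts_of_base_one [CompleteSpace K] (hq0 : q ≠ 0) (hq1 : ‖q‖ < 1) {p : PairNo}
    {μ : MoveSeq} {k s₀ s₁ : ℕ} (he : p.exponent = 1) (hμ : μ.endsF2 = 0) {M : ℤ}
    (hM : M = s₀ + 2 * s₁ + 3)
    (hexp : ∀ r, 2 * p.expo r = (3 * M - 18 * k + 9 * μ.usesF2) * r ^ 2 +
      (M - 6 * k - 6 + 3 * μ.usesF2) * r) :
    (Summable fun m => ‖partA q p μ k s₁ m‖) ∧ (Summable fun m => ‖partB q p μ k s₁ m‖) ∧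
      HasSum (fun m => partA q p μ k s₁ m - partB q p μ k s₁ m)
        (principalChar q s₀ s₁ * qPochInf q q) := by
  have hsX : Summable fun j => ‖q ^ expX M (s₁ + 1) j‖ :=
    summable_norm_zpow_of_natAbs_le hq1 (natAbs_le_expX (by omega) (by omega))
  have hsY : Summable fun j => ‖q ^ expY M (s₁ + 1) j‖ :=
    summable_norm_zpow_of_natAbs_le hq1 (natAbs_le_expY (by omega) (by omega))
  have hx := hsX.of_norm.hasSum
  have hy := hsY.of_norm.hasSum
  have hxy := theta_sub_theta hq0 hq1 s₀ s₁ (x := ∑' j, q ^ expX M (s₁ + 1) j)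
    (y := ∑' j, q ^ expY M (s₁ + 1) j) (by rw [← hM]; exact hx) (by rw [← hM]; exact hy)
  rw [← hxy]
  have hsX' : Summable fun j => ‖q ^ expX M (s₁ + 1) (-j)‖ :=
    ((Equiv.neg ℤ).summable_iff (f := fun j => ‖q ^ expX M (s₁ + 1) j‖)).2 hsX
  have hx' : HasSum (fun j => q ^ expX M (s₁ + 1) (-j)) _ :=
    ((Equiv.neg ℤ).hasSum_iff (f := fun j => q ^ expX M (s₁ + 1) j)).2 hx
  refine hasSum_sub_of_blocks hsX' hsY hx' hy (fun r => ?_) (fun r => ?_)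
    (Or.inl fun r => ⟨?_, ?_, ?_, ?_⟩)
  · rw [partA, p.alphaTilde_three_mul, ← zpow_add₀ hq0]
    refine congrArg (fun e : ℤ => q ^ e) (int_eq_of_two_mul_eq ?_)
    have h := two_mul_quintExp (-r)
    have h1 := hexp r
    have h2 := two_mul_choose_succ (3 * r)
    rw [expX, he]
    push_cast at h2 ⊢
    linear_combination h1 - μ.usesF2 * h2 - M * h
  · rw [partB, partA, p.alphaTilde_three_mul, ← zpow_add₀ hq0, ← zpow_add₀ hq0]
    refine congrArg (fun e : ℤ => q ^ e) (int_eq_of_two_mul_eq ?_)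
    have h := two_mul_quintExp r
    have h1 := hexp r
    have h2 := two_mul_choose_succ (3 * r)
    rw [expY, he, hμ]
    push_cast at h2 ⊢
    linear_combination h1 - μ.usesF2 * h2 - M * h
  · rw [partA, p.alphaTilde_one_mod, if_pos he, mul_zero]
  · rw [partB, partA, p.alphaTilde_one_mod, if_pos he, mul_zero, mul_zero]
  · rw [partA, p.alphaTilde_two_mod, if_pos he, mul_neg, ← zpow_add₀ hq0]
    refine congrArg (fun e : ℤ => -q ^ e) (int_eq_of_two_mul_eq ?_)
    have h := two_mul_quintExp (-(r + 1))
    have h1 := hexp (-r - 1)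
    have h2 := two_mul_choose_succ (3 * r + 2)
    rw [expY, he]
    push_cast at h2 ⊢
    linear_combination h1 - μ.usesF2 * h2 - M * h
  · rw [partB, partA, p.alphaTilde_two_mod, if_pos he, mul_neg, mul_neg, ← zpow_add₀ hq0,
      ← zpow_add₀ hq0]
    refine congrArg (fun e : ℤ => -q ^ e) (int_eq_of_two_mul_eq ?_)
    have h := two_mul_quintExp (-(-(r + 1)))
    have h1 := hexp (-r - 1)
    have h2 := two_mul_choose_succ (3 * r + 2)
    rw [expX, he, hμ]
    push_cast at h2 ⊢
    linear_combination h1 - μ.usesF2 * h2 - M * h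

/-- Now the positive series is taken as it stands, the negative one is reflected by `j ↦ -j - 1`,
and residue 1 supplies the other halves. The relation `hi` between `i` and `s₁` is needed to match
the terms of the negative series. -/
theorem hasSum_parts_of_base_two [CompleteSpace K] (hq0 : q ≠ 0) (hq1 : ‖q‖ < 1) {p : PairNo}
    {μ : MoveSeq} {k i s₀ s₁ : ℕ} (he : p.exponent = 2) (hμ : μ.endsF2 = μ.usesF2) {M : ℤ}
    (hM : M = s₀ + 2 * s₁ + 3)
    (hexp : ∀ r, 2 * p.expo r = (3 * M - 18 * k + 9 * μ.usesF2) * r ^ 2 +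
      (6 * (s₁ + 1) - M - 12 * k + 6 * i + 3 * μ.usesF2) * r)
    (hi : M = 2 * (s₁ + 1) + 2 * (i + 1) - μ.usesF2) :
    (Summable fun m => ‖partA q p μ k i m‖) ∧ (Summable fun m => ‖partB q p μ k i m‖) ∧
      HasSum (fun m => partA q p μ k i m - partB q p μ k i m)
        (principalChar q s₀ s₁ * qPochInf q q) := by
  have hsX : Summable fun j => ‖q ^ expX M (s₁ + 1) j‖ :=
    summable_norm_zpow_of_natAbs_le hq1 (natAbs_le_expX (by omega) (by omega))
  have hsY : Summable fun j => ‖q ^ expY M (s₁ + 1) j‖ :=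
    summable_norm_zpow_of_natAbs_le hq1 (natAbs_le_expY (by omega) (by omega))
  have hx := hsX.of_norm.hasSum
  have hy := hsY.of_norm.hasSum
  have hxy := theta_sub_theta hq0 hq1 s₀ s₁ (x := ∑' j, q ^ expX M (s₁ + 1) j)
    (y := ∑' j, q ^ expY M (s₁ + 1) j) (by rw [← hM]; exact hx) (by rw [← hM]; exact hy)
  rw [← hxy]
  set τ : ℤ ≃ ℤ := (Equiv.neg ℤ).trans (Equiv.subRight 1)
  have hsY' : Summable fun j => ‖q ^ expY M (s₁ + 1) (-j - 1)‖ :=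
    (τ.summable_iff (f := fun j => ‖q ^ expY M (s₁ + 1) j‖)).2 hsY
  have hy' : HasSum (fun j => q ^ expY M (s₁ + 1) (-j - 1)) _ :=
    (τ.hasSum_iff (f := fun j => q ^ expY M (s₁ + 1) j)).2 hy
  refine hasSum_sub_of_blocks hsX hsY' hx hy' (fun r => ?_) (fun r => ?_)
    (Or.inr fun r => ⟨?_, ?_, ?_, ?_⟩)
  · rw [partA, p.alphaTilde_three_mul, ← zpow_add₀ hq0]
    refine congrArg (fun e : ℤ => q ^ e) (int_eq_of_two_mul_eq ?_)
    have h := two_mul_quintExp r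
    have h1 := hexp r
    have h2 := two_mul_choose_succ (3 * r)
    rw [expX, he]
    push_cast at h2 ⊢
    linear_combination h1 - μ.usesF2 * h2 - M * h
  · rw [partB, partA, p.alphaTilde_three_mul, ← zpow_add₀ hq0, ← zpow_add₀ hq0]
    refine congrArg (fun e : ℤ => q ^ e) (int_eq_of_two_mul_eq ?_)
    have h := two_mul_quintExp (-r - 1)
    have h1 := hexp r
    have h2 := two_mul_choose_succ (3 * r)
    rw [expY, he, hμ]
    push_cast at h2 ⊢
    linear_combination h1 - μ.usesF2 * h2 - M * h - (6 * r + 2) * hi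
  · rw [partA, p.alphaTilde_two_mod, if_neg (by omega), mul_zero]
  · rw [partB, partA, p.alphaTilde_two_mod, if_neg (by omega), mul_zero, mul_zero]
  · rw [partA, p.alphaTilde_one_mod, if_neg (by omega), mul_neg, ← zpow_add₀ hq0]
    refine congrArg (fun e : ℤ => -q ^ e) (int_eq_of_two_mul_eq ?_)
    have h := two_mul_quintExp (-(-(r + 1)) - 1)
    have h1 := hexp (-r - 1)
    have h2 := two_mul_choose_succ (3 * r + 1)
    rw [expY, he]
    push_cast at h2 ⊢
    linear_combination h1 - μ.usesF2 * h2 - M * h + (6 * r + 4) * hi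
  · rw [partB, partA, p.alphaTilde_one_mod, if_neg (by omega), mul_neg, mul_neg, ← zpow_add₀ hq0,
      ← zpow_add₀ hq0]
    refine congrArg (fun e : ℤ => -q ^ e) (int_eq_of_two_mul_eq ?_)
    have h := two_mul_quintExp (-(r + 1))
    have h1 := hexp (-r - 1)
    have h2 := two_mul_choose_succ (3 * r + 1)
    rw [expX, he, hμ]
    push_cast at h2 ⊢
    linear_combination h1 - μ.usesF2 * h2 - M * h

end Identities

end A22

namespace A22

/-! ### Limits of the final pairs and the simple factors -/

section Limits

variable {K : Type*} [NormedField K] {q : K}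

/-- The constant by which the sum of the sequence `α` of the final pair differs from the sum of the
differences of the two parts. -/
def sumConst (q : K) (p : PairNo) (μ : MoveSeq) (i : ℕ) : K :=
  if i = 0 then alphaConst q p μ else 1

/-- For `i ≥ 1` the final `α` pairs `partA` at `m + 1` with `partB` at `m`. Absolute convergence
allows the two sums to be separated and the index shift to be undone. -/
theorem MoveSeq.hasSum_run_alpha [CompleteSpace K] (hq0 : q ≠ 0) (hq1 : ‖q‖ < 1) {k : ℕ}
    (hk : 1 ≤ k) (i : ℕ) {p : PairNo} {μ : MoveSeq} (hμ : μ.Admissible p.exponent) {S : K}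
    (hA : Summable fun m => ‖partA q p μ k i m‖) (hB : Summable fun m => ‖partB q p μ k i m‖)
    (hS : HasSum (fun m => partA q p μ k i m - partB q p μ k i m) S) :
    (Summable fun m => ‖(μ.run q k i (p.pair q)).α m‖) ∧
      HasSum (μ.run q k i (p.pair q)).α (sumConst q p μ i * S) := by
  have hq := pow_ne_one_of_norm_lt_one hq1
  have hq' := neg_pow_ne_one_of_norm_lt_one hq1
  rcases Nat.eq_zero_or_pos i with rfl | hi
  · have h := funext fun m => run_alpha_of_eq_zero hq0 hq hq' hk hμ m
    rw [h, sumConst, if_pos rfl]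
    refine ⟨?_, hS.mul_left _⟩
    simp only [norm_mul]
    exact ((hA.add hB).of_nonneg_of_le (fun _ => norm_nonneg _) fun m =>
      norm_sub_le _ _).mul_left _
  · have h0 := run_alpha_head hq0 hq hk hi p μ
    have h1 := run_alpha_succ hq0 hq hq' hk hi hμ
    have hA' := (summable_nat_add_iff 1).2 hA
    rw [sumConst, if_neg (by omega), one_mul]
    refine ⟨(summable_nat_add_iff 1).1 ?_, ?_⟩
    · simp only [h1]
      exact (hA'.add hB).of_nonneg_of_le (fun _ => norm_nonneg _) fun m => norm_sub_le _ _
    · have a := hA.of_norm.hasSum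
      have b := hB.of_norm.hasSum
      have a' := (hasSum_nat_add_iff' 1).2 a
      rw [hS.unique (a.sub b)]
      have c := a'.sub b
      rw [← funext h1] at c
      have d := (hasSum_nat_add_iff 1).1 c
      rw [sum_range_one, sum_range_one, h0] at d
      have e : ∀ a b c : K, a - c - b + c = a - b := fun a b c => by ring
      rwa [e] at d

/-- With final base `q^e` the quotient `(q)_∞ / (q^{e+1})_∞` is `(1 - q) ⋯ (1 - q^e)`. For `i = 0`
the constant of `α` cancels `1 - q^e`, except in kind (II), where it cancels `1 - q`. -/
theorem sumConst_mul_div [CompleteSpace K] (hq0 : q ≠ 0) (hq1 : ‖q‖ < 1) (i : ℕ) {p : PairNo}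
    {μ : MoveSeq} (hμ : μ.Admissible p.exponent) (x : K) :
    sumConst q p μ i * (x * qPochInf q q) / qPochInf (finalBase q (p.base q) i * q) q =
      simpleFactor q p μ i * x := by
  have h1 : 1 - q ≠ 0 := by
    have := pow_ne_one_of_norm_lt_one hq1 1 le_rfl
    rw [pow_one] at this
    exact sub_ne_zero.2 this.symm
  have h2 : 1 - q ^ 2 ≠ 0 :=
    sub_ne_zero.2 (pow_ne_one_of_norm_lt_one hq1 2 (by omega)).symm
  have e1 := qPochInf_eq_mul hq1 q
  have e2 := qPochInf_eq_mul hq1 (q * q)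
  have i1 : qPochInf (q ^ 3) q ≠ 0 := qPochInf_ne_zero hq1 fun n => by
    rw [← pow_add]
    exact pow_ne_one_of_norm_lt_one hq1 _ (by omega)
  have e : q * q = q ^ 2 := by ring
  have h2' : 1 - q * q ≠ 0 := by rwa [e]
  rcases Nat.eq_zero_or_pos i with rfl | hi
  · cases p <;> cases μ <;> simp [MoveSeq.Admissible, PairNo.exponent] at hμ <;>
      simp only [sumConst, alphaConst, finalBase, if_true, PairNo.base, PairNo.exponent,
        simpleFactor, pow_one, ← e] <;> rw [e1, e2] <;> field_simp
  · have h3 : q ^ 2 / q = q := by field_simp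
    have h4 : q / q = 1 := div_self hq0
    have h0 : i ≠ 0 := by omega
    cases p <;> cases μ <;> simp [MoveSeq.Admissible, PairNo.exponent] at hμ <;>
      simp only [sumConst, finalBase, if_neg h0, PairNo.base, simpleFactor, h3, h4, one_mul] <;>
      rw [e1, e2] <;> field_simp

/-- The exponent may be 0 after a base change from `q`, but not if the last move is F2; this is what
`IsBaileyPair.moveF2_limit` requires of the base. -/
theorem MoveSeq.exists_finalBase_eq_pow (hq0 : q ≠ 0) (k i : ℕ) {p : PairNo} {μ : MoveSeq}
    (hμ : μ.Admissible p.exponent) :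
    ∃ e : ℕ, finalBase q (p.base q) i = q ^ e ∧ (μ.lastF2 k i → 1 ≤ e) := by
  have he : p.exponent = 1 ∨ p.exponent = 2 := by cases p <;> simp [PairNo.exponent]
  rw [p.base_eq, finalBase]
  split_ifs with h0
  · exact ⟨_, rfl, fun _ => by omega⟩
  · refine ⟨p.exponent - 1, ?_, fun h => ?_⟩
    · rw [div_eq_iff hq0, ← pow_succ, Nat.sub_add_cancel (by omega)]
    · cases μ
      · exact absurd h Bool.false_ne_true
      · have : p.exponent = 2 := hμ
        omega
      · exact absurd (of_decide_eq_true h).2 h0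

/-- The limit of the sequence `β` of the final pair, and the infinite multi-sum. -/
theorem MoveSeq.tendsto_and_hasSum [CompleteSpace K] (hq0 : q ≠ 0) (hq1 : ‖q‖ < 1)
    (h2 : (2 : K) ≠ 0) {k : ℕ} (hk : 1 ≤ k) (i : ℕ) {p : PairNo} {μ : MoveSeq}
    (hμ : μ.Admissible p.exponent) {x : K}
    (hS : (Summable fun m => ‖partA q p μ k i m‖) ∧ (Summable fun m => ‖partB q p μ k i m‖) ∧
      HasSum (fun m => partA q p μ k i m - partB q p μ k i m) (x * qPochInf q q)) :
    Tendsto (fun n => qPochInf q q * (μ.run q k i (p.pair q)).β n) atTop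
        (𝓝 (simpleFactor q p μ i * x)) ∧
      HasSum (sumSideTerm q p μ k i) (simpleFactor q p μ i * x) := by
  have hq := pow_ne_one_of_norm_lt_one hq1
  have hq' := neg_pow_ne_one_of_norm_lt_one hq1
  have hP := μ.isBaileyPair_penultimate hq0 hq hq' h2 k i p
  have hb : (μ.penultimate q k i (p.pair q)).base = finalBase q (p.base q) i :=
    μ.penultimate_base q k i (p.pair q)
  obtain ⟨hs, hA⟩ := hasSum_run_alpha hq0 hq1 hk i hμ hS.1 hS.2.1 hS.2.2
  obtain ⟨e, hfe, hle⟩ := exists_finalBase_eq_pow hq0 k i hμ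
  have ha : ∀ n, 1 ≤ n → (μ.penultimate q k i (p.pair q)).base * q ^ n ≠ 1 := fun n hn => by
    rw [hb, hfe, ← pow_add]; exact hq _ (by omega)
  have ha0 : (μ.penultimate q k i (p.pair q)).base ≠ 0 := by
    rw [hb, hfe]; exact pow_ne_zero _ hq0
  have hbase : (p.pair q).base ≠ 0 := by
    rw [show (p.pair q).base = q ^ p.exponent from p.base_eq q]; exact pow_ne_zero _ hq0
  have hside : sumSideTerm q p μ k i = fun N => μ.lastWeight q (p.base q) k i N *
      (μ.penultimate q k i (p.pair q)).β N /
        μ.outer (fun x => qPochInf x q) q (p.base q) k i := by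
    funext N
    rw [sumSideTerm, ← sum_div]
    congr 1
    exact μ.sum_summand hq0 hbase hk i N
  rw [run_eq hq0 hk] at hs hA ⊢
  rw [hside, ← sumConst_mul_div hq0 hq1 i hμ, ← hb]
  by_cases h : μ.lastF2 k i
  · rw [if_pos h] at hs hA ⊢
    have ho : μ.outer (fun x => qPochInf x q) q (p.base q) k i =
        qPochInf (-finalBase q (p.base q) i) q := by
      cases μ
      · exact absurd h Bool.false_ne_true
      · simp only [outer, finalBase]; split_ifs <;> rfl
      · simp only [outer, finalBase, if_pos (of_decide_eq_true h), if_pos (of_decide_eq_true h).2]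
    have := hP.moveF2_limit hq0 hq1 ha ha0 (by
      rw [hb, hfe, norm_pow]
      exact pow_le_of_le_one (norm_nonneg _) hq1.le (by have := hle h; omega)) hs hA
    simpa only [lastWeight, if_pos h, ho, hb] using this
  · rw [if_neg h] at hs hA ⊢
    have ho : μ.outer (fun x => qPochInf x q) q (p.base q) k i = 1 := by
      cases μ
      · rfl
      · exact absurd rfl h
      · simp only [outer, if_neg (mt decide_eq_true h)]
    have := hP.moveF1_limit hq0 hq1 ha ha0 (by
      rw [hb, hfe, norm_pow]
      exact pow_le_one₀ (norm_nonneg _) hq1.le) hs hA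
    simpa only [lastWeight, if_neg h, ho, hb, div_one] using this

theorem MoveSeq.isBaileyPair_run (hq0 : q ≠ 0) (hq1 : ‖q‖ < 1) (h2 : (2 : K) ≠ 0) {k : ℕ}
    (hk : 1 ≤ k) (i : ℕ) {p : PairNo} {μ : MoveSeq} (hμ : μ.Admissible p.exponent) :
    IsBaileyPair q (μ.run q k i (p.pair q)) := by
  have hq := pow_ne_one_of_norm_lt_one hq1
  have hq' := neg_pow_ne_one_of_norm_lt_one hq1
  have hP := μ.isBaileyPair_penultimate hq0 hq hq' h2 k i p
  have hb : (μ.penultimate q k i (p.pair q)).base = finalBase q (p.base q) i :=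
    μ.penultimate_base q k i (p.pair q)
  obtain ⟨e, hfe, hle⟩ := exists_finalBase_eq_pow hq0 k i hμ
  have ha : ∀ n, 1 ≤ n → (μ.penultimate q k i (p.pair q)).base * q ^ n ≠ 1 := fun n hn => by
    rw [hb, hfe, ← pow_add]; exact hq _ (by omega)
  rw [run_eq hq0 hk]
  split_ifs with h
  · exact hP.moveF2 hq ha fun n => by
      rw [hb, hfe, neg_mul, ← pow_add]
      exact hq' _ (by have := hle h; omega)
  · exact hP.moveF1 hq ha

end Limits

end A22

namespace A22

/-! ### Principal characters and the list of identities -/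

theorem principalChar_eq_quintupleQ {K : Type*} [NormedField K] [CompleteSpace K] {q : K}
    (hq0 : q ≠ 0) (hq1 : ‖q‖ < 1) (s₀ s₁ : ℕ) :
    principalChar q s₀ s₁ =
      quintupleQ (q ^ (s₀ + 2 * s₁ + 3)) (q ^ (-(s₁ : ℤ) - 1)) / qPochInf q q := by
  have hM : ∀ n : ℕ, 1 ≤ n → ‖q ^ n‖ < 1 := fun n hn => by
    rw [norm_pow]; exact pow_lt_one₀ (norm_nonneg _) hq1 (by omega)
  have h1 := hM (s₀ + 2 * s₁ + 3) (by omega)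
  have h2 := hM (2 * (s₀ + 2 * s₁ + 3)) (by omega)
  rw [principalChar, quintupleQ]
  congr 1
  simp only [qPochInf]
  have m1 := multipliable_qPoch h1 (q ^ (s₁ + 1))
  have m2 := multipliable_qPoch h1 (q ^ (s₀ + s₁ + 2))
  have m3 := multipliable_qPoch h1 (q ^ (s₀ + 2 * s₁ + 3))
  have m4 := multipliable_qPoch h2 (q ^ (s₀ + 1))
  have m5 := multipliable_qPoch h2 (q ^ (s₀ + 4 * s₁ + 5))
  rw [← m1.tprod_mul m2, ← (m1.mul m2).tprod_mul m3, ← ((m1.mul m2).mul m3).tprod_mul m4,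
    ← (((m1.mul m2).mul m3).mul m4).tprod_mul m5]
  refine tprod_congr fun n => ?_
  -- In terms of `t` and `u = q^{s₀+1}` one has `q^M = u t²`, and the second argument of
  -- `quintupleQ` is `t⁻¹`; the products then agree factor by factor.
  set t := q ^ (s₁ + 1) with ht
  have ht0 : t ≠ 0 := pow_ne_zero _ hq0
  have e0 : q ^ (-(s₁ : ℤ) - 1) = t⁻¹ := by
    rw [ht, ← zpow_natCast, ← zpow_neg]; congr 1; push_cast; ring
  have e1 : q ^ (s₀ + 2 * s₁ + 3) = q ^ (s₀ + 1) * t ^ 2 := by rw [ht]; ring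
  have e2 : q ^ (s₀ + s₁ + 2) = q ^ (s₀ + 1) * t := by rw [ht]; ring
  have e3 : q ^ (s₀ + 4 * s₁ + 5) = q ^ (s₀ + 1) * t ^ 4 := by rw [ht]; ring
  have e4 : q ^ (2 * (s₀ + 2 * s₁ + 3)) = (q ^ (s₀ + 1) * t ^ 2) ^ 2 := by rw [ht]; ring
  rw [e0, e1, e2, e3, e4, inv_inv]
  clear_value t
  generalize q ^ (s₀ + 1) = u
  have f1 : (u * t ^ 2) ^ (n + 1) * t⁻¹ = u * t * (u * t ^ 2) ^ n := by
    rw [pow_succ]; field_simp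
  have f2 : (u * t ^ 2) ^ (2 * n + 1) * t⁻¹ ^ 2 = u * ((u * t ^ 2) ^ 2) ^ n := by
    rw [← pow_mul, pow_succ]; field_simp
  have f3 : (u * t ^ 2) ^ (2 * n + 1) * (t⁻¹ ^ 2)⁻¹ = u * t ^ 4 * ((u * t ^ 2) ^ 2) ^ n := by
    rw [← pow_mul, pow_succ, inv_pow, inv_inv]; ring
  rw [f1, f2, f3]
  ring

/-! ### Modules of a given level and the arithmetic of the table -/

theorem bijOn_modulesOfLevel {l m : ℕ} (hm : m = l / 2) {f : ℕ → ℕ}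
    (hf : Set.BijOn f (Set.Iic m) (Set.Iic m)) :
    Set.BijOn (fun i => (l - 2 * f i, f i)) (Set.Iic m) (modulesOfLevel l) := by
  refine ⟨fun i hi => ?_, fun i hi j hj h => hf.injOn hi hj (Prod.mk.inj h).2, fun s hs => ?_⟩
  · have h := hf.mapsTo hi
    simp only [Set.mem_Iic, modulesOfLevel, Set.mem_ofPred_eq] at h ⊢
    omega
  · simp only [modulesOfLevel, Set.mem_ofPred_eq] at hs
    -- A module of level `l` is determined by `s₁ ≤ l / 2`, so any permutation `f` of this range
    -- labels all of them; the table uses the identity and the reflection.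
    obtain ⟨i, hi, h⟩ := hf.surjOn (show s.2 ∈ Set.Iic m by simp only [Set.mem_Iic]; omega)
    refine ⟨i, hi, Prod.ext ?_ h⟩
    simp only [h]
    omega

theorem ncard_modulesOfLevel (l : ℕ) : (modulesOfLevel l).ncard = l / 2 + 1 := by
  have h := bijOn_modulesOfLevel (l := l) rfl (Set.bijOn_id _)
  rw [← h.image_eq, h.injOn.ncard_image, ← Finset.coe_Iic, Set.ncard_coe_finset,
    Nat.card_Iic]

theorem bijOn_reflect (m : ℕ) : Set.BijOn (fun i => m - i) (Set.Iic m) (Set.Iic m) := by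
  refine ⟨fun i _ => ?_, fun i hi j hj h => ?_, fun i hi => ⟨m - i, ?_, ?_⟩⟩ <;>
    simp only [Set.mem_Iic] at * <;> omega

theorem table_modules (r : Fin 10) {k : ℕ} (hk : 1 ≤ k) :
    (table r).modulus k = 2 * (table r).level k + 6 ∧
      (table r).numModules k = (modulesOfLevel ((table r).level k)).ncard ∧
      Set.BijOn (fun i => ((table r).level k - 2 * (table r).s₁ k i, (table r).s₁ k i))
        (Set.Iic ((table r).iMax k)) (modulesOfLevel ((table r).level k)) := by
  rw [ncard_modulesOfLevel]
  have hm : (table r).iMax k = (table r).level k / 2 := by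
    fin_cases r <;> simp only [table] <;> simp <;> omega
  refine ⟨?_, ?_, bijOn_modulesOfLevel hm ?_⟩
  · fin_cases r <;> simp [table] <;> omega
  · fin_cases r <;> simp [table] <;> omega
  · fin_cases r
    all_goals first | exact Set.bijOn_id _ | exact bijOn_reflect _

/-- Writing the levels without subtraction reduces the remaining questions about rows to linear
arithmetic: the six rows have levels in six different classes modulo 6. -/
theorem table_base_one (r : Fin 10) {k : ℕ} (hk : 1 ≤ k) :
    (table r).pair ∈ ({.one, .three, .five} : Set PairNo) ↔
      r = 0 ∧ (table r).level k = 6 * k + 1 ∨ r = 1 ∧ (table r).level k + 2 = 6 * k ∨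
      r = 4 ∧ (table r).level k + 1 = 6 * k ∨ r = 5 ∧ (table r).level k + 4 = 6 * k ∨
      r = 8 ∧ (table r).level k = 6 * k ∨ r = 9 ∧ (table r).level k + 3 = 6 * k := by
  fin_cases r <;> simp [table] <;> omega

theorem table_base_two (r : Fin 10) {k : ℕ} (hk : 1 ≤ k) :
    (table r).pair ∈ ({.two, .four} : Set PairNo) ↔
      r = 2 ∧ (table r).level k = 6 * k + 1 ∨ r = 3 ∧ (table r).level k + 2 = 6 * k ∨
      r = 6 ∧ (table r).level k + 1 = 6 * k ∨ r = 7 ∧ (table r).level k + 4 = 6 * k := by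
  fin_cases r <;> simp [table] <;> omega

theorem level_modEq_iff {r r' : Fin 10} {k k' : ℕ} (hk : 1 ≤ k) (hk' : 1 ≤ k')
    (h : (table r).pair ∈ ({.one, .three, .five} : Set PairNo))
    (h' : (table r').pair ∈ ({.one, .three, .five} : Set PairNo)) :
    (table r).level k ≡ (table r').level k' [MOD 6] ↔ r = r' := by
  rw [table_base_one r hk] at h
  rw [table_base_one r' hk'] at h'
  rw [Nat.ModEq]
  generalize (table r).level k = l at *
  generalize (table r').level k' = l' at *
  omega

theorem existsUnique_row_of_base_one {l : ℕ} (hl : 2 ≤ l) : ∃! rk : Fin 10 × ℕ,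
    (table rk.1).pair ∈ ({.one, .three, .five} : Set PairNo) ∧
      1 ≤ rk.2 ∧ (table rk.1).level rk.2 = l := by
  have h : l % 6 = 0 ∨ l % 6 = 1 ∨ l % 6 = 2 ∨ l % 6 = 3 ∨ l % 6 = 4 ∨ l % 6 = 5 := by omega
  have key : ∃ (r : Fin 10) (k : ℕ), (table r).pair ∈ ({.one, .three, .five} : Set PairNo) ∧
      1 ≤ k ∧ (table r).level k = l := by
    -- The residue of `l` selects the row. For residues 0 and 1 the assumption `2 ≤ l` ensures `l /
    -- 6 ≥ 1`; in the other rows `k` is one larger than `l / 6`.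
    rcases h with h | h | h | h | h | h
    · exact ⟨8, l / 6, by simp [table], by omega, by simp [table]; omega⟩
    · exact ⟨0, l / 6, by simp [table], by omega, by simp [table]; omega⟩
    · exact ⟨5, l / 6 + 1, by simp [table], by omega, by simp [table]; omega⟩
    · exact ⟨9, l / 6 + 1, by simp [table], by omega, by simp [table]; omega⟩
    · exact ⟨1, l / 6 + 1, by simp [table], by omega, by simp [table]; omega⟩
    · exact ⟨4, l / 6 + 1, by simp [table], by omega, by simp [table]; omega⟩
  obtain ⟨r, k, h1, h2, h3⟩ := key
  refine ⟨(r, k), ⟨h1, h2, h3⟩, fun ⟨r', k'⟩ ⟨h1', h2', h3'⟩ => ?_⟩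
  have e := (table_base_one r h2).1 h1
  have e' := (table_base_one r' h2').1 h1'
  simp only at h3'
  rw [h3] at e
  rw [h3'] at e'
  refine Prod.ext ?_ ?_ <;> simp only <;> omega

theorem existsUnique_row_of_base_two {l : ℕ} (hl : 2 ≤ l) (hl3 : ¬ 3 ∣ l) : ∃! rk : Fin 10 × ℕ,
    (table rk.1).pair ∈ ({.two, .four} : Set PairNo) ∧
      1 ≤ rk.2 ∧ (table rk.1).level rk.2 = l := by
  have h : l % 6 = 1 ∨ l % 6 = 2 ∨ l % 6 = 4 ∨ l % 6 = 5 := by omega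
  have key : ∃ (r : Fin 10) (k : ℕ), (table r).pair ∈ ({.two, .four} : Set PairNo) ∧
      1 ≤ k ∧ (table r).level k = l := by
    rcases h with h | h | h | h
    · exact ⟨2, l / 6, by simp [table], by omega, by simp [table]; omega⟩
    · exact ⟨7, l / 6 + 1, by simp [table], by omega, by simp [table]; omega⟩
    · exact ⟨3, l / 6 + 1, by simp [table], by omega, by simp [table]; omega⟩
    · exact ⟨6, l / 6 + 1, by simp [table], by omega, by simp [table]; omega⟩
  obtain ⟨r, k, h1, h2, h3⟩ := key
  refine ⟨(r, k), ⟨h1, h2, h3⟩, fun ⟨r', k'⟩ ⟨h1', h2', h3'⟩ => ?_⟩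
  have e := (table_base_two r h2).1 h1
  have e' := (table_base_two r' h2').1 h1'
  simp only at h3'
  rw [h3] at e
  rw [h3'] at e'
  refine Prod.ext ?_ ?_ <;> simp only <;> omega

theorem table_admissible (r : Fin 10) : (table r).moves.Admissible (table r).pair.exponent := by
  fin_cases r <;> simp [table, MoveSeq.Admissible, PairNo.exponent]

/-- In each row, the two parts of the sequence `α` of the final pair sum to the numerator of the
principal character. -/
theorem hasSum_parts {K : Type*} [NormedField K] [CompleteSpace K] {q : K} (hq0 : q ≠ 0)
    (hq1 : ‖q‖ < 1) (r : Fin 10) {k i s₀ s₁ : ℕ} (hk : 1 ≤ k) (hi : i ≤ (table r).iMax k)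
    (hs₁ : s₁ = (table r).s₁ k i) (hl : s₀ + 2 * s₁ = (table r).level k) :
    (Summable fun m => ‖partA q (table r).pair (table r).moves k i m‖) ∧
      (Summable fun m => ‖partB q (table r).pair (table r).moves k i m‖) ∧
      HasSum (fun m => partA q (table r).pair (table r).moves k i m -
        partB q (table r).pair (table r).moves k i m) (principalChar q s₀ s₁ * qPochInf q q) := by
  have h5 := PairNo.two_mul_expo_five
  -- In every row `M` is the level plus 3, and the required identities are polynomial in `r`, `k`
  -- and, for base `q²`, `i`. The bound on `i` is used to pass from natural to integer subtraction
  -- in `s₁`.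
  fin_cases r
  · change s₁ = i at hs₁
    change _ = 6 * k + 1 at hl
    subst hs₁
    refine hasSum_parts_of_base_one hq0 hq1 (p := .one) (μ := .noF2) rfl rfl
      (M := 6 * k + 4) (by omega) fun r => ?_
    simp only [PairNo.expo, MoveSeq.usesF2]
    ring
  · change s₁ = i at hs₁
    change _ = 6 * k - 2 at hl
    subst hs₁
    refine hasSum_parts_of_base_one hq0 hq1 (p := .one) (μ := .F2Begin) rfl rfl
      (M := 6 * k + 1) (by omega) fun r => ?_
    simp only [PairNo.expo, MoveSeq.usesF2]
    ring
  · change s₁ = 3 * k - i at hs₁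
    change i ≤ 3 * k at hi
    change _ = 6 * k + 1 at hl
    have hs : (s₁ : ℤ) = 3 * k - i := by omega
    refine hasSum_parts_of_base_two hq0 hq1 (p := .two) (μ := .noF2) rfl rfl
      (M := 6 * k + 4) (by omega) (fun r => ?_) ?_
    · simp only [PairNo.expo, MoveSeq.usesF2, hs]
      ring
    · simp only [MoveSeq.usesF2, hs]
      ring
  · change s₁ = 3 * k - 1 - i at hs₁
    change i ≤ 3 * k - 1 at hi
    change _ = 6 * k - 2 at hl
    have hs : (s₁ : ℤ) = 3 * k - 1 - i := by omega
    refine hasSum_parts_of_base_two hq0 hq1 (p := .two) (μ := .F2End) rfl rfl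
      (M := 6 * k + 1) (by omega) (fun r => ?_) ?_
    · simp only [PairNo.expo, MoveSeq.usesF2, hs]
      ring
    · simp only [MoveSeq.usesF2, hs]
      ring
  · change s₁ = i at hs₁
    change _ = 6 * k - 1 at hl
    subst hs₁
    refine hasSum_parts_of_base_one hq0 hq1 (p := .three) (μ := .noF2) rfl rfl
      (M := 6 * k + 2) (by omega) fun r => ?_
    simp only [PairNo.expo, MoveSeq.usesF2]
    ring
  · change s₁ = i at hs₁
    change _ = 6 * k - 4 at hl
    subst hs₁
    refine hasSum_parts_of_base_one hq0 hq1 (p := .three) (μ := .F2Begin) rfl rfl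
      (M := 6 * k - 1) (by omega) fun r => ?_
    simp only [PairNo.expo, MoveSeq.usesF2]
    ring
  · change s₁ = 3 * k - 1 - i at hs₁
    change i ≤ 3 * k - 1 at hi
    change _ = 6 * k - 1 at hl
    have hs : (s₁ : ℤ) = 3 * k - 1 - i := by omega
    refine hasSum_parts_of_base_two hq0 hq1 (p := .four) (μ := .noF2) rfl rfl
      (M := 6 * k + 2) (by omega) (fun r => ?_) ?_
    · simp only [PairNo.expo, MoveSeq.usesF2, hs]
      ring
    · simp only [MoveSeq.usesF2, hs]
      ring
  · change s₁ = 3 * k - 2 - i at hs₁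
    change i ≤ 3 * k - 2 at hi
    change _ = 6 * k - 4 at hl
    have hs : (s₁ : ℤ) = 3 * k - 2 - i := by omega
    refine hasSum_parts_of_base_two hq0 hq1 (p := .four) (μ := .F2End) rfl rfl
      (M := 6 * k - 1) (by omega) (fun r => ?_) ?_
    · simp only [PairNo.expo, MoveSeq.usesF2, hs]
      ring
    · simp only [MoveSeq.usesF2, hs]
      ring
  · change s₁ = i at hs₁
    change _ = 6 * k at hl
    subst hs₁
    refine hasSum_parts_of_base_one hq0 hq1 (p := .five) (μ := .noF2) rfl rfl
      (M := 6 * k + 3) (by omega) fun r => ?_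
    simp only [h5, MoveSeq.usesF2]
    ring
  · change s₁ = i at hs₁
    change _ = 6 * k - 3 at hl
    subst hs₁
    refine hasSum_parts_of_base_one hq0 hq1 (p := .five) (μ := .F2Begin) rfl rfl
      (M := 6 * k) (by omega) fun r => ?_
    simp only [h5, MoveSeq.usesF2]
    ring

end A22

theorem mainTheorem1 {K : Type*} [NormedField K] [CompleteSpace K] [CharZero K]
    (q : K) (hq0 : q ≠ 0) (hq1 : ‖q‖ < 1) :
    -- the five initial pairs are Bailey pairs
    (∀ p : A22.PairNo, A22.IsBaileyPair q (p.pair q)) ∧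
    -- the principal characters are specializations of the quintuple product
    (∀ s₀ s₁ : ℕ, A22.principalChar q s₀ s₁ =
      A22.quintupleQ (q ^ (s₀ + 2 * s₁ + 3)) (q ^ (-(s₁ : ℤ) - 1)) / A22.qPochInf q q) ∧
    -- each row of the list gives every module of its level exactly once
    (∀ (r : Fin 10) (k : ℕ), 1 ≤ k →
      (A22.table r).modulus k = 2 * (A22.table r).level k + 6 ∧
      (A22.table r).numModules k = (A22.modulesOfLevel ((A22.table r).level k)).ncard ∧
      Set.BijOn
        (fun i => ((A22.table r).level k - 2 * (A22.table r).s₁ k i, (A22.table r).s₁ k i))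
        (Set.Iic ((A22.table r).iMax k)) (A22.modulesOfLevel ((A22.table r).level k))) ∧
    -- the identities
    (∀ (r : Fin 10) (k i s₀ s₁ : ℕ), 1 ≤ k → i ≤ (A22.table r).iMax k →
      s₁ = (A22.table r).s₁ k i → s₀ + 2 * s₁ = (A22.table r).level k →
      -- the moves lead to a Bailey pair
      A22.IsBaileyPair q ((A22.table r).moves.run q k i ((A22.table r).pair.pair q)) ∧
      -- its sequence `β` is given by the explicit multi-sum
      (∀ n : ℕ, ((A22.table r).moves.run q k i ((A22.table r).pair.pair q)).β n =
        A22.multiSum q (A22.table r).pair (A22.table r).moves k i n) ∧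
      -- `(q)_∞ β_n` tends to the principal character times the simple factor
      Tendsto
        (fun n => A22.qPochInf q q *
          ((A22.table r).moves.run q k i ((A22.table r).pair.pair q)).β n) atTop
        (𝓝 (A22.simpleFactor q (A22.table r).pair (A22.table r).moves i *
          A22.principalChar q s₀ s₁)) ∧
      -- which is the sum of the infinite multi-sum
      HasSum (A22.sumSideTerm q (A22.table r).pair (A22.table r).moves k i)
        (A22.simpleFactor q (A22.table r).pair (A22.table r).moves i *
          A22.principalChar q s₀ s₁)) ∧
    -- the pairs 1, 3, 5 cover every level `l ≥ 2` exactly once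
    (∀ l : ℕ, 2 ≤ l → ∃! rk : Fin 10 × ℕ,
      (A22.table rk.1).pair ∈ ({.one, .three, .five} : Set A22.PairNo) ∧
      1 ≤ rk.2 ∧ (A22.table rk.1).level rk.2 = l) ∧
    -- their six rows are six families, according to the level modulo 6
    (∀ (r r' : Fin 10) (k k' : ℕ), 1 ≤ k → 1 ≤ k' →
      (A22.table r).pair ∈ ({.one, .three, .five} : Set A22.PairNo) →
      (A22.table r').pair ∈ ({.one, .three, .five} : Set A22.PairNo) →
      ((A22.table r).level k ≡ (A22.table r').level k' [MOD 6] ↔ r = r')) ∧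
    -- the pairs 2, 4 also cover every level that is not divisible by 3
    (∀ l : ℕ, 2 ≤ l → ¬ 3 ∣ l → ∃! rk : Fin 10 × ℕ,
      (A22.table rk.1).pair ∈ ({.two, .four} : Set A22.PairNo) ∧
      1 ≤ rk.2 ∧ (A22.table rk.1).level rk.2 = l) := by
  have hq := A22.pow_ne_one_of_norm_lt_one hq1
  -- Characteristic zero enters only here; it is needed for the products `(-1)_n` of pair 5.
  have h2 : (2 : K) ≠ 0 := two_ne_zero
  refine ⟨fun p => p.isBaileyPair hq0 hq h2, A22.principalChar_eq_quintupleQ hq0 hq1,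
    fun r _ hk => A22.table_modules r hk, fun r k i s₀ s₁ hk hi hs₁ hl => ?_,
    fun _ hl => A22.existsUnique_row_of_base_one hl,
    fun _ _ _ _ hk hk' h h' => A22.level_modEq_iff hk hk' h h',
    fun _ hl hl3 => A22.existsUnique_row_of_base_two hl hl3⟩
  have hμ := A22.table_admissible r
  exact ⟨A22.MoveSeq.isBaileyPair_run hq0 hq1 h2 hk i hμ,
    fun n => A22.MoveSeq.run_beta_eq_multiSum hq0 hk i n _ _,
    A22.MoveSeq.tendsto_and_hasSum hq0 hq1 h2 hk i hμ (A22.hasSum_parts hq0 hq1 r hk hi hs₁ hl)⟩
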